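/- **Setting.** Fix $\mu,n\ge 0$, $X=\{x_1,\dots,x_\mu\}$, $X'=\{x'_1,\dots,x'_\mu\}$ and a further label $k$. Diagrams are finite uni-trivalent graphs (edges without vertices, i.e. struts, have two univalent ends) with a cyclic order at every trivalent vertex and with labelled univalent vertices (legs); the degree of a diagram is half the number of all its vertices, univalent and trivalent. For a set $A$ of labels containing $k$, let $B(A,\underline{k})$ be the degree-completion of the space of finite $\mathbb{Q}$-linear combinations of diagrams with legs labelled in $A$, modulo AS, IHX and the link relations for $k$: for any diagram with one distinguished leg $*$, the sum of all diagrams obtained by attaching $*$ to the edge next to a leg labelled $k$ (over all legs labelled $k$) is zero. Let $B_{\le n}$ be its quotient by the diagrams of degree greater than $n$, and let $B^{o}$ be defined as $B$, except that diagrams may also have finitely many closed dashed loops. **Formal integration.** For a diagram $D$, possibly with closed dashed loops, with legs labelled in $X\cup X'\cup\{k\}$, the element $\int^{(n)}dX\,D\in B_{\le n}(X',\underline{k})$ is $$\Big\langle \prod_{i=1}^{\mu}\frac{1}{n!}\Big(\frac12\; {}_{x_i}\!\frown_{x_i}\Big)^{n},\,D\Big\rangle,$$ the sum of all ways of gluing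 all the $X$-labelled legs of the $n$ chords for each $i$ to all the $X$-labelled legs of $D$, labels matching (zero if the numbers do not agree), in which every closed dashed loop is then replaced by the factor $-2n$. It is extended linearly to series of diagrams (finite combinations in each degree). **Translation.** Let $M(k)=(M_{ij}(k))$ be a $\mu\times\mu$ matrix with entries in $\mathbb{Q}[[k]]$. For a series $F(\overline{x},k)$ of diagrams with legs labelled in $X\cup\{k\}$, the series $F(\overline{x}+M(k)\overline{x}',k)$ is obtained by replacing every diagram by the sum of all diagrams obtained by, for each leg labelled by some $x_i$, either keeping it or, for some $j$, relabelling it $x'_j$ and inserting on its edge a coupon labelled $M_{ij}(k)$. Here a coupon labelled $\sum_m f_mk^m$ stands for $\sum_m f_m$ times the edge with $m$ new legs labelled $k$ attached to it, all from the same side: at each new vertex the cyclic order is (edge coming from the diagram, new $k$-leg, edge leading to the relabelled leg). **Theorem (Translation invariance).** Let $M(k)$ be any $\mu\times\mu$ matrix over $\mathbb{Q}[[k]]$ and let $F\in B(X,\underline{k})$. Then $$\int^{(n)}dX\,F(\overline{x},k)=\int^{(n)}dX\,F(\overline{x}+M(k)\overline{x}',k)\quad\text{in } B_{\le n}(X',\underline{k}),$$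 where both sides may be computed from any series of diagrams representing $F$: if $F_1$ and $F_2$ are series of diagrams (without closed dashed loops, with legs labelled in $X\cup\{k\}$) both representing $F$, then $$\int^{(n)}dX\,F_1(\overline{x},k)=\int^{(n)}dX\,F_2(\overline{x}+M(k)\overline{x}',k)\quad\text{in } B_{\le n}(X',\underline{k}).$$ -/

import Mathlib

/-! ### Uni-trivalent diagrams

A diagram is presented by its finite set `H` of half-edges.  The fixed-point-free involution `e`
pairs the two halves of every edge, and the cycles of the permutation `σ` are the vertices:
a fixed point is a univalent vertex (a *leg*), a 2-cycle is a mere subdivision point of an edge,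
a 3-cycle is a trivalent vertex together with its cyclic order.  Subdivision points carry no
information: they are erased by a relation below, and they serve to present closed dashed loops
(components all of whose vertices are subdivision points).
Only the labels of legs matter; `label` has irrelevant values on all other half-edges. -/

/-- Uni-trivalent diagrams (possibly with closed dashed loops) with legs labelled in `L`. -/
structure Diagram (L : Type) : Type 1 where
  H : Type
  finite : Finite H
  e : Equiv.Perm H
  σ : Equiv.Perm H
  label : H → L
  e_e : ∀ h, e (e h) = h
  e_ne : ∀ h, e h ≠ h
  valence : ∀ h, σ h = h ∨ σ (σ h) = h ∨ σ (σ (σ h)) = h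

namespace Diagram

variable {L : Type}

/-- `h` is (the half-edge at) a univalent vertex. -/
def IsLeg (D : Diagram L) (h : D.H) : Prop := D.σ h = h

/-- `h` belongs to a subdivision point. -/
def IsBiv (D : Diagram L) (h : D.H) : Prop := D.σ h ≠ h ∧ D.σ (D.σ h) = h

/-- `h` belongs to a trivalent vertex. -/
def IsTri (D : Diagram L) (h : D.H) : Prop := D.σ h ≠ h ∧ D.σ (D.σ h) ≠ h

/-- The degree: half the number of all (univalent and trivalent) vertices.  That number is even,
so the division is exact. -/
noncomputable def degree (D : Diagram L) : ℕ :=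
  (Nat.card {h : D.H // D.IsLeg h} + Nat.card {h : D.H // D.IsTri h} / 3) / 2

/-- Half-edges in the same connected component. -/
def conn (D : Diagram L) : Setoid D.H :=
  Relation.EqvGen.setoid fun a b => b = D.e a ∨ b = D.σ a

/-- `h` lies on a closed dashed loop: its component has subdivision points only. -/
def OnLoop (D : Diagram L) (h : D.H) : Prop := ∀ h', D.conn h h' → D.IsBiv h'

/-- The diagram has no closed dashed loop. -/
def LoopFree (D : Diagram L) : Prop := ∀ h, ¬ D.OnLoop h

/-- The number of closed dashed loops. -/
noncomputable def loops (D : Diagram L) : ℕ :=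
  Nat.card {c : Quotient D.conn // ∃ h, Quotient.mk D.conn h = c ∧ D.OnLoop h}

/-- All legs are labelled by elements of `A`. -/
def LabelledIn (D : Diagram L) (A : Set L) : Prop := ∀ h, D.IsLeg h → D.label h ∈ A

/-- Isomorphism of diagrams. -/
structure Iso (D D' : Diagram L) where
  f : D.H ≃ D'.H
  map_e : ∀ h, f (D.e h) = D'.e (f h)
  map_σ : ∀ h, f (D.σ h) = D'.σ (f h)
  map_label : ∀ h, D.IsLeg h → D'.label (f h) = D.label h

/-- The same edges, with the vertices transported along a permutation `ρ` of the half-edges. -/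
def conj (D : Diagram L) (ρ : Equiv.Perm D.H) : Diagram L where
  H := D.H
  finite := D.finite
  e := D.e
  σ := ρ * D.σ * ρ⁻¹
  label := D.label
  e_e := D.e_e
  e_ne := D.e_ne
  valence h := by
    obtain ⟨g, rfl⟩ := ρ.surjective h
    simpa using D.valence g

open Classical in
/-- The edges of `D` with a new subdivision point on the edge `{a, e a}`. -/
noncomputable def subdivideEdge (D : Diagram L) (a : D.H) : D.H ⊕ Bool → D.H ⊕ Bool
  | .inl h => if h = a then .inr false else if h = D.e a then .inr true else .inl (D.e h)
  | .inr false => .inl a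
  | .inr true => .inl (D.e a)

theorem subdivideEdge_involutive (D : Diagram L) (a : D.H) :
    Function.Involutive (D.subdivideEdge a) := by
  rintro (h | _ | _)
  · by_cases h1 : h = a
    · simp [subdivideEdge, h1]
    · by_cases h2 : h = D.e a
      · subst h2
        simp [subdivideEdge, D.e_ne]
      · have h3 : D.e h ≠ a := fun h3 => h2 (by rw [← h3, D.e_e])
        have h4 : D.e h ≠ D.e a := fun h4 => h1 (D.e.injective h4)
        simp [subdivideEdge, h1, h2, h3, h4, D.e_e, -EmbeddingLike.apply_eq_iff_eq]
  · simp [subdivideEdge]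
  · simp [subdivideEdge, D.e_ne]

/-- A new subdivision point on the edge `{a, e a}`. -/
noncomputable def subdivide (D : Diagram L) (a : D.H) : Diagram L where
  H := D.H ⊕ Bool
  finite := by have := D.finite; infer_instance
  e := (D.subdivideEdge_involutive a).toPerm
  σ := Equiv.sumCongr D.σ Equiv.boolNot
  label := Sum.elim D.label (fun _ => D.label a)
  e_e x := D.subdivideEdge_involutive a x
  e_ne x := by
    change D.subdivideEdge a x ≠ x
    rcases x with h | _ | _
    · simp only [subdivideEdge]
      split_ifs
      · simp
      · simp
      · simpa using D.e_ne h
    · simp [subdivideEdge]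
    · simp [subdivideEdge]
  valence x := by
    rcases x with h | b
    · simpa using D.valence h
    · right; left; simp

open Classical in
/-- For legs `u ≠ s`: attach the leg `s` to the edge ending in the leg `u`, near `u`.  A new edge
is added; one of its ends forms a trivalent vertex with `u` and `s` (in the cyclic order
`u`, `s`, new edge), and its other end is a leg labelled `l`. -/
noncomputable def attach (D : Diagram L) (l : L) (s u : D.H) (hs : D.IsLeg s) (hu : D.IsLeg u)
    (hne : u ≠ s) : Diagram L where
  H := D.H ⊕ Bool
  finite := by have := D.finite; infer_instance
  e := Equiv.sumCongr D.e Equiv.boolNot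
  σ := Equiv.sumCongr D.σ (Equiv.refl Bool) *
    (Equiv.swap (.inl u) (.inl s) * Equiv.swap (.inl s) (.inr false))
  label := Sum.elim D.label (fun _ => l)
  e_e x := by rcases x with h | b <;> simp [D.e_e]
  e_ne x := by rcases x with h | b <;> simp [D.e_ne]
  valence x := by
    have hu' : D.σ u = u := hu
    have hs' : D.σ s = s := hs
    rcases x with h | _ | _
    · by_cases h1 : h = u
      · subst h1
        right; right
        simp [Equiv.swap_apply_def, hu', hs', hne]
      · by_cases h2 : h = s
        · subst h2
          right; right
          simp [Equiv.swap_apply_def, hu', hs', hne]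
        · have key : ∀ g : D.H, g ≠ u → g ≠ s → D.σ g ≠ u ∧ D.σ g ≠ s := fun g hg hg' =>
            ⟨fun hh => hg (D.σ.injective (hh.trans hu'.symm)),
              fun hh => hg' (D.σ.injective (hh.trans hs'.symm))⟩
          obtain ⟨h3, h4⟩ := key h h1 h2
          obtain ⟨h5, h6⟩ := key _ h3 h4
          simpa [Equiv.swap_apply_def, h1, h2, h3, h4, h5, h6] using D.valence h
    · right; right
      simp [Equiv.swap_apply_def, hu', hs', hne]
    · left
      simp [Equiv.swap_apply_def]

/-- Delete all closed dashed loops. -/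
def dropLoops (D : Diagram L) : Diagram L where
  H := {h : D.H // ¬ D.OnLoop h}
  finite := by have := D.finite; infer_instance
  e := D.e.subtypePerm fun h => not_congr
    ⟨fun H h' hh => H h' ((Relation.EqvGen.symm _ _ (.rel _ _ (.inl rfl))).trans _ _ _ hh),
      fun H h' hh => H h' (.trans _ _ _ (.rel _ _ (.inl rfl)) hh)⟩
  σ := D.σ.subtypePerm fun h => not_congr
    ⟨fun H h' hh => H h' ((Relation.EqvGen.symm _ _ (.rel _ _ (.inr rfl))).trans _ _ _ hh),
      fun H h' hh => H h' (.trans _ _ _ (.rel _ _ (.inr rfl)) hh)⟩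
  label h := D.label h.1
  e_e h := Subtype.ext (D.e_e h.1)
  e_ne h hh := D.e_ne h.1 (congrArg Subtype.val hh)
  valence h := by
    rcases D.valence h.1 with h1 | h1 | h1
    · exact .inl (Subtype.ext h1)
    · exact .inr (.inl (Subtype.ext h1))
    · exact .inr (.inr (Subtype.ext h1))

/-! ### Relations -/

/-- A diagram as a vector. -/
noncomputable def vec (D : Diagram L) : Diagram L →₀ ℚ := Finsupp.single D 1

open Classical in
/-- The defining relations of the spaces of diagrams: isomorphic diagrams are identified,
subdivision points are erased, AS, IHX, and the link relations for the (underlined) labels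
in `S`. -/
inductive Relator (S : Set L) : (Diagram L →₀ ℚ) → Prop
  | iso {D D' : Diagram L} (f : Iso D D') : Relator S (D.vec - D'.vec)
  | subdivide (D : Diagram L) (a : D.H) : Relator S (D.vec - (D.subdivide a).vec)
  /-- Reversing the cyclic order at the trivalent vertex `(h, σ h, σ (σ h))` changes the sign. -/
  | antisymm (D : Diagram L) (h : D.H) (hh : D.IsTri h) :
      Relator S (D.vec + (D.conj (Equiv.swap (D.σ h) (D.σ (D.σ h)))).vec)
  /-- An edge `{a, e a}` joins distinct trivalent vertices `(a, b, c)` and `(e a, f, g)`; the three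
  diagrams obtained by cyclically permuting `b`, `c`, `f` add up to zero. -/
  | ihx (D : Diagram L) (a : D.H) (ha : D.IsTri a) (hd : D.IsTri (D.e a))
      (h1 : D.e a ≠ D.σ a) (h2 : D.e a ≠ D.σ (D.σ a))
      (ρ : Equiv.Perm D.H)
      (hρ : ρ = Equiv.swap (D.σ a) (D.σ (D.σ a)) * Equiv.swap (D.σ (D.σ a)) (D.σ (D.e a))) :
      Relator S (D.vec + (D.conj ρ).vec + (D.conj (ρ * ρ)).vec)
  /-- The sum of all ways of attaching a distinguished leg `s` (whose own label is ignored) to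
  the legs labelled `l` vanishes. -/
  | link (D : Diagram L) (l : L) (hl : l ∈ S) (s : D.H) (hs : D.IsLeg s) :
      Relator S (∑ᶠ u : {u : D.H // D.IsLeg u ∧ D.label u = l ∧ u ≠ s},
        (D.attach l s u.1 hs u.2.1 u.2.2.2).vec)

/-- The space of finite combinations of diagrams in `P`, modulo the relations that involve
diagrams in `P` only. -/
abbrev Space (P : Set (Diagram L)) (S : Set L) : Type 1 :=
  (P →₀ ℚ) ⧸ Submodule.span ℚ {r : P →₀ ℚ | Relator S (r.mapDomain Subtype.val)}

/-- The generators of `B(A)`: diagrams without closed dashed loops, with legs labelled in `A`. -/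
def gens (A : Set L) : Set (Diagram L) := {D | D.LoopFree ∧ D.LabelledIn A}

/-- The generators of `B(A)` in degree `d`. -/
def gensEq (A : Set L) (d : ℕ) : Set (Diagram L) := {D | D ∈ gens A ∧ D.degree = d}

/-- The generators of `B(A)` in degree at most `n`. -/
def gensLe (A : Set L) (n : ℕ) : Set (Diagram L) := {D | D ∈ gens A ∧ D.degree ≤ n}

/-- The space `B(A)`, completed with respect to the degree, with link relations for the labels
in `S`. -/
abbrev B (A S : Set L) : Type 1 := ∀ d : ℕ, Space (gensEq A d) S

/-- The space `B_{≤ n}(A)`, with link relations for the labels in `S`: the part of degree at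
most `n`, which is the quotient of `B(A)` by all diagrams of degree greater than `n`. -/
abbrev BLe (A S : Set L) (n : ℕ) : Type 1 := Space (gensLe A n) S

/-- The class in `B_{≤ n}(A)` of a diagram of `B(A)`; it vanishes in degrees greater than `n`. -/
noncomputable def BLe.mk (A S : Set L) (n : ℕ) (D : Diagram L) (hD : D ∈ gens A) : BLe A S n :=
  open Classical in
  if hn : D.degree ≤ n then Submodule.Quotient.mk (Finsupp.single ⟨D, hD, hn⟩ 1) else 0

/-- Formal series of diagrams without closed dashed loops and with legs labelled in `A`:
a finite rational combination in every degree. -/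
abbrev Series (A : Set L) : Type 1 := ∀ d : ℕ, gensEq A d →₀ ℚ

/-- Formal series of diagrams that may have closed dashed loops. -/
abbrev SeriesO (L : Type) : Type 1 := ∀ d : ℕ, {D : Diagram L // D.degree = d} →₀ ℚ

/-- The element of `B(A)` represented by a series of diagrams. -/
noncomputable def Series.toB {A : Set L} (S : Set L) (F : Series A) : B A S :=
  fun d => Submodule.Quotient.mk (F d)

/-- A series of diagrams without loops, as a series of diagrams that may have loops. -/
noncomputable def Series.toO {A : Set L} (F : Series A) : SeriesO L :=
  fun d => (F d).mapDomain fun D => ⟨D.1, D.2.2⟩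

/-! ### Gluing legs -/

/-- The legs labelled in `X`. -/
def LegIn (D : Diagram L) (X : Set L) : Type := {h : D.H // D.IsLeg h ∧ D.label h ∈ X}

/-- The label-preserving bijections between the legs of `C` and of `D` that are labelled
in `X`. -/
def Gluing (X : Set L) (C D : Diagram L) : Type :=
  {g : C.LegIn X ≃ D.LegIn X // ∀ u, D.label (g u).1 = C.label u.1}

open Classical in
/-- The legs labelled in `X` are interchanged according to `g`; other half-edges are fixed. -/
noncomputable def glueLegs {X : Set L} {C D : Diagram L} (g : Gluing X C D) :
    C.H ⊕ D.H → C.H ⊕ D.H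
  | .inl c => if hc : C.IsLeg c ∧ C.label c ∈ X then .inr (g.1 ⟨c, hc⟩).1 else .inl c
  | .inr d => if hd : D.IsLeg d ∧ D.label d ∈ X then .inl (g.1.symm ⟨d, hd⟩).1 else .inr d

theorem glueLegs_involutive {X : Set L} {C D : Diagram L} (g : Gluing X C D) :
    Function.Involutive (glueLegs g) := by
  rintro (c | d)
  · by_cases hc : C.IsLeg c ∧ C.label c ∈ X
    · have h1 := (g.1 ⟨c, hc⟩).2
      have h2 : g.1.symm ⟨(g.1 ⟨c, hc⟩).1, h1⟩ = ⟨c, hc⟩ := g.1.symm_apply_apply _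
      simp only [glueLegs, dif_pos hc, dif_pos h1, h2]
    · simp only [glueLegs, dif_neg hc]
  · by_cases hd : D.IsLeg d ∧ D.label d ∈ X
    · have h1 := (g.1.symm ⟨d, hd⟩).2
      have h2 : g.1 ⟨(g.1.symm ⟨d, hd⟩).1, h1⟩ = ⟨d, hd⟩ := g.1.apply_symm_apply _
      simp only [glueLegs, dif_pos hd, dif_pos h1, h2]
    · simp only [glueLegs, dif_neg hd]

/-- The disjoint union of `C` and `D`, with the legs labelled in `X` glued according to `g`:
two glued legs become the two half-edges of a subdivision point. -/
noncomputable def glue {X : Set L} {C D : Diagram L} (g : Gluing X C D) : Diagram L where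
  H := C.H ⊕ D.H
  finite := by have := C.finite; have := D.finite; infer_instance
  e := Equiv.sumCongr C.e D.e
  σ := Equiv.sumCongr C.σ D.σ * (glueLegs_involutive g).toPerm
  label := Sum.elim C.label D.label
  e_e x := by rcases x with h | h <;> simp [C.e_e, D.e_e]
  e_ne x := by rcases x with h | h <;> simp [C.e_ne, D.e_ne]
  valence x := by
    have hm : ∀ y, (Equiv.sumCongr C.σ D.σ * (glueLegs_involutive g).toPerm :
        Equiv.Perm (C.H ⊕ D.H)) y = Sum.map C.σ D.σ (glueLegs g y) := fun y => rfl
    simp only [hm]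
    rcases x with c | d
    · by_cases hc : C.IsLeg c ∧ C.label c ∈ X
      · right; left
        have h1 := (g.1 ⟨c, hc⟩).2
        have h2 : g.1.symm ⟨(g.1 ⟨c, hc⟩).1, h1⟩ = ⟨c, hc⟩ := g.1.symm_apply_apply _
        have h3 : D.σ (g.1 ⟨c, hc⟩).1 = (g.1 ⟨c, hc⟩).1 := h1.1
        have h4 : C.σ c = c := hc.1
        simp only [glueLegs, dif_pos hc, Sum.map_inr, Sum.map_inl, h3, dif_pos h1, h2, h4]
      · have key : ∀ a, ¬ (C.IsLeg a ∧ C.label a ∈ X) →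
            ¬ (C.IsLeg (C.σ a) ∧ C.label (C.σ a) ∈ X) := fun a ha hh => ha (by
          have h5 : C.σ a = a := C.σ.injective hh.1
          rwa [h5] at hh)
        simpa only [glueLegs, dif_neg hc, Sum.map_inl, dif_neg (key c hc),
          dif_neg (key _ (key c hc)), Sum.inl.injEq] using C.valence c
    · by_cases hd : D.IsLeg d ∧ D.label d ∈ X
      · right; left
        have h1 := (g.1.symm ⟨d, hd⟩).2
        have h2 : g.1 ⟨(g.1.symm ⟨d, hd⟩).1, h1⟩ = ⟨d, hd⟩ := g.1.apply_symm_apply _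
        have h3 : C.σ (g.1.symm ⟨d, hd⟩).1 = (g.1.symm ⟨d, hd⟩).1 := h1.1
        have h4 : D.σ d = d := hd.1
        simp only [glueLegs, dif_pos hd, Sum.map_inr, Sum.map_inl, h3, dif_pos h1, h2, h4]
      · have key : ∀ a, ¬ (D.IsLeg a ∧ D.label a ∈ X) →
            ¬ (D.IsLeg (D.σ a) ∧ D.label (D.σ a) ∈ X) := fun a ha hh => ha (by
          have h5 : D.σ a = a := D.σ.injective hh.1
          rwa [h5] at hh)
        simpa only [glueLegs, dif_neg hd, Sum.map_inr, dif_neg (key d hd),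
          dif_neg (key _ (key d hd)), Sum.inr.injEq] using D.valence d

theorem dropLoops_loopFree (D : Diagram L) : D.dropLoops.LoopFree := by
  intro h hl
  refine h.2 fun h' hh => ?_
  have key : ∀ a b : D.H, D.conn a b → ∀ ha : ¬ D.OnLoop a, ∃ hb : ¬ D.OnLoop b,
      D.dropLoops.conn ⟨a, ha⟩ ⟨b, hb⟩ := by
    intro a b hab ha
    have hb : ¬ D.OnLoop b := fun H => ha fun c hc =>
      H c (.trans _ _ _ (.symm _ _ hab) hc)
    refine ⟨hb, ?_⟩
    clear hl hh
    revert ha hb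
    induction hab with
    | rel x y hxy =>
      intro ha hb
      refine .rel _ _ ?_
      rcases hxy with h1 | h1
      · exact .inl (Subtype.ext h1)
      · exact .inr (Subtype.ext h1)
    | refl x => intro ha hb; exact .refl _
    | symm x y _ ih => intro ha hb; exact .symm _ _ (ih hb ha)
    | trans x y z h1 h2 ih1 ih2 =>
      intro ha hb
      have hy : ¬ D.OnLoop y := fun H => ha fun c hc => H c (.trans _ _ _ (.symm _ _ h1) hc)
      exact .trans _ _ _ (ih1 ha hy) (ih2 hy hb)
  obtain ⟨hb, h1⟩ := key h.1 h' hh h.2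
  obtain ⟨h2, h3⟩ := hl _ h1
  exact ⟨fun H => h2 (Subtype.ext H), congrArg Subtype.val h3⟩

theorem glue_dropLoops_labelledIn {X Y : Set L} {C D : Diagram L} (g : Gluing X C D)
    (hC : C.LabelledIn (X ∪ Y)) (hD : D.LabelledIn (X ∪ Y)) :
    (glue g).dropLoops.LabelledIn Y := by
  rintro ⟨x, hx⟩ hl
  have hl' : Sum.map C.σ D.σ (glueLegs g x) = x := congrArg Subtype.val hl
  change (glue g).label x ∈ Y
  rcases x with c | d
  · by_cases hc : C.IsLeg c ∧ C.label c ∈ X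
    · simp [glueLegs, dif_pos hc] at hl'
    · have h1 : C.σ c = c := by
        simpa only [glueLegs, dif_neg hc, Sum.map_inl, Sum.inl.injEq] using hl'
      exact (hC c h1).resolve_left fun h2 => hc ⟨h1, h2⟩
  · by_cases hd : D.IsLeg d ∧ D.label d ∈ X
    · simp [glueLegs, dif_pos hd] at hl'
    · have h1 : D.σ d = d := by
        simpa only [glueLegs, dif_neg hd, Sum.map_inr, Sum.inr.injEq] using hl'
      exact (hD d h1).resolve_left fun h2 => hd ⟨h1, h2⟩

end Diagram

/-! ### The labels `x_i`, `x'_i`, `k` and formal integration -/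

/-- The labels `x_1, …, x_μ`, `x'_1, …, x'_μ` and `k`. -/
inductive Lab (μ : ℕ) : Type
  | x (i : Fin μ) : Lab μ
  | x' (i : Fin μ) : Lab μ
  | k : Lab μ

namespace Lab

/-- The set of labels `X = {x_1, …, x_μ}`. -/
def X (μ : ℕ) : Set (Lab μ) := Set.range Lab.x

/-- The set of labels `X' = {x'_1, …, x'_μ}`. -/
def X' (μ : ℕ) : Set (Lab μ) := Set.range Lab.x'

/-- The set of labels `{k}`. -/
def K (μ : ℕ) : Set (Lab μ) := {Lab.k}

theorem mem_union {μ : ℕ} (l : Lab μ) : l ∈ X μ ∪ (X' μ ∪ K μ) := by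
  cases l <;> simp [X, X', K]

end Lab

namespace Diagram

variable {μ : ℕ}

/-- The diagram consisting of `n` chords with both ends labelled `x_i`, for every `i`. -/
def chords (μ n : ℕ) : Diagram (Lab μ) where
  H := (Fin μ × Fin n) × Bool
  finite := inferInstance
  e := Equiv.prodCongr (Equiv.refl _) Equiv.boolNot
  σ := Equiv.refl _
  label h := Lab.x h.1.1
  e_e h := by rcases h with ⟨a, b⟩; simp
  e_ne h := by
    intro hh
    have := congrArg Prod.snd hh
    simp at this
  valence h := .inl rfl

/-- Formal integration `∫⁽ⁿ⁾ dX` of a diagram: the sum of all ways of gluing the legs labelled in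
`X` to those of `n` chords for every `i`, with the coefficient `∏ i, (1 / n!) (1 / 2) ^ n`,
every resulting closed dashed loop being replaced by the factor `-2n`. -/
noncomputable def intDiagram (n : ℕ) (D : Diagram (Lab μ)) :
    BLe (Lab.X' μ ∪ Lab.K μ) (Lab.K μ) n :=
  (∏ _i : Fin μ, (1 / (n.factorial : ℚ)) * (1 / 2 : ℚ) ^ n) •
    ∑ᶠ g : Gluing (Lab.X μ) (chords μ n) D,
      (-2 * (n : ℚ)) ^ (glue g).loops •
        BLe.mk (Lab.X' μ ∪ Lab.K μ) (Lab.K μ) n (glue g).dropLoops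
          ⟨dropLoops_loopFree _, glue_dropLoops_labelledIn g
            (fun _ _ => Lab.mem_union _) (fun _ _ => Lab.mem_union _)⟩

/-- Formal integration `∫⁽ⁿ⁾ dX` of a series of diagrams.  Gluing removes the `2nμ` legs labelled
in `X`, so that only finitely many degrees contribute in degree at most `n`. -/
noncomputable def integral (n : ℕ) (F : SeriesO (Lab μ)) :
    BLe (Lab.X' μ ∪ Lab.K μ) (Lab.K μ) n :=
  ∑ᶠ d : ℕ, (F d).sum fun D q => q • intDiagram n D.1

/-! ### Translation by power series -/

/-- A choice, for every leg labelled by some `x_i`, either to keep it (`none`), or to replace it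
by a leg labelled `x'_j` at the end of an edge with `m` new `k`-legs (`some (j, m)`). -/
def Choice (D : Diagram (Lab μ)) : Type :=
  {c : D.H → Option (Fin μ × ℕ) // ∀ h, c h ≠ none → D.IsLeg h ∧ D.label h ∈ Lab.X μ}

/-- The number of `k`-legs to be inserted next to `h`. -/
def Choice.teeth {D : Diagram (Lab μ)} (c : D.Choice) (h : D.H) : ℕ :=
  match c.1 h with
  | none => 0
  | some (_, m) => m

/-- The new label of the leg `h`. -/
def Choice.newLabel {D : Diagram (Lab μ)} (c : D.Choice) (h : D.H) : Lab μ :=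
  match c.1 h with
  | none => D.label h
  | some (j, _) => Lab.x' j

/-- The coefficient of a choice in the translation by `M`: a leg `x_i` that is replaced according
to `some (j, m)` contributes the coefficient of `k ^ m` in `M i j`. -/
noncomputable def Choice.coeff {D : Diagram (Lab μ)} (M : Matrix (Fin μ) (Fin μ) (PowerSeries ℚ))
    (c : D.Choice) : ℚ :=
  ∏ᶠ h : D.H, match D.label h, c.1 h with
    | Lab.x i, some (j, m) => PowerSeries.coeff m (M i j)
    | _, _ => 1

/-- The half-edges of the diagram obtained from `D` by inserting `m = c.teeth h` trivalent vertices,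
each with a `k`-leg, on every edge `{h, e h}` next to `h`.  These vertices are numbered
`j = 0, …, m - 1` when one moves away from `h`.  The half-edge `inl (h, 0)` is `h` itself; the
vertex number `j` has the half-edges `inl (h, j + 1)` (pointing away from `h`),
`inr ((h, j), some false)` (the edge to the `k`-leg) and `inr ((h, j), none)` (pointing towards
`h`), in this cyclic order; the `k`-leg itself is `inr ((h, j), some true)`. -/
abbrev Choice.Half {D : Diagram (Lab μ)} (c : D.Choice) : Type :=
  (Σ h : D.H, Fin (c.teeth h + 1)) ⊕ ((Σ h : D.H, Fin (c.teeth h)) × Option Bool)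

/-- The edges of the diagram with inserted `k`-legs. -/
def Choice.edge {D : Diagram (Lab μ)} (c : D.Choice) : c.Half → c.Half
  | .inl ⟨h, i⟩ =>
    if hi : i.1 < c.teeth h then .inr (⟨h, ⟨i.1, hi⟩⟩, none) else .inl ⟨D.e h, Fin.last _⟩
  | .inr (⟨h, j⟩, none) => .inl ⟨h, j.castSucc⟩
  | .inr (t, some b) => .inr (t, some (!b))

theorem Choice.edge_involutive {D : Diagram (Lab μ)} (c : D.Choice) :
    Function.Involutive c.edge := by
  rintro (⟨h, i⟩ | ⟨⟨h, j⟩, _ | b⟩)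
  · by_cases hi : i.1 < c.teeth h
    · simp [Choice.edge, hi]
    · have hi' : i = Fin.last _ := Fin.ext (by simp; omega)
      subst hi'
      simp only [Choice.edge, Fin.val_last, lt_irrefl, dite_false]
      rw [D.e_e]
  · simp [Choice.edge]
  · simp [Choice.edge]

/-- The vertices of the diagram with inserted `k`-legs. -/
def Choice.vertex {D : Diagram (Lab μ)} (c : D.Choice) : c.Half → c.Half
  | .inl ⟨h, ⟨0, _⟩⟩ => .inl ⟨D.σ h, 0⟩
  | .inl ⟨h, ⟨j + 1, hj⟩⟩ => .inr (⟨h, ⟨j, Nat.lt_of_succ_lt_succ hj⟩⟩, some false)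
  | .inr (t, some false) => .inr (t, none)
  | .inr (t, none) => .inl ⟨t.1, t.2.succ⟩
  | .inr (t, some true) => .inr (t, some true)

/-- The inverse of `Choice.vertex`. -/
def Choice.vertexInv {D : Diagram (Lab μ)} (c : D.Choice) : c.Half → c.Half
  | .inl ⟨h, ⟨0, _⟩⟩ => .inl ⟨D.σ.symm h, 0⟩
  | .inl ⟨h, ⟨j + 1, hj⟩⟩ => .inr (⟨h, ⟨j, Nat.lt_of_succ_lt_succ hj⟩⟩, none)
  | .inr (t, some false) => .inl ⟨t.1, t.2.succ⟩
  | .inr (t, none) => .inr (t, some false)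
  | .inr (t, some true) => .inr (t, some true)

theorem Choice.mk_zero {D : Diagram (Lab μ)} (c : D.Choice) {g h : D.H} (hg : g = h) :
    (⟨g, 0⟩ : Σ h : D.H, Fin (c.teeth h + 1)) = ⟨h, 0⟩ := by rw [hg]

/-- The diagram obtained from `D` by relabelling its legs according to the choice `c` and
inserting the chosen numbers of `k`-legs. -/
def graft (D : Diagram (Lab μ)) (c : D.Choice) : Diagram (Lab μ) where
  H := c.Half
  finite := by have := D.finite; infer_instance
  e := c.edge_involutive.toPerm
  σ :=
    { toFun := c.vertex
      invFun := c.vertexInv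
      left_inv := by
        rintro (⟨h, ⟨_ | j, hj⟩⟩ | ⟨⟨h, j⟩, _ | _ | _⟩)
        · exact congrArg Sum.inl (c.mk_zero (D.σ.symm_apply_apply h))
        all_goals rfl
      right_inv := by
        rintro (⟨h, ⟨_ | j, hj⟩⟩ | ⟨⟨h, j⟩, _ | _ | _⟩)
        · exact congrArg Sum.inl (c.mk_zero (D.σ.apply_symm_apply h))
        all_goals rfl }
  label := Sum.elim (fun y => c.newLabel y.1) (fun _ => Lab.k)
  e_e y := c.edge_involutive y
  e_ne y := by
    change c.edge y ≠ y
    rcases y with ⟨h, i⟩ | ⟨⟨h, j⟩, _ | b⟩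
    · simp only [Choice.edge]
      split_ifs
      · simp
      · intro hh
        exact D.e_ne h (congrArg Sigma.fst (Sum.inl.inj hh))
    · simp [Choice.edge]
    · simp [Choice.edge]
  valence y := by
    change c.vertex y = y ∨ c.vertex (c.vertex y) = y ∨ c.vertex (c.vertex (c.vertex y)) = y
    rcases y with ⟨h, ⟨_ | j, hj⟩⟩ | ⟨⟨h, j⟩, _ | _ | _⟩
    · rcases D.valence h with h1 | h1 | h1
      · exact .inl (congrArg Sum.inl (c.mk_zero h1))
      · exact .inr (.inl (congrArg Sum.inl (c.mk_zero h1)))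
      · exact .inr (.inr (congrArg Sum.inl (c.mk_zero h1)))
    · exact .inr (.inr rfl)
    · exact .inr (.inr rfl)
    · exact .inr (.inr rfl)
    · exact .inl rfl

/-- The series `F(x̄ + M(k) x̄', k)`: every diagram of `F` is replaced by the sum, over all choices,
of the corresponding diagrams with the corresponding coefficients. -/
noncomputable def Series.translate (M : Matrix (Fin μ) (Fin μ) (PowerSeries ℚ))
    (F : Series (Lab.X μ ∪ Lab.K μ)) : SeriesO (Lab μ) :=
  fun d => ∑ d' ∈ Finset.range (d + 1), (F d').sum fun D q =>
    ∑ᶠ c : {c : D.1.Choice // (D.1.graft c).degree = d},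
      Finsupp.single ⟨D.1.graft c.1, c.2⟩ (q * c.1.coeff M)

end Diagram

/-! The proof has two independent halves: integration respects the defining relations
(`linearCombination_intDiagram_of_relator`), and translation does not change the integral of any
single diagram (`sum_choices`). IHX and the link relations enter only in the first half, which
reduces to the fact that gluing chords to the $X$-legs commutes with every move that defines a
relation.

The second half rests on one vanishing statement, `sum_pairUp_eq_zero`: in degree at most $n$, with
closed loops equal to $-2n$, the sum of all ways of joining $2n+2$ given legs in pairs is zero.
Suppose first that two of these legs, $a$ and $b$, are the ends of a strut. Joining $a$ to $b$
creates a loop, hence a factor $-2n$; joining $a$ to any of the $2n$ other legs merely lengthens an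
edge. After grouping, all $2n+1$ possibilities contain the same remaining diagram, and the factors
add up to $-2n+2n=0$. Without such struts, every one of the legs hangs on a vertex outside the given
legs. If the joined diagrams have degree at most $n$, there are at most $2n+1$ such vertices, so two
of the legs hang on the same trivalent vertex; exchanging them permutes the pairings and changes the
sign, and the sum equals its own negative. If the degree exceeds $n$, every term is zero.

To apply this, take a diagram some of whose $x_i$-legs have been translated already, and translate
one more $x_i$-leg $s$, always by the same label $x'_j$ and the same number of $k$-legs. Cut the
edge at $s$: the translated end becomes a strut, and joining its free end to $s$ is one more chord
next to the $n$ chords of colour $i$. Summing over $s$ and over all placements of the chords runs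
through the pairings of $2n+2$ legs, so the total is zero (`finsum_intDiagram_graft_set`).

Summing these identities, each translated diagram is weighted by its number of translated
$x_i$-legs, so this weighted sum vanishes (`sum_choices_card_smul`). Only diagrams with exactly $2n$
kept $x_i$-legs have a nonzero integral, so the weight is the constant $N_i-2n$, where $N_i$ is the
number of $x_i$-legs of the original diagram. If some $N_i>2n$, the weight can be divided out, and
both sides of the invariance are zero. If all $N_i\le 2n$, every actual translation leaves fewer
than $2n$ legs of some colour, and only the untranslated diagram survives. Bounds on degrees make
all these sums finite. -/

namespace Diagram

/-! ### Reducible forms of the constructions on diagrams -/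

section Reducible

variable {L : Type} (D : Diagram L)

/-- Reducible form of `subdivide`. -/
noncomputable abbrev subdiv (a : D.H) : Diagram L where
  H := D.H ⊕ Bool
  finite := (D.subdivide a).finite
  e := (D.subdivideEdge_involutive a).toPerm
  σ := Equiv.sumCongr D.σ Equiv.boolNot
  label := Sum.elim D.label (fun _ => D.label a)
  e_e := (D.subdivide a).e_e
  e_ne := (D.subdivide a).e_ne
  valence := (D.subdivide a).valence

/-- Definitional; it carries relators, which are stated with the original construction, over to the
reducible form in which all computations are done. -/
theorem subdivide_eq (a : D.H) : D.subdivide a = D.subdiv a := rfl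

/-- Reducible form of `conj`. -/
abbrev conjugate (ρ : Equiv.Perm D.H) : Diagram L where
  H := D.H
  finite := D.finite
  e := D.e
  σ := ρ * D.σ * ρ⁻¹
  label := D.label
  e_e := D.e_e
  e_ne := D.e_ne
  valence := (D.conj ρ).valence

theorem conj_eq (ρ : Equiv.Perm D.H) : D.conj ρ = D.conjugate ρ := rfl

open Classical in
/-- Reducible form of `attach`. -/
noncomputable abbrev attachLeg (l : L) (s u : D.H) (hs : D.IsLeg s) (hu : D.IsLeg u)
    (hne : u ≠ s) : Diagram L where
  H := D.H ⊕ Bool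
  finite := (D.attach l s u hs hu hne).finite
  e := Equiv.sumCongr D.e Equiv.boolNot
  σ := Equiv.sumCongr D.σ (Equiv.refl Bool) *
    (Equiv.swap (.inl u) (.inl s) * Equiv.swap (.inl s) (.inr false) : Equiv.Perm (D.H ⊕ Bool))
  label := Sum.elim D.label (fun _ => l)
  e_e := (D.attach l s u hs hu hne).e_e
  e_ne := (D.attach l s u hs hu hne).e_ne
  valence := by exact (D.attach l s u hs hu hne).valence

theorem attach_eq (l : L) (s u : D.H) (hs : D.IsLeg s) (hu : D.IsLeg u) (hne : u ≠ s) :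
    D.attach l s u hs hu hne = D.attachLeg l s u hs hu hne := rfl

/-- Reducible form of `dropLoops`. -/
abbrev withoutLoops : Diagram L where
  H := {h : D.H // ¬ D.OnLoop h}
  finite := D.dropLoops.finite
  e := D.dropLoops.e
  σ := D.dropLoops.σ
  label h := D.label h.1
  e_e := D.dropLoops.e_e
  e_ne := D.dropLoops.e_ne
  valence := D.dropLoops.valence

end Reducible

/-! ### Types of vertices, closed dashed loops, isomorphisms -/

section Basics

variable {L : Type} (D : Diagram L)

theorem isLeg_or_isBiv_or_isTri (h : D.H) : D.IsLeg h ∨ D.IsBiv h ∨ D.IsTri h := by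
  unfold IsLeg IsBiv IsTri
  tauto

theorem isBiv_σ_iff (h : D.H) : D.IsBiv (D.σ h) ↔ D.IsBiv h := by
  unfold IsBiv
  rw [D.σ.injective.ne_iff, D.σ.injective.eq_iff]

theorem isTri_σ_iff (h : D.H) : D.IsTri (D.σ h) ↔ D.IsTri h := by
  unfold IsTri
  rw [D.σ.injective.ne_iff, D.σ.injective.ne_iff]

variable {D}

theorem IsLeg.not_isBiv {h : D.H} (hh : D.IsLeg h) : ¬ D.IsBiv h := fun h' => h'.1 hh

theorem IsLeg.not_isTri {h : D.H} (hh : D.IsLeg h) : ¬ D.IsTri h := fun h' => h'.1 hh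

theorem IsBiv.not_isTri {h : D.H} (hh : D.IsBiv h) : ¬ D.IsTri h := fun h' => h'.2 hh.2

theorem IsTri.σ_σ_σ {h : D.H} (hh : D.IsTri h) : D.σ (D.σ (D.σ h)) = h := by
  rcases D.valence h with h1 | h1 | h1
  · exact absurd h1 hh.1
  · exact absurd h1 hh.2
  · exact h1

theorem conn_e (h : D.H) : D.conn h (D.e h) := .rel _ _ (.inl rfl)

theorem conn_σ (h : D.H) : D.conn h (D.σ h) := .rel _ _ (.inr rfl)

theorem OnLoop.isBiv {h : D.H} (hh : D.OnLoop h) : D.IsBiv h := hh h (.refl _)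

theorem onLoop_congr {a b : D.H} (hab : D.conn a b) : D.OnLoop a ↔ D.OnLoop b :=
  ⟨fun H c hc => H c (.trans _ _ _ hab hc), fun H c hc => H c (.trans _ _ _ (.symm _ _ hab) hc)⟩

theorem onLoop_e {h : D.H} : D.OnLoop (D.e h) ↔ D.OnLoop h := (onLoop_congr (conn_e h)).symm

theorem onLoop_σ {h : D.H} : D.OnLoop (D.σ h) ↔ D.OnLoop h := (onLoop_congr (conn_σ h)).symm

/-- A set of half-edges at subdivision points that is closed under `e` and `σ` consists of
closed dashed loops. -/
theorem onLoop_of_closed (Z : Set D.H) (he : ∀ h ∈ Z, D.e h ∈ Z) (hσ : ∀ h ∈ Z, D.σ h ∈ Z)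
    (hb : ∀ h ∈ Z, D.IsBiv h) {h : D.H} (hh : h ∈ Z) : D.OnLoop h := by
  have key : ∀ a b, D.conn a b → (a ∈ Z ↔ b ∈ Z) := by
    intro a b hab
    induction hab with
    | rel x y hxy =>
      rcases hxy with rfl | rfl
      · exact ⟨he _, fun h1 => by simpa [D.e_e] using he _ h1⟩
      · refine ⟨hσ _, fun h1 => ?_⟩
        -- At a subdivision point `σ` is an involution, so closure under `σ` also gives closure
        -- under its inverse.
        have h2 := (D.isBiv_σ_iff x).1 (hb _ h1)
        simpa [h2.2] using hσ _ h1
    | refl => rfl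
    | symm _ _ _ ih => exact ih.symm
    | trans _ _ _ _ _ ih1 ih2 => exact ih1.trans ih2
  exact fun b hab => hb b ((key _ _ hab).1 hh)

/-- Connectedness along closed dashed loops is preserved by maps that preserve it locally. -/
theorem conn_map {D' : Diagram L} (f : D.H → D'.H)
    (he : ∀ h, D.OnLoop h → D'.conn (f h) (f (D.e h)))
    (hσ : ∀ h, D.OnLoop h → D'.conn (f h) (f (D.σ h))) {a b : D.H} (ha : D.OnLoop a)
    (hab : D.conn a b) : D'.conn (f a) (f b) := by
  induction hab with
  | rel x y hxy =>
    rcases hxy with rfl | rfl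
    · exact he _ ha
    · exact hσ _ ha
  | refl => exact .refl _
  | symm x y h ih => exact .symm _ _ (ih ((onLoop_congr h).2 ha))
  | trans x y z h1 _ ih1 ih2 =>
    exact .trans _ _ _ (ih1 ha) (ih2 ((onLoop_congr h1).1 ha))

/-- The half-edges on closed dashed loops, up to connectedness. -/
def loopSetoid (D : Diagram L) : Setoid {h : D.H // D.OnLoop h} := D.conn.comap Subtype.val

/-- With loops as classes of half-edges lying on loops, a map between sets of loops can be given on
representatives. -/
theorem loops_eq_card (D : Diagram L) : D.loops = Nat.card (Quotient D.loopSetoid) := by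
  refine (Nat.card_congr (Equiv.ofBijective
    (fun c : Quotient D.loopSetoid => (⟨Quotient.map' (s₂ := D.conn) Subtype.val
      (fun _ _ h => h) c, ?_⟩ :
      {c : Quotient D.conn // ∃ h, Quotient.mk D.conn h = c ∧ D.OnLoop h})) ⟨?_, ?_⟩)).symm
  · induction c using Quotient.inductionOn with
    | h a => exact ⟨a.1, rfl, a.2⟩
  · intro a b
    induction a using Quotient.inductionOn with
    | h a =>
      induction b using Quotient.inductionOn with
      | h b =>
        intro hab
        have h1 : Quotient.mk D.conn a.1 = Quotient.mk D.conn b.1 := congrArg Subtype.val hab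
        have h2 : D.conn a.1 b.1 := Quotient.exact h1
        exact Quotient.sound h2
  · rintro ⟨c, h, rfl, hh⟩
    exact ⟨Quotient.mk _ ⟨h, hh⟩, rfl⟩

/-- The maps need to be inverse only up to connectedness. This allows for moves, such as
subdivision, that change the number of half-edges but not the number of loops. -/
theorem loops_congr {D' : Diagram L} (f : D.H → D'.H) (g : D'.H → D.H)
    (hf : ∀ h, D.OnLoop h → D'.OnLoop (f h)) (hg : ∀ h, D'.OnLoop h → D.OnLoop (g h))
    (fe : ∀ h, D.OnLoop h → D'.conn (f h) (f (D.e h)))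
    (fσ : ∀ h, D.OnLoop h → D'.conn (f h) (f (D.σ h)))
    (ge : ∀ h, D'.OnLoop h → D.conn (g h) (g (D'.e h)))
    (gσ : ∀ h, D'.OnLoop h → D.conn (g h) (g (D'.σ h)))
    (gf : ∀ h, D.OnLoop h → D.conn (g (f h)) h) (fg : ∀ h, D'.OnLoop h → D'.conn (f (g h)) h) :
    D.loops = D'.loops := by
  rw [loops_eq_card, loops_eq_card]
  refine Nat.card_congr
    ⟨Quotient.map' (s₁ := D.loopSetoid) (s₂ := D'.loopSetoid) (fun h => ⟨f h.1, hf _ h.2⟩) ?_,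
      Quotient.map' (s₁ := D'.loopSetoid) (s₂ := D.loopSetoid) (fun h => ⟨g h.1, hg _ h.2⟩) ?_,
      ?_, ?_⟩
  · exact fun a b hab => conn_map f fe fσ a.2 hab
  · exact fun a b hab => conn_map g ge gσ a.2 hab
  · intro a
    induction a using Quotient.inductionOn with
    | h a => exact Quotient.sound (gf _ a.2)
  · intro a
    induction a using Quotient.inductionOn with
    | h a => exact Quotient.sound (fg _ a.2)

/-! ### Isomorphisms -/

namespace Iso

variable {D' D'' : Diagram L}

/-- The inverse of an isomorphism. -/
def symm (f : Iso D D') : Iso D' D where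
  f := f.f.symm
  map_e h := by
    rw [Equiv.symm_apply_eq, f.map_e, Equiv.apply_symm_apply]
  map_σ h := by
    rw [Equiv.symm_apply_eq, f.map_σ, Equiv.apply_symm_apply]
  map_label h hh := by
    have h1 : D.IsLeg (f.f.symm h) := by
      unfold IsLeg at hh ⊢
      rw [Equiv.eq_symm_apply, f.map_σ, Equiv.apply_symm_apply, hh]
    rw [← f.map_label _ h1, Equiv.apply_symm_apply]

theorem isLeg (f : Iso D D') (h : D.H) : D'.IsLeg (f.f h) ↔ D.IsLeg h := by
  unfold IsLeg
  rw [← f.map_σ, f.f.injective.eq_iff]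

theorem isBiv (f : Iso D D') (h : D.H) : D'.IsBiv (f.f h) ↔ D.IsBiv h := by
  unfold IsBiv
  rw [← f.map_σ, ← f.map_σ, f.f.injective.eq_iff, f.f.injective.ne_iff]

theorem isTri (f : Iso D D') (h : D.H) : D'.IsTri (f.f h) ↔ D.IsTri h := by
  unfold IsTri
  rw [← f.map_σ, ← f.map_σ, f.f.injective.ne_iff, f.f.injective.ne_iff]

theorem onLoop_aux (f : Iso D D') {h : D.H} (hh : D.OnLoop h) : D'.OnLoop (f.f h) := by
  refine onLoop_of_closed (f.f '' {a | D.OnLoop a}) ?_ ?_ ?_ ⟨h, hh, rfl⟩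
  · rintro _ ⟨a, ha, rfl⟩
    exact ⟨D.e a, onLoop_e.2 ha, f.map_e a⟩
  · rintro _ ⟨a, ha, rfl⟩
    exact ⟨D.σ a, onLoop_σ.2 ha, f.map_σ a⟩
  · rintro _ ⟨_, ha, rfl⟩
    exact (f.isBiv _).2 (OnLoop.isBiv ha)

theorem onLoop (f : Iso D D') (h : D.H) : D'.OnLoop (f.f h) ↔ D.OnLoop h :=
  ⟨fun hh => by simpa [symm] using f.symm.onLoop_aux hh, f.onLoop_aux⟩

theorem loops_eq (f : Iso D D') : D.loops = D'.loops := by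
  refine loops_congr f.f f.f.symm (fun h => (f.onLoop h).2) (fun h hh => ?_) ?_ ?_ ?_ ?_ ?_ ?_
  · exact f.symm.onLoop_aux hh
  · exact fun h _ => by rw [f.map_e]; exact conn_e _
  · exact fun h _ => by rw [f.map_σ]; exact conn_σ _
  · exact fun h _ => by have := f.symm.map_e h; simp only [symm] at this; rw [this]; exact conn_e _
  · exact fun h _ => by have := f.symm.map_σ h; simp only [symm] at this; rw [this]; exact conn_σ _
  · exact fun h _ => by rw [Equiv.symm_apply_apply]
  · exact fun h _ => by rw [Equiv.apply_symm_apply]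

/-- An isomorphism induces an isomorphism of the diagrams without closed dashed loops. -/
def withoutLoops (f : Iso D D') : Iso D.withoutLoops D'.withoutLoops where
  f := f.f.subtypeEquiv fun h => not_congr (f.onLoop h).symm
  map_e h := Subtype.ext (f.map_e h.1)
  map_σ h := Subtype.ext (f.map_σ h.1)
  map_label h hh := f.map_label h.1 (congrArg Subtype.val hh)

theorem degree_eq (f : Iso D D') : D.degree = D'.degree := by
  unfold degree
  rw [Nat.card_congr (f.f.subtypeEquiv fun h => (f.isLeg h).symm),
    Nat.card_congr (f.f.subtypeEquiv fun h => (f.isTri h).symm)]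

theorem loopFree_aux (f : Iso D D') (h : D'.LoopFree) : D.LoopFree :=
  fun _ ha => h _ (f.onLoop_aux ha)

theorem labelledIn_aux (f : Iso D D') {A : Set L} (h : D'.LabelledIn A) : D.LabelledIn A :=
  fun a ha => by rw [← f.map_label a ha]; exact h _ ((f.isLeg a).2 ha)

theorem mem_gensLe (f : Iso D D') (A : Set L) (n : ℕ) : D ∈ gensLe A n ↔ D' ∈ gensLe A n := by
  have key : ∀ {D D' : Diagram L}, Iso D D' → D' ∈ gensLe A n → D ∈ gensLe A n := fun f h =>
    ⟨⟨f.loopFree_aux h.1.1, f.labelledIn_aux h.1.2⟩, f.degree_eq ▸ h.2⟩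
  exact ⟨key f.symm, key f⟩

end Iso

theorem isLeg_withoutLoops (h : D.withoutLoops.H) : D.withoutLoops.IsLeg h ↔ D.IsLeg h.1 := Subtype.ext_iff

theorem isTri_withoutLoops (h : D.withoutLoops.H) : D.withoutLoops.IsTri h ↔ D.IsTri h.1 :=
  and_congr (not_congr Subtype.ext_iff) (not_congr Subtype.ext_iff)

/-- Closed loops carry subdivision points only, and these do not count for the degree. -/
theorem degree_withoutLoops (D : Diagram L) : D.withoutLoops.degree = D.degree := by
  unfold degree
  have h1 : Nat.card {h // D.withoutLoops.IsLeg h} = Nat.card {h // D.IsLeg h} :=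
    Nat.card_congr
      ⟨fun h => ⟨h.1.1, (isLeg_withoutLoops _).1 h.2⟩,
        fun h => ⟨⟨h.1, fun hl => h.2.not_isBiv hl.isBiv⟩, (isLeg_withoutLoops _).2 h.2⟩,
        fun _ => rfl, fun _ => rfl⟩
  have h2 : Nat.card {h // D.withoutLoops.IsTri h} = Nat.card {h // D.IsTri h} :=
    Nat.card_congr
      ⟨fun h => ⟨h.1.1, (isTri_withoutLoops _).1 h.2⟩,
        fun h => ⟨⟨h.1, fun hl => hl.isBiv.not_isTri h.2⟩, (isTri_withoutLoops _).2 h.2⟩,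
        fun _ => rfl, fun _ => rfl⟩
  rw [h1, h2]

end Basics

/-! ### Subdivision, reordering of vertices and attachment, compared with the deletion of loops -/

section Ops

variable {L : Type} {D : Diagram L}

/-! ### Subdivision -/

@[simp] theorem subdiv_σ_inl (a h : D.H) : (D.subdiv a).σ (.inl h) = .inl (D.σ h) := rfl

@[simp] theorem subdiv_σ_inr (a : D.H) (b : Bool) :
    (D.subdiv a).σ (.inr b) = .inr (!b) := rfl

theorem subdiv_e_inl_self (a : D.H) : (D.subdiv a).e (.inl a) = .inr false := by
  change D.subdivideEdge a (.inl a) = .inr false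
  simp [subdivideEdge]

theorem subdiv_e_inl_e (a : D.H) : (D.subdiv a).e (.inl (D.e a)) = .inr true := by
  change D.subdivideEdge a (.inl (D.e a)) = .inr true
  simp [subdivideEdge, D.e_ne]

theorem subdiv_e_inl (a : D.H) {h : D.H} (h1 : h ≠ a) (h2 : h ≠ D.e a) :
    (D.subdiv a).e (.inl h) = .inl (D.e h) := by
  change D.subdivideEdge a (.inl h) = .inl (D.e h)
  simp [subdivideEdge, h1, h2]

@[simp] theorem subdiv_e_false (a : D.H) : (D.subdiv a).e (.inr false) = .inl a := rfl

@[simp] theorem subdiv_e_true (a : D.H) : (D.subdiv a).e (.inr true) = .inl (D.e a) := rfl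

theorem isLeg_subdiv_inl (a h : D.H) : (D.subdiv a).IsLeg (.inl h) ↔ D.IsLeg h :=
  Sum.inl_injective.eq_iff

theorem isBiv_subdiv_inl (a h : D.H) : (D.subdiv a).IsBiv (.inl h) ↔ D.IsBiv h :=
  and_congr Sum.inl_injective.ne_iff Sum.inl_injective.eq_iff

theorem isTri_subdiv_inl (a h : D.H) : (D.subdiv a).IsTri (.inl h) ↔ D.IsTri h :=
  and_congr Sum.inl_injective.ne_iff Sum.inl_injective.ne_iff

theorem isBiv_subdiv_inr (a : D.H) (b : Bool) : (D.subdiv a).IsBiv (.inr b) := by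
  constructor <;> simp

/-- The map `x.elim id fun _ => a` collapses the new point onto its edge, and components are
preserved by this collapse. -/
theorem onLoop_subdiv (a : D.H) (x : D.H ⊕ Bool) :
    (D.subdiv a).OnLoop x ↔ D.OnLoop (x.elim id fun _ => a) := by
  have h0 : ∀ h, D.OnLoop h →
      ∀ x : D.H ⊕ Bool, x.elim id (fun _ => a) = h → (D.subdiv a).OnLoop x := by
    intro h hh x hx
    refine onLoop_of_closed (D := D.subdiv a) {x | D.OnLoop (x.elim id fun _ => a)} ?_ ?_ ?_
      (by simpa [hx] using hh)
    · rintro (h | _ | _) hh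
      · by_cases h1 : h = a
        · subst h1
          rw [subdiv_e_inl_self]
          exact hh
        · by_cases h2 : h = D.e a
          · subst h2
            rw [subdiv_e_inl_e]
            exact onLoop_e.1 hh
          · rw [subdiv_e_inl a h1 h2]
            exact onLoop_e.2 hh
      · exact hh
      · exact onLoop_e.2 hh
    · rintro (h | b) hh
      · exact onLoop_σ.2 hh
      · exact hh
    · rintro (h | b) hh
      · exact (isBiv_subdiv_inl a h).2 (OnLoop.isBiv hh)
      · exact isBiv_subdiv_inr a b
  have h1 : ∀ h, (D.subdiv a).OnLoop (.inl h) → D.OnLoop h := by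
    intro h hh
    refine onLoop_of_closed {h | (D.subdiv a).OnLoop (.inl h)} ?_ ?_ ?_ hh
    · intro h hh
      have he := onLoop_e.2 hh
      by_cases h1 : h = a
      · subst h1
        rw [subdiv_e_inl_self] at he
        exact onLoop_e.2 (onLoop_σ.2 he)
      · by_cases h2 : h = D.e a
        · subst h2
          rw [subdiv_e_inl_e] at he
          have := onLoop_e.2 (onLoop_σ.2 he)
          rw [Set.mem_ofPred_eq, D.e_e]
          exact this
        · rwa [subdiv_e_inl a h1 h2] at he
    · exact fun h hh => onLoop_σ.2 hh
    · exact fun h hh => (isBiv_subdiv_inl a h).1 (OnLoop.isBiv hh)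
  rcases x with h | b
  · exact ⟨h1 h, fun hh => h0 h hh _ rfl⟩
  · refine ⟨fun hh => ?_, fun hh => h0 a hh _ rfl⟩
    cases b
    · exact h1 a (onLoop_e.2 hh)
    · exact h1 a (onLoop_e.2 (onLoop_σ.2 hh))

theorem loops_subdiv (a : D.H) : (D.subdiv a).loops = D.loops := by
  have c1 : (D.subdiv a).conn (.inl a) (.inr false) := by
    rw [← subdiv_e_inl_self]; exact conn_e _
  have c2 : (D.subdiv a).conn (.inr false) (.inr true) := conn_σ _
  have c3 : (D.subdiv a).conn (.inl (D.e a)) (.inr true) := by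
    rw [← subdiv_e_inl_e]; exact conn_e _
  have c4 : (D.subdiv a).conn (.inl a) (.inl (D.e a)) :=
    .trans _ _ _ c1 (.trans _ _ _ c2 (.symm _ _ c3))
  refine (loops_congr Sum.inl (fun x : D.H ⊕ Bool => x.elim id fun _ => a)
    (fun h hh => (onLoop_subdiv a (.inl h)).2 hh) (fun h hh => (onLoop_subdiv a h).1 hh)
    ?_ (fun h _ => conn_σ (D := D.subdiv a) (.inl h)) ?_ ?_ (fun h _ => .refl _) ?_).symm
  · intro h _
    by_cases h1 : h = a
    · subst h1
      exact c4
    · by_cases h2 : h = D.e a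
      · subst h2
        rw [D.e_e]
        exact .symm _ _ c4
      · rw [← subdiv_e_inl a h1 h2]
        exact conn_e _
  · rintro (h | _ | _) _
    · by_cases h1 : h = a
      · subst h1
        rw [subdiv_e_inl_self]
        exact .refl _
      · by_cases h2 : h = D.e a
        · subst h2
          rw [subdiv_e_inl_e]
          exact .symm _ _ (conn_e a)
        · rw [subdiv_e_inl a h1 h2]
          exact conn_e _
    · exact .refl _
    · exact conn_e _
  · rintro (h | b) _
    · exact conn_σ h
    · exact .refl _
  · rintro (h | _ | _) _
    · exact .refl _
    · exact c1
    · exact .trans _ _ _ c1 c2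

/-- A complement in a sum, as a sum. -/
def sumSubtypeEquiv {α β : Type} (P : α ⊕ β → Prop) (Q : α → Prop) (h1 : ∀ a, P (.inl a) ↔ Q a)
    (h2 : ∀ b, ¬ P (.inr b)) : {a // ¬ Q a} ⊕ β ≃ {x // ¬ P x} where
  toFun
    | .inl a => ⟨.inl a.1, fun h => a.2 ((h1 _).1 h)⟩
    | .inr b => ⟨.inr b, h2 b⟩
  invFun
    | ⟨.inl a, h⟩ => .inl ⟨a, fun h' => h ((h1 _).2 h')⟩
    | ⟨.inr b, _⟩ => .inr b
  left_inv := by rintro (a | b) <;> rfl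
  right_inv := by rintro ⟨a | b, h⟩ <;> rfl

/-- Subdivision commutes with the deletion of closed dashed loops. -/
noncomputable def withoutLoopsSubdiv (a : D.H) (ha : ¬ D.OnLoop a) :
    Iso (D.withoutLoops.subdiv ⟨a, ha⟩) (D.subdiv a).withoutLoops where
  f := sumSubtypeEquiv _ _ (fun h => onLoop_subdiv a (.inl h))
    (fun _ h => ha ((onLoop_subdiv a _).1 h))
  map_e := by
    rintro (h | _ | _)
    · refine Subtype.ext ?_
      by_cases h1 : h = ⟨a, ha⟩
      · subst h1
        rw [subdiv_e_inl_self]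
        exact (subdiv_e_inl_self a).symm
      · by_cases h2 : h = D.withoutLoops.e ⟨a, ha⟩
        · subst h2
          rw [subdiv_e_inl_e]
          exact (subdiv_e_inl_e a).symm
        · rw [subdiv_e_inl _ h1 h2]
          exact (subdiv_e_inl a (fun h => h1 (Subtype.ext h))
            (fun h => h2 (Subtype.ext h))).symm
    · rfl
    · rfl
  map_σ := by rintro (h | b) <;> rfl
  map_label := by rintro (h | b) _ <;> rfl

/-- Subdivision of a closed dashed loop. -/
noncomputable def withoutLoopsSubdivOnLoop (a : D.H) (ha : D.OnLoop a) :
    Iso D.withoutLoops (D.subdiv a).withoutLoops where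
  f :=
    { toFun := fun h => ⟨.inl h.1, fun h' => h.2 ((onLoop_subdiv a _).1 h')⟩
      invFun
        | ⟨.inl h, hh⟩ => ⟨h, fun h' => hh ((onLoop_subdiv a _).2 h')⟩
        | ⟨.inr _, hh⟩ => (hh ((onLoop_subdiv a _).2 ha)).elim
      left_inv := fun _ => rfl
      right_inv := by
        rintro ⟨h | b, hh⟩
        · rfl
        · exact (hh ((onLoop_subdiv a _).2 ha)).elim }
  map_e h := Subtype.ext (subdiv_e_inl a (h := h.1) (fun h1 => h.2 (by rw [h1]; exact ha))
    (fun h1 => h.2 (by rw [h1]; exact onLoop_e.2 ha))).symm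
  map_σ _ := rfl
  map_label _ _ := rfl

theorem degree_subdiv (a : D.H) : (D.subdiv a).degree = D.degree := by
  unfold degree
  have h1 : Nat.card {h // (D.subdiv a).IsLeg h} = Nat.card {h // D.IsLeg h} :=
    (Nat.card_congr (Equiv.ofBijective
      (fun h => ⟨.inl h.1, (isLeg_subdiv_inl a _).2 h.2⟩)
      ⟨fun x y h => Subtype.ext (Sum.inl.inj (congrArg Subtype.val h)), by
        rintro ⟨h | b, hh⟩
        · exact ⟨⟨h, (isLeg_subdiv_inl a _).1 hh⟩, rfl⟩
        · exact (hh.not_isBiv (isBiv_subdiv_inr a b)).elim⟩)).symm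
  have h2 : Nat.card {h // (D.subdiv a).IsTri h} = Nat.card {h // D.IsTri h} :=
    (Nat.card_congr (Equiv.ofBijective
      (fun h => ⟨.inl h.1, (isTri_subdiv_inl a _).2 h.2⟩)
      ⟨fun x y h => Subtype.ext (Sum.inl.inj (congrArg Subtype.val h)), by
        rintro ⟨h | b, hh⟩
        · exact ⟨⟨h, (isTri_subdiv_inl a _).1 hh⟩, rfl⟩
        · exact ((isBiv_subdiv_inr a b).not_isTri hh).elim⟩)).symm
  rw [h1, h2]

theorem subdiv_mem_gensLe (a : D.H) (A : Set L) (n : ℕ) :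
    D.subdiv a ∈ gensLe A n ↔ D ∈ gensLe A n := by
  refine and_congr (and_congr ?_ ?_) (by rw [degree_subdiv])
  · exact ⟨fun H h hh => H (.inl h) ((onLoop_subdiv a _).2 hh),
      fun H h hh => H _ ((onLoop_subdiv a _).1 hh)⟩
  · refine ⟨fun H h hh => H (.inl h) ((isLeg_subdiv_inl a h).2 hh), ?_⟩
    rintro H (h | b) hh
    · exact H h ((isLeg_subdiv_inl a h).1 hh)
    · exact (hh.not_isBiv (isBiv_subdiv_inr a b)).elim

/-! ### Conjugation by permutations that move half-edges at trivalent vertices only -/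

section Conj

variable {ρ : Equiv.Perm D.H}

/-- The permutations in AS and IHX move only half-edges at trivalent vertices. Such a conjugation
leaves legs and subdivision points, and therefore loops and the degree, untouched. -/
theorem conjugate_σ_of_not_isTri (hρ : ∀ h, ¬ D.IsTri h → ρ h = h) {h : D.H} (hh : ¬ D.IsTri h) :
    (D.conjugate ρ).σ h = D.σ h := by
  have h1 : ρ⁻¹ h = h := by rw [Equiv.Perm.inv_eq_iff_eq, hρ h hh]
  change ρ (D.σ (ρ⁻¹ h)) = D.σ h
  rw [h1, hρ _ (by rwa [isTri_σ_iff])]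

theorem isTri_conjugate (hρ : ∀ h, ¬ D.IsTri h → ρ h = h) (h : D.H) :
    (D.conjugate ρ).IsTri h ↔ D.IsTri h := by
  by_cases hh : D.IsTri h
  · refine iff_of_true ?_ hh
    obtain ⟨g, rfl⟩ := ρ.surjective h
    have hg : D.IsTri g := by
      by_contra hg
      rw [hρ g hg] at hh
      exact hg hh
    constructor
    · change ρ (D.σ (ρ⁻¹ (ρ g))) ≠ ρ g
      simpa using hg.1
    · change ρ (D.σ (ρ⁻¹ (ρ (D.σ (ρ⁻¹ (ρ g)))))) ≠ ρ g
      simpa using hg.2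
  · refine iff_of_false (fun h1 => hh ?_) hh
    have h2 := conjugate_σ_of_not_isTri hρ hh
    have h3 := conjugate_σ_of_not_isTri hρ (h := D.σ h) (by rwa [isTri_σ_iff])
    unfold IsTri at h1 ⊢
    rwa [h2, h3] at h1

theorem isLeg_conjugate (hρ : ∀ h, ¬ D.IsTri h → ρ h = h) (h : D.H) :
    (D.conjugate ρ).IsLeg h ↔ D.IsLeg h := by
  by_cases hh : D.IsTri h
  · exact iff_of_false (fun h1 => h1.not_isTri ((isTri_conjugate hρ h).2 hh)) (fun h1 => h1.not_isTri hh)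
  · unfold IsLeg
    rw [conjugate_σ_of_not_isTri hρ hh]

theorem isBiv_conjugate (hρ : ∀ h, ¬ D.IsTri h → ρ h = h) (h : D.H) :
    (D.conjugate ρ).IsBiv h ↔ D.IsBiv h := by
  by_cases hh : D.IsTri h
  · exact iff_of_false (fun h1 => h1.not_isTri ((isTri_conjugate hρ h).2 hh)) (fun h1 => h1.not_isTri hh)
  · unfold IsBiv
    rw [conjugate_σ_of_not_isTri hρ hh, conjugate_σ_of_not_isTri hρ (h := D.σ h) (by rwa [isTri_σ_iff])]

theorem onLoop_conjugate (hρ : ∀ h, ¬ D.IsTri h → ρ h = h) (h : D.H) :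
    (D.conjugate ρ).OnLoop h ↔ D.OnLoop h := by
  constructor
  · intro hh
    refine onLoop_of_closed (D := D) {h | (D.conjugate ρ).OnLoop h} (fun h hh => onLoop_e (D := D.conjugate ρ).2 hh)
      (fun h hh => ?_)
      (fun h hh => (isBiv_conjugate hρ h).1 (OnLoop.isBiv (D := D.conjugate ρ) hh)) hh
    have h1 : ¬ D.IsTri h := ((isBiv_conjugate hρ h).1 (OnLoop.isBiv (D := D.conjugate ρ) hh)).not_isTri
    have h2 := onLoop_σ (D := D.conjugate ρ).2 hh
    rwa [conjugate_σ_of_not_isTri hρ h1] at h2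
  · intro hh
    refine onLoop_of_closed (D := D.conjugate ρ) {h | D.OnLoop h} (fun h hh => onLoop_e (D := D).2 hh)
      (fun h hh => ?_) (fun h hh => (isBiv_conjugate hρ h).2 (OnLoop.isBiv hh)) hh
    rw [conjugate_σ_of_not_isTri hρ (OnLoop.isBiv hh).not_isTri]
    exact onLoop_σ.2 hh

theorem loops_conjugate (hρ : ∀ h, ¬ D.IsTri h → ρ h = h) : (D.conjugate ρ).loops = D.loops := by
  refine loops_congr (D := D.conjugate ρ) (D' := D) id id (fun h => (onLoop_conjugate hρ h).1)
    (fun h => (onLoop_conjugate hρ h).2) (fun h _ => conn_e (D := D) h) (fun h hh => ?_)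
    (fun h _ => conn_e (D := D.conjugate ρ) h) (fun h hh => ?_) (fun h _ => .refl _)
    (fun h _ => .refl _)
  · rw [conjugate_σ_of_not_isTri hρ ((onLoop_conjugate hρ h).1 hh).isBiv.not_isTri]
    exact conn_σ (D := D) h
  · have := conjugate_σ_of_not_isTri hρ hh.isBiv.not_isTri
    rw [id, id, ← this]
    exact conn_σ (D := D.conjugate ρ) h

theorem degree_conjugate (hρ : ∀ h, ¬ D.IsTri h → ρ h = h) : (D.conjugate ρ).degree = D.degree := by
  unfold degree
  rw [Nat.card_congr (Equiv.subtypeEquivRight (isLeg_conjugate hρ)),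
    Nat.card_congr (Equiv.subtypeEquivRight (isTri_conjugate hρ))]

theorem conjugate_mem_gensLe (hρ : ∀ h, ¬ D.IsTri h → ρ h = h) (A : Set L) (n : ℕ) :
    D.conjugate ρ ∈ gensLe A n ↔ D ∈ gensLe A n := by
  refine and_congr (and_congr ?_ ?_) (by rw [degree_conjugate hρ])
  · exact forall_congr' fun h => not_congr (onLoop_conjugate hρ h)
  · exact forall_congr' fun h => imp_congr (isLeg_conjugate hρ h) Iff.rfl

/-- Conjugation commutes with the deletion of closed dashed loops. -/
def withoutLoopsConjugate (hρ : ∀ h, ¬ D.IsTri h → ρ h = h) (ρ' : Equiv.Perm D.withoutLoops.H)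
    (hρ' : ∀ h, (ρ' h).1 = ρ h.1) : Iso (D.withoutLoops.conjugate ρ') (D.conjugate ρ).withoutLoops where
  f := (Equiv.subtypeEquivRight fun h => not_congr (onLoop_conjugate hρ h)).symm
  map_e _ := rfl
  map_σ h := by
    refine Subtype.ext ?_
    obtain ⟨g, rfl⟩ := ρ'.surjective h
    change (ρ' (D.withoutLoops.σ (ρ'⁻¹ (ρ' g)))).1 = ρ (D.σ (ρ⁻¹ (ρ' g).1))
    rw [hρ', hρ', Equiv.Perm.inv_def, Equiv.symm_apply_apply, Equiv.Perm.inv_def, Equiv.symm_apply_apply]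
    rfl
  map_label _ _ := rfl

end Conj

/-! ### Attaching a leg -/

section Attach

variable {l : L} {s u : D.H} (hs : D.IsLeg s) (hu : D.IsLeg u) (hne : u ≠ s)

theorem attachLeg_σ_left : (D.attachLeg l s u hs hu hne).σ (.inl u) = .inl s := by
  have hs' : D.σ s = s := hs
  simp [ Equiv.swap_apply_def, hne, hs']

theorem attachLeg_σ_new : (D.attachLeg l s u hs hu hne).σ (.inl s) = .inr false := by
  simp [ Equiv.swap_apply_def]

theorem attachLeg_σ_false : (D.attachLeg l s u hs hu hne).σ (.inr false) = .inl u := by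
  have hu' : D.σ u = u := hu
  simp [hu']

theorem attachLeg_σ_true : (D.attachLeg l s u hs hu hne).σ (.inr true) = .inr true := by
  simp [ Equiv.swap_apply_def]

theorem attachLeg_σ_inl {h : D.H} (h1 : h ≠ u) (h2 : h ≠ s) :
    (D.attachLeg l s u hs hu hne).σ (.inl h) = .inl (D.σ h) := by
  simp [ Equiv.swap_apply_def, h1, h2]

theorem isTri_attachLeg_left : (D.attachLeg l s u hs hu hne).IsTri (.inl u) := by
  unfold IsTri
  rw [attachLeg_σ_left, attachLeg_σ_new]
  simpa using hne.symm

theorem isTri_attachLeg_new : (D.attachLeg l s u hs hu hne).IsTri (.inl s) := by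
  unfold IsTri
  rw [attachLeg_σ_new, attachLeg_σ_false]
  simpa using hne

theorem isTri_attachLeg_false : (D.attachLeg l s u hs hu hne).IsTri (.inr false) := by
  unfold IsTri
  rw [attachLeg_σ_false, attachLeg_σ_left]
  simp

theorem isLeg_attachLeg_true : (D.attachLeg l s u hs hu hne).IsLeg (.inr true) := attachLeg_σ_true hs hu hne

theorem σ_ne_leg {s u : D.H} (hs : D.IsLeg s) (hu : D.IsLeg u) {h : D.H} (h1 : h ≠ u)
    (h2 : h ≠ s) : D.σ h ≠ u ∧ D.σ h ≠ s := by
  have hu' : D.σ u = u := hu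
  have hs' : D.σ s = s := hs
  exact ⟨fun hh => h1 (D.σ.injective (hh.trans hu'.symm)),
    fun hh => h2 (D.σ.injective (hh.trans hs'.symm))⟩

theorem isLeg_attachLeg_inl {h : D.H} (h1 : h ≠ u) (h2 : h ≠ s) :
    (D.attachLeg l s u hs hu hne).IsLeg (.inl h) ↔ D.IsLeg h := by
  unfold IsLeg
  rw [attachLeg_σ_inl hs hu hne h1 h2]
  exact Sum.inl_injective.eq_iff

theorem isBiv_attachLeg_inl {h : D.H} (h1 : h ≠ u) (h2 : h ≠ s) :
    (D.attachLeg l s u hs hu hne).IsBiv (.inl h) ↔ D.IsBiv h := by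
  unfold IsBiv
  obtain ⟨h3, h4⟩ := σ_ne_leg hs hu h1 h2
  rw [attachLeg_σ_inl hs hu hne h1 h2, attachLeg_σ_inl hs hu hne h3 h4]
  exact and_congr Sum.inl_injective.ne_iff Sum.inl_injective.eq_iff

theorem isTri_attachLeg_inl {h : D.H} (h1 : h ≠ u) (h2 : h ≠ s) :
    (D.attachLeg l s u hs hu hne).IsTri (.inl h) ↔ D.IsTri h := by
  unfold IsTri
  obtain ⟨h3, h4⟩ := σ_ne_leg hs hu h1 h2
  rw [attachLeg_σ_inl hs hu hne h1 h2, attachLeg_σ_inl hs hu hne h3 h4]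
  exact and_congr Sum.inl_injective.ne_iff Sum.inl_injective.ne_iff

theorem not_onLoop_attachLeg_inr (b : Bool) : ¬ (D.attachLeg l s u hs hu hne).OnLoop (.inr b) := by
  cases b
  · exact fun h => h.isBiv.not_isTri (isTri_attachLeg_false hs hu hne)
  · exact fun h => (isLeg_attachLeg_true hs hu hne).not_isBiv h.isBiv

/-- The two legs involved in an attachment lie on components that are not loops, before and after.
-/
theorem onLoop_attachLeg_inl (h : D.H) :
    (D.attachLeg l s u hs hu hne).OnLoop (.inl h) ↔ D.OnLoop h := by
  have key : ∀ h, D.OnLoop h → h ≠ u ∧ h ≠ s := fun h hh =>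
    ⟨by rintro rfl; exact hu.not_isBiv hh.isBiv, by rintro rfl; exact hs.not_isBiv hh.isBiv⟩
  have key' : ∀ h, (D.attachLeg l s u hs hu hne).OnLoop (.inl h) → h ≠ u ∧ h ≠ s := fun h hh =>
    ⟨by rintro rfl; exact hh.isBiv.not_isTri (isTri_attachLeg_left hs hu hne),
      by rintro rfl; exact hh.isBiv.not_isTri (isTri_attachLeg_new hs hu hne)⟩
  constructor
  · intro hh
    refine onLoop_of_closed {h | (D.attachLeg l s u hs hu hne).OnLoop (.inl h)}
      (fun h hh => onLoop_e (D := D.attachLeg l s u hs hu hne).2 hh) (fun h hh => ?_)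
      (fun h hh => (isBiv_attachLeg_inl hs hu hne (key' h hh).1 (key' h hh).2).1 (OnLoop.isBiv hh)) hh
    have h2 := onLoop_σ.2 hh
    rwa [attachLeg_σ_inl hs hu hne (key' h hh).1 (key' h hh).2] at h2
  · intro hh
    refine onLoop_of_closed (D := D.attachLeg l s u hs hu hne) (Sum.inl '' {h | D.OnLoop h})
      ?_ ?_ ?_ ⟨h, hh, rfl⟩
    · rintro _ ⟨h, hh, rfl⟩
      exact ⟨D.e h, onLoop_e.2 hh, rfl⟩
    · rintro _ ⟨h, hh, rfl⟩
      exact ⟨D.σ h, onLoop_σ.2 hh, (attachLeg_σ_inl hs hu hne (key h hh).1 (key h hh).2).symm⟩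
    · rintro _ ⟨h, hh, rfl⟩
      exact (isBiv_attachLeg_inl hs hu hne (key h hh).1 (key h hh).2).2 (OnLoop.isBiv hh)

theorem loops_attachLeg : (D.attachLeg l s u hs hu hne).loops = D.loops := by
  have key : ∀ h, D.OnLoop h → h ≠ u ∧ h ≠ s := fun h hh =>
    ⟨by rintro rfl; exact hu.not_isBiv hh.isBiv, by rintro rfl; exact hs.not_isBiv hh.isBiv⟩
  refine (loops_congr Sum.inl (fun x : D.H ⊕ Bool => x.elim id fun _ => s)
    (fun h hh => (onLoop_attachLeg_inl hs hu hne h).2 hh) ?_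
    (fun h _ => conn_e (D := D.attachLeg l s u hs hu hne) (.inl h)) (fun h hh => ?_) ?_ ?_
    (fun h _ => .refl _) ?_).symm
  · rintro (h | b) hh
    · exact (onLoop_attachLeg_inl hs hu hne h).1 hh
    · exact (not_onLoop_attachLeg_inr hs hu hne b hh).elim
  · rw [← attachLeg_σ_inl hs hu hne (key h hh).1 (key h hh).2]
    exact conn_σ _
  · rintro (h | b) hh
    · exact conn_e h
    · exact .refl _
  · rintro (h | b) hh
    · have h1 := key h ((onLoop_attachLeg_inl hs hu hne h).1 hh)
      rw [attachLeg_σ_inl hs hu hne h1.1 h1.2]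
      exact conn_σ h
    · exact (not_onLoop_attachLeg_inr hs hu hne b hh).elim
  · rintro (h | b) hh
    · exact .refl _
    · exact (not_onLoop_attachLeg_inr hs hu hne b hh).elim

/-- Attaching a leg commutes with the deletion of closed dashed loops. -/
def withoutLoopsAttachLeg (hs' : ¬ D.OnLoop s) (hu' : ¬ D.OnLoop u)
    (hs0 : D.withoutLoops.IsLeg ⟨s, hs'⟩) (hu0 : D.withoutLoops.IsLeg ⟨u, hu'⟩)
    (hne0 : (⟨u, hu'⟩ : D.withoutLoops.H) ≠ ⟨s, hs'⟩) :
    Iso (D.withoutLoops.attachLeg l ⟨s, hs'⟩ ⟨u, hu'⟩ hs0 hu0 hne0)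
      (D.attachLeg l s u hs hu hne).withoutLoops where
  f := sumSubtypeEquiv _ _ (onLoop_attachLeg_inl hs hu hne) (not_onLoop_attachLeg_inr hs hu hne)
  map_e := by rintro (h | b) <;> rfl
  map_σ := by
    rintro (h | _ | _)
    · refine Subtype.ext ?_
      by_cases h1 : h = ⟨u, hu'⟩
      · subst h1
        rw [attachLeg_σ_left]
        exact (attachLeg_σ_left hs hu hne).symm
      · by_cases h2 : h = ⟨s, hs'⟩
        · subst h2
          rw [attachLeg_σ_new]
          exact (attachLeg_σ_new hs hu hne).symm
        · rw [attachLeg_σ_inl _ _ _ h1 h2]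
          exact (attachLeg_σ_inl hs hu hne (fun h => h1 (Subtype.ext h))
            (fun h => h2 (Subtype.ext h))).symm
    · refine Subtype.ext ?_
      rw [attachLeg_σ_false]
      exact (attachLeg_σ_false hs hu hne).symm
    · refine Subtype.ext ?_
      rw [attachLeg_σ_true]
      exact (attachLeg_σ_true hs hu hne).symm
  map_label := by rintro (h | b) _ <;> rfl

end Attach

end Ops

/-! ### Evaluation of diagrams with loops, and the relations it satisfies -/

section Eval

variable {L : Type} (A S : Set L) (n : ℕ) (t : ℚ)

open Classical in
/-- The class of a diagram in `B_{≤ n}(A)`; zero unless the diagram is one of the generators. -/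
noncomputable def cls (D : Diagram L) : BLe A S n :=
  if h : D ∈ gensLe A n then Submodule.Quotient.mk (Finsupp.single ⟨D, h⟩ 1) else 0

theorem mk_eq_cls (D : Diagram L) (hD : D ∈ gens A) : BLe.mk A S n D hD = cls A S n D := by
  unfold BLe.mk cls
  by_cases hn : D.degree ≤ n
  · rw [dif_pos hn, dif_pos (show D ∈ gensLe A n from ⟨hD, hn⟩)]
  · rw [dif_neg hn, dif_neg (fun h => hn h.2)]

theorem cls_of_notMem {D : Diagram L} (h : D ∉ gensLe A n) : cls A S n D = 0 := dif_neg h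

/-- The value of a diagram, possibly with closed dashed loops, in `B_{≤ n}(A)`: closed dashed loops
are replaced by the factor `t`. -/
noncomputable def eval (D : Diagram L) : BLe A S n := t ^ D.loops • cls A S n D.withoutLoops

/-- On combinations of generators, the linear extension of `cls` is the quotient map. The support
condition is needed because only relations among generators are divided out. -/
theorem linearCombination_cls_of_relator {r : Diagram L →₀ ℚ} (hr : Relator S r)
    (hs : ∀ D ∈ r.support, D ∈ gensLe A n) :
    Finsupp.linearCombination ℚ (cls A S n) r = 0 := by
  have h1 : Finsupp.linearCombination ℚ (cls A S n ∘ (Subtype.val : gensLe A n → Diagram L)) =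
      (Submodule.span ℚ {r : gensLe A n →₀ ℚ | Relator S (r.mapDomain Subtype.val)}).mkQ := by
    refine Finsupp.lhom_ext' fun D => LinearMap.ext_ring ?_
    simp only [LinearMap.comp_apply, Finsupp.lsingle_apply, Finsupp.linearCombination_single,
      one_smul, Function.comp_apply, Submodule.mkQ_apply]
    exact dif_pos D.2
  obtain ⟨r', rfl⟩ : ∃ r' : gensLe A n →₀ ℚ, r'.mapDomain Subtype.val = r :=
    ⟨_, Finsupp.mapDomain_comapDomain Subtype.val Subtype.val_injective r
      (fun D hD => ⟨⟨D, hs D hD⟩, rfl⟩)⟩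
  rw [Finsupp.linearCombination_mapDomain, h1, Submodule.mkQ_apply, Submodule.Quotient.mk_eq_zero]
  exact Submodule.subset_span hr

variable {A S n t} {D D' : Diagram L}

/-- Either all diagrams of the relation are generators, and the relation holds in the quotient, or
none is, and every term is zero by convention. A relation with only some terms of small degree would
not survive the truncation. -/
theorem cls_eq_zero_of_relator {ι : Type*} (s : Finset ι) (E : ι → Diagram L) (q : ι → ℚ)
    (hr : Relator S (∑ i ∈ s, q i • (E i).vec))
    (hs : ∀ i ∈ s, ∀ j ∈ s, E i ∈ gensLe A n ↔ E j ∈ gensLe A n) :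
    ∑ i ∈ s, q i • cls A S n (E i) = 0 := by
  classical
  by_cases h : ∀ i ∈ s, E i ∈ gensLe A n
  · have h1 := linearCombination_cls_of_relator A S n hr (fun D hD => ?_)
    · simpa [map_sum, vec, Finsupp.linearCombination_single] using h1
    · obtain ⟨i, hi, hD⟩ := Finset.mem_biUnion.1 (Finsupp.support_finsetSum hD)
      have h2 := Finsupp.support_smul hD
      rw [vec, Finsupp.support_single _ one_ne_zero, Finset.mem_singleton] at h2
      exact h2 ▸ h i hi
  · push Not at h
    obtain ⟨i, hi, h⟩ := h
    refine Finset.sum_eq_zero fun j hj => ?_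
    rw [cls_of_notMem A S n (fun h' => h ((hs i hi j hj).2 h')), smul_zero]

theorem Iso.cls_eq (f : Iso D D') : cls A S n D = cls A S n D' := by
  have h := cls_eq_zero_of_relator (A := A) (S := S) (n := n) Finset.univ ![D, D'] ![1, -1]
    (by simpa [Fin.sum_univ_two, sub_eq_add_neg] using Relator.iso f) (by
      have := f.mem_gensLe A n
      intro i _ j _
      fin_cases i <;> fin_cases j <;> simp [this])
  simpa [Fin.sum_univ_two, add_neg_eq_zero] using h

theorem Iso.eval_eq (f : Iso D D') : eval A S n t D = eval A S n t D' := by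
  unfold eval
  rw [f.loops_eq, f.withoutLoops.cls_eq]

theorem cls_subdiv (a : D.H) : cls A S n (D.subdiv a) = cls A S n D := by
  have h := cls_eq_zero_of_relator (A := A) (S := S) (n := n) Finset.univ ![D, D.subdiv a] ![1, -1]
    (by simpa [Fin.sum_univ_two, sub_eq_add_neg, subdivide_eq] using Relator.subdivide D a) (by
      have := D.subdiv_mem_gensLe a A n
      intro i _ j _
      fin_cases i <;> fin_cases j <;> simp [this])
  refine Eq.symm ?_
  simpa [Fin.sum_univ_two, add_neg_eq_zero] using h

theorem eval_subdiv (a : D.H) : eval A S n t (D.subdiv a) = eval A S n t D := by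
  unfold eval
  rw [loops_subdiv]
  by_cases ha : D.OnLoop a
  · rw [(withoutLoopsSubdivOnLoop a ha).cls_eq]
  · rw [← (withoutLoopsSubdiv a ha).cls_eq, cls_subdiv]

theorem eval_conjugate {ρ : Equiv.Perm D.H} (hρ : ∀ h, ¬ D.IsTri h → ρ h = h)
    (ρ' : Equiv.Perm D.withoutLoops.H) (hρ' : ∀ h, (ρ' h).1 = ρ h.1) :
    eval A S n t (D.conjugate ρ) = t ^ D.loops • cls A S n (D.withoutLoops.conjugate ρ') := by
  unfold eval
  rw [loops_conjugate hρ, (withoutLoopsConjugate hρ ρ' hρ').cls_eq]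

theorem swap_val {α : Type} {P : α → Prop} [DecidableEq α] [DecidableEq {a // P a}]
    (a b x : {a // P a}) : (Equiv.swap a b x).1 = Equiv.swap a.1 b.1 x.1 := by
  simp only [Equiv.swap_apply_def, Subtype.ext_iff]
  split_ifs <;> rfl

theorem cls_antisymm [DecidableEq D.H] (h : D.H) (hh : D.IsTri h) :
    cls A S n D + cls A S n (D.conjugate (Equiv.swap (D.σ h) (D.σ (D.σ h)))) = 0 := by
  have hρ : ∀ g, ¬ D.IsTri g → Equiv.swap (D.σ h) (D.σ (D.σ h)) g = g := fun g hg =>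
    Equiv.swap_apply_of_ne_of_ne (by rintro rfl; exact hg (by simpa [isTri_σ_iff] using hh))
      (by rintro rfl; exact hg (by simpa [isTri_σ_iff] using hh))
  have h0 := cls_eq_zero_of_relator (A := A) (S := S) (n := n) Finset.univ
    ![D, D.conjugate (Equiv.swap (D.σ h) (D.σ (D.σ h)))] ![1, 1]
    (by simp only [Fin.sum_univ_two, Matrix.cons_val_zero, Matrix.cons_val_one, one_smul]
        -- The relator is stated with classical decidability, hence a different instance in
        -- `Equiv.swap`.
        convert Relator.antisymm D h hh using 3
        rw [conj_eq]
        congr!) (by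
      have := D.conjugate_mem_gensLe hρ A n
      intro i _ j _
      fin_cases i <;> fin_cases j <;> simp [this])
  simpa [Fin.sum_univ_two] using h0

theorem not_onLoop_of_isTri {h : D.H} (hh : D.IsTri h) : ¬ D.OnLoop h :=
  fun h' => h'.isBiv.not_isTri hh

theorem not_onLoop_of_isLeg {h : D.H} (hh : D.IsLeg h) : ¬ D.OnLoop h :=
  fun h' => hh.not_isBiv h'.isBiv

/-- The trivalent vertex is not on a loop, so the relation takes place in the loop-free part, with
the common factor `t ^ D.loops`. -/
theorem eval_antisymm [DecidableEq D.H] (h : D.H) (hh : D.IsTri h) :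
    eval A S n t D + eval A S n t (D.conjugate (Equiv.swap (D.σ h) (D.σ (D.σ h)))) = 0 := by
  classical
  have hρ : ∀ g, ¬ D.IsTri g → Equiv.swap (D.σ h) (D.σ (D.σ h)) g = g := fun g hg =>
    Equiv.swap_apply_of_ne_of_ne (by rintro rfl; exact hg (by simpa [isTri_σ_iff] using hh))
      (by rintro rfl; exact hg (by simpa [isTri_σ_iff] using hh))
  have h1 : D.withoutLoops.IsTri ⟨h, not_onLoop_of_isTri hh⟩ := (isTri_withoutLoops _).2 hh
  rw [eval_conjugate hρ (Equiv.swap (D.withoutLoops.σ ⟨h, not_onLoop_of_isTri hh⟩)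
    (D.withoutLoops.σ (D.withoutLoops.σ ⟨h, not_onLoop_of_isTri hh⟩)))
    (fun g => swap_val _ _ g), eval, ← smul_add, cls_antisymm _ h1, smul_zero]

theorem cls_ihx [DecidableEq D.H] (a : D.H) (ha : D.IsTri a) (hd : D.IsTri (D.e a))
    (h1 : D.e a ≠ D.σ a) (h2 : D.e a ≠ D.σ (D.σ a)) (ρ : Equiv.Perm D.H)
    (hρ : ρ = Equiv.swap (D.σ a) (D.σ (D.σ a)) * Equiv.swap (D.σ (D.σ a)) (D.σ (D.e a)))
    (hρ' : ∀ h, ¬ D.IsTri h → ρ h = h) (hρρ : ∀ h, ¬ D.IsTri h → (ρ * ρ) h = h) :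
    cls A S n D + cls A S n (D.conjugate ρ) + cls A S n (D.conjugate (ρ * ρ)) = 0 := by
  have h0 := cls_eq_zero_of_relator (A := A) (S := S) (n := n) Finset.univ
    ![D, D.conjugate ρ, D.conjugate (ρ * ρ)] ![1, 1, 1]
    (by simp only [Fin.sum_univ_three, Matrix.cons_val_zero, Matrix.cons_val_one,
          Matrix.cons_val_two, Matrix.tail_cons, Matrix.head_cons, one_smul]
        exact Relator.ihx D a ha hd h1 h2 ρ (by rw [hρ]; congr!)) (by
      have e1 := D.conjugate_mem_gensLe hρ' A n
      have e2 := D.conjugate_mem_gensLe hρρ A n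
      intro i _ j _
      fin_cases i <;> fin_cases j <;> simp [e1, e2])
  simpa [Fin.sum_univ_three] using h0

theorem eval_ihx [DecidableEq D.H] (a : D.H) (ha : D.IsTri a) (hd : D.IsTri (D.e a))
    (h1 : D.e a ≠ D.σ a) (h2 : D.e a ≠ D.σ (D.σ a)) (ρ : Equiv.Perm D.H)
    (hρ : ρ = Equiv.swap (D.σ a) (D.σ (D.σ a)) * Equiv.swap (D.σ (D.σ a)) (D.σ (D.e a))) :
    eval A S n t D + eval A S n t (D.conjugate ρ) + eval A S n t (D.conjugate (ρ * ρ)) = 0 := by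
  classical
  have hρ' : ∀ g, ¬ D.IsTri g → ρ g = g := by
    intro g hg
    have i1 : g ≠ D.σ a := by rintro rfl; exact hg (by simpa [isTri_σ_iff] using ha)
    have i2 : g ≠ D.σ (D.σ a) := by rintro rfl; exact hg (by simpa [isTri_σ_iff] using ha)
    have i3 : g ≠ D.σ (D.e a) := by rintro rfl; exact hg (by simpa [isTri_σ_iff] using hd)
    rw [hρ, Equiv.Perm.mul_apply, Equiv.swap_apply_of_ne_of_ne i2 i3,
      Equiv.swap_apply_of_ne_of_ne i1 i2]
  have hρρ : ∀ g, ¬ D.IsTri g → (ρ * ρ) g = g := fun g hg => by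
    rw [Equiv.Perm.mul_apply, hρ' g hg, hρ' g hg]
  let a' : D.withoutLoops.H := ⟨a, not_onLoop_of_isTri ha⟩
  let ρ' : Equiv.Perm D.withoutLoops.H :=
    Equiv.swap (D.withoutLoops.σ a') (D.withoutLoops.σ (D.withoutLoops.σ a')) *
      Equiv.swap (D.withoutLoops.σ (D.withoutLoops.σ a')) (D.withoutLoops.σ (D.withoutLoops.e a'))
  have e1 : ∀ h, (ρ' h).1 = ρ h.1 := by
    intro h
    rw [hρ, Equiv.Perm.mul_apply, Equiv.Perm.mul_apply, swap_val, swap_val]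
    rfl
  have e2 : ∀ h, ((ρ' * ρ') h).1 = (ρ * ρ) h.1 := by
    intro h
    rw [Equiv.Perm.mul_apply, e1, e1, Equiv.Perm.mul_apply]
  rw [eval_conjugate hρ' ρ' e1, eval_conjugate hρρ (ρ' * ρ') e2, eval, ← smul_add, ← smul_add,
    cls_ihx a' ((isTri_withoutLoops _).2 ha) ((isTri_withoutLoops _).2 hd)
      (fun h => h1 (congrArg Subtype.val h)) (fun h => h2 (congrArg Subtype.val h)) ρ' rfl, smul_zero]
  · exact fun h hh => Subtype.ext ((e1 h).trans (hρ' _ (fun h' => hh ((isTri_withoutLoops _).2 h'))))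
  · exact fun h hh => Subtype.ext ((e2 h).trans (hρρ _ (fun h' => hh ((isTri_withoutLoops _).2 h'))))

/-! ### Link relations -/

theorem degree_congr (f : D.H ≃ D'.H) (h1 : ∀ h, D'.IsLeg (f h) ↔ D.IsLeg h)
    (h2 : ∀ h, D'.IsTri (f h) ↔ D.IsTri h) : D.degree = D'.degree := by
  unfold degree
  rw [Nat.card_congr (f.subtypeEquiv fun h => (h1 h).symm),
    Nat.card_congr (f.subtypeEquiv fun h => (h2 h).symm)]

section Link

variable {l : L} {s u : D.H} (hs : D.IsLeg s) (hu : D.IsLeg u) (hne : u ≠ s)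

theorem isLeg_attachLeg_iff (x : D.H ⊕ Bool) : (D.attachLeg l s u hs hu hne).IsLeg x ↔
    x = .inr true ∨ ∃ h, x = .inl h ∧ h ≠ u ∧ h ≠ s ∧ D.IsLeg h := by
  rcases x with h | _ | _
  · by_cases h1 : h = u
    · subst h1
      have := (isTri_attachLeg_left (l := l) hs hu hne)
      simpa using fun h' : (D.attachLeg l s h hs hu hne).IsLeg (.inl h) => h'.not_isTri this
    · by_cases h2 : h = s
      · subst h2
        have := (isTri_attachLeg_new (l := l) hs hu hne)
        simpa using fun h' : (D.attachLeg l h u hs hu hne).IsLeg (.inl h) => h'.not_isTri this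
      · simp [isLeg_attachLeg_inl hs hu hne h1 h2, h1, h2]
  · have := (isTri_attachLeg_false (l := l) hs hu hne)
    simpa using fun h' : (D.attachLeg l s u hs hu hne).IsLeg (.inr false) => h'.not_isTri this
  · simp [isLeg_attachLeg_true (l := l) hs hu hne]

theorem isTri_attachLeg_iff (x : D.H ⊕ Bool) : (D.attachLeg l s u hs hu hne).IsTri x ↔
    x = .inr false ∨ ∃ h, x = .inl h ∧ (h = u ∨ h = s ∨ D.IsTri h) := by
  rcases x with h | _ | _
  · by_cases h1 : h = u
    · subst h1
      simp [isTri_attachLeg_left (l := l) hs hu hne]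
    · by_cases h2 : h = s
      · subst h2
        simp [isTri_attachLeg_new (l := l) hs hu hne]
      · simp [isTri_attachLeg_inl hs hu hne h1 h2, h1, h2]
  · simp [isTri_attachLeg_false (l := l) hs hu hne]
  · have := (isLeg_attachLeg_true (l := l) hs hu hne)
    simp [fun h' : (D.attachLeg l s u hs hu hne).IsTri (.inr true) => this.not_isTri h']

theorem degree_attachLeg_eq {u' : D.H} (hu' : D.IsLeg u') (hne' : u' ≠ s) :
    (D.attachLeg l s u hs hu hne).degree = (D.attachLeg l s u' hs hu' hne').degree := by
  classical
  by_cases h0 : u = u'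
  · subst h0
    rfl
  · refine degree_congr (Equiv.swap (.inl u) (.inl u')) ?_ ?_
    · intro x
      rw [isLeg_attachLeg_iff, isLeg_attachLeg_iff]
      rcases x with h | b
      · by_cases h1 : h = u
        · subst h1
          simp
        · by_cases h2 : h = u'
          · subst h2
            simp [hu, hu', hne, hne', h0, Ne.symm h0]
          · rw [Equiv.swap_apply_of_ne_of_ne (by simpa) (by simpa)]
            simp [h1, h2]
      · rw [Equiv.swap_apply_of_ne_of_ne (by simp) (by simp)]
        simp
    · intro x
      rw [isTri_attachLeg_iff, isTri_attachLeg_iff]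
      rcases x with h | b
      · by_cases h1 : h = u
        · subst h1
          simp
        · by_cases h2 : h = u'
          · subst h2
            simp [hu.not_isTri, hu'.not_isTri, hne, hne', h0, Ne.symm h0]
          · rw [Equiv.swap_apply_of_ne_of_ne (by simpa) (by simpa)]
            simp [h1, h2]
      · rw [Equiv.swap_apply_of_ne_of_ne (by simp) (by simp)]
        simp

/-- The right-hand side depends on `u` only through the degree, which `degree_attachLeg_eq` shows to
be independent of `u`. Hence the terms of a link relation are generators all together or not at all.
-/
theorem attachLeg_mem_gensLe (hl : D.label u = l) : D.attachLeg l s u hs hu hne ∈ gensLe A n ↔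
    D.LoopFree ∧ (∀ h, h ≠ s → D.IsLeg h → D.label h ∈ A) ∧
      (D.attachLeg l s u hs hu hne).degree ≤ n := by
  rw [← and_assoc]
  refine and_congr (and_congr ?_ ?_) Iff.rfl
  · refine ⟨fun H h hh => H (.inl h) ((onLoop_attachLeg_inl hs hu hne h).2 hh), ?_⟩
    rintro H (h | b) hh
    · exact H h ((onLoop_attachLeg_inl hs hu hne h).1 hh)
    · exact not_onLoop_attachLeg_inr hs hu hne b hh
  · constructor
    · intro H h h1 h2
      by_cases h3 : h = u
      · subst h3
        rw [hl]
        exact H (.inr true) (isLeg_attachLeg_true hs hu hne)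
      · exact H (.inl h) ((isLeg_attachLeg_inl hs hu hne h3 h1).2 h2)
    · intro H x hx
      rcases (isLeg_attachLeg_iff hs hu hne x).1 hx with rfl | ⟨h, rfl, _, h2, h3⟩
      · exact hl ▸ H u hne hu
      · exact H h h2 h3

end Link

theorem cls_link {l : L} (hl : l ∈ S) {s : D.H} (hs : D.IsLeg s) :
    ∑ᶠ u : {u : D.H // D.IsLeg u ∧ D.label u = l ∧ u ≠ s},
      cls A S n (D.attachLeg l s u.1 hs u.2.1 u.2.2.2) = 0 := by
  have := D.finite
  have := Fintype.ofFinite {u : D.H // D.IsLeg u ∧ D.label u = l ∧ u ≠ s}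
  have h0 := cls_eq_zero_of_relator (A := A) (S := S) (n := n) Finset.univ
    (fun u : {u : D.H // D.IsLeg u ∧ D.label u = l ∧ u ≠ s} =>
      D.attachLeg l s u.1 hs u.2.1 u.2.2.2) (fun _ => 1)
    (by simpa [finsum_eq_sum_of_fintype, attach_eq] using Relator.link D l hl s hs)
    (fun i _ j _ => by
      rw [attachLeg_mem_gensLe hs _ _ i.2.2.1, attachLeg_mem_gensLe hs _ _ j.2.2.1,
        degree_attachLeg_eq hs i.2.1 i.2.2.2 j.2.1 j.2.2.2])
  simpa [finsum_eq_sum_of_fintype] using h0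

theorem eval_link {l : L} (hl : l ∈ S) {s : D.H} (hs : D.IsLeg s) :
    ∑ᶠ u : {u : D.H // D.IsLeg u ∧ D.label u = l ∧ u ≠ s},
      eval A S n t (D.attachLeg l s u.1 hs u.2.1 u.2.2.2) = 0 := by
  have := D.finite
  have key := cls_link (A := A) (n := n) hl (D := D.withoutLoops)
    (s := ⟨s, not_onLoop_of_isLeg hs⟩) ((isLeg_withoutLoops _).2 hs)
  -- Legs are never on loops, so deleting the loops does not change the index set of the link
  -- relation.
  let φ : {u : D.withoutLoops.H // D.withoutLoops.IsLeg u ∧ D.withoutLoops.label u = l ∧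
      u ≠ ⟨s, not_onLoop_of_isLeg hs⟩} ≃ {u : D.H // D.IsLeg u ∧ D.label u = l ∧ u ≠ s} :=
    { toFun := fun u => ⟨u.1.1, (isLeg_withoutLoops _).1 u.2.1, u.2.2.1,
        fun h => u.2.2.2 (Subtype.ext h)⟩
      invFun := fun u => ⟨⟨u.1, not_onLoop_of_isLeg u.2.1⟩, (isLeg_withoutLoops _).2 u.2.1, u.2.2.1,
        fun h => u.2.2.2 (congrArg Subtype.val h)⟩
      left_inv := fun _ => rfl
      right_inv := fun _ => rfl }
  rw [← finsum_comp_equiv φ]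
  have h1 : ∀ u, eval A S n t (D.attachLeg l s (φ u).1 hs (φ u).2.1 (φ u).2.2.2) =
      t ^ D.loops • cls A S n (D.withoutLoops.attachLeg l ⟨s, not_onLoop_of_isLeg hs⟩ u.1
        ((isLeg_withoutLoops _).2 hs) u.2.1 u.2.2.2) := by
    intro u
    unfold eval
    rw [loops_attachLeg]
    exact congrArg _ (withoutLoopsAttachLeg hs (φ u).2.1 (φ u).2.2.2
      (not_onLoop_of_isLeg hs) u.1.2 ((isLeg_withoutLoops _).2 hs) u.2.1 u.2.2.2).cls_eq.symm
  simp_rw [h1]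
  rw [← smul_finsum, key, smul_zero]

end Eval

/-! ### Joining legs along an involution -/

section Join

variable {L : Type}

/-- Involutions that move legs only. -/
structure IsMatching (D : Diagram L) (τ : Equiv.Perm D.H) : Prop where
  invol : ∀ h, τ (τ h) = h
  isLeg : ∀ h, τ h ≠ h → D.IsLeg h

variable {D : Diagram L} {τ : Equiv.Perm D.H}

theorem IsMatching.moved (_ : D.IsMatching τ) {h : D.H} (h1 : τ h ≠ h) : τ (τ h) ≠ τ h := by
  rwa [τ.injective.ne_iff]

theorem IsMatching.σ_moved (hτ : D.IsMatching τ) {h : D.H} (h1 : τ h ≠ h) :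
    D.σ (τ h) = τ h := hτ.isLeg _ (hτ.moved h1)

theorem IsMatching.fixed_σ (hτ : D.IsMatching τ) {h : D.H} (h1 : τ h = h) :
    τ (D.σ h) = D.σ h := by
  by_contra h2
  have h3 : D.σ h = h := D.σ.injective (hτ.isLeg _ h2)
  rw [h3] at h2
  exact h2 h1

/-- Pairs of legs are joined according to the involution `τ`. -/
abbrev join (D : Diagram L) (τ : Equiv.Perm D.H) (hτ : D.IsMatching τ) : Diagram L where
  H := D.H
  finite := D.finite
  e := D.e
  σ := D.σ * τ
  label := D.label
  e_e := D.e_e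
  e_ne := D.e_ne
  valence h := by
    simp only [Equiv.Perm.mul_apply]
    by_cases h1 : τ h = h
    · have h2 := hτ.fixed_σ h1
      have h3 := hτ.fixed_σ h2
      rw [h1, h2, h3]
      exact D.valence h
    · right; left
      rw [hτ.σ_moved h1, hτ.invol]
      exact hτ.isLeg h h1

variable (hτ : D.IsMatching τ)

theorem join_σ_of_ne {h : D.H} (h1 : τ h ≠ h) : (D.join τ hτ).σ h = τ h := hτ.σ_moved h1

theorem join_σ_of_eq {h : D.H} (h1 : τ h = h) : (D.join τ hτ).σ h = D.σ h := congrArg D.σ h1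

theorem isLeg_join (h : D.H) : (D.join τ hτ).IsLeg h ↔ D.IsLeg h ∧ τ h = h := by
  by_cases h1 : τ h = h
  · unfold IsLeg
    rw [join_σ_of_eq hτ h1]
    exact ⟨fun h2 => ⟨h2, h1⟩, fun h2 => h2.1⟩
  · unfold IsLeg
    rw [join_σ_of_ne hτ h1]
    exact ⟨fun h2 => absurd h2 h1, fun h2 => h2.2⟩

theorem isBiv_join_of_ne {h : D.H} (h1 : τ h ≠ h) : (D.join τ hτ).IsBiv h := by
  unfold IsBiv
  rw [join_σ_of_ne hτ h1, join_σ_of_ne hτ (hτ.moved h1), hτ.invol]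
  exact ⟨h1, rfl⟩

theorem isBiv_join_of_eq {h : D.H} (h1 : τ h = h) : (D.join τ hτ).IsBiv h ↔ D.IsBiv h := by
  unfold IsBiv
  rw [join_σ_of_eq hτ h1, join_σ_of_eq hτ (hτ.fixed_σ h1)]

theorem isTri_join (h : D.H) : (D.join τ hτ).IsTri h ↔ D.IsTri h := by
  by_cases h1 : τ h = h
  · unfold IsTri
    rw [join_σ_of_eq hτ h1, join_σ_of_eq hτ (hτ.fixed_σ h1)]
  · exact iff_of_false (isBiv_join_of_ne hτ h1).not_isTri (hτ.isLeg h h1).not_isTri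

end Join

/-! ### Contraction of an edge between two subdivision points -/

section Contract

variable {L : Type} {D : Diagram L} {u : D.H} (h1 : D.IsBiv u) (h2 : D.IsBiv (D.e u))

theorem e_mem_iff (D : Diagram L) (u h : D.H) :
    (D.e h ≠ u ∧ D.e h ≠ D.e u) ↔ (h ≠ u ∧ h ≠ D.e u) := by
  have h1 : D.e h = u ↔ h = D.e u :=
    ⟨fun h1 => by rw [← h1, D.e_e], fun h1 => by rw [h1, D.e_e]⟩
  have h2 := D.e.injective.eq_iff (a := h) (b := u)
  tauto

open Classical in
/-- The contraction of the edge `{u, e u}` on the vertices. -/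
noncomputable def contractVertex (D : Diagram L) (u h : D.H) : D.H :=
  if D.σ h = u ∨ D.σ h = D.e u then D.σ (D.e (D.σ h)) else D.σ h

include h1 h2 in
theorem contractVertex_mem {h : D.H} (hh : h ≠ u ∧ h ≠ D.e u) :
    D.contractVertex u h ≠ u ∧ D.contractVertex u h ≠ D.e u := by
  unfold contractVertex
  split_ifs with h3
  · rcases h3 with h3 | h3
    · have h4 : h = D.σ u := D.σ.injective (h3.trans h1.2.symm)
      rw [h3]
      refine ⟨fun h5 => hh.2 ?_, h2.1⟩
      rw [h4]
      exact D.σ.injective (by rw [h1.2, h5])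
    · have h4 : h = D.σ (D.e u) := D.σ.injective (h3.trans h2.2.symm)
      rw [h3, D.e_e]
      refine ⟨h1.1, fun h5 => hh.1 ?_⟩
      rw [h4, ← h5, h1.2]
  · push Not at h3
    exact h3

/-- The contraction of an edge `{u, e u}` that joins two subdivision points.  The contraction of
a closed dashed loop with one subdivision point is its deletion. -/
noncomputable abbrev contract (D : Diagram L) (u : D.H) (h1 : D.IsBiv u)
    (h2 : D.IsBiv (D.e u)) : Diagram L where
  H := {h : D.H // h ≠ u ∧ h ≠ D.e u}
  finite := by have := D.finite; infer_instance
  e := D.e.subtypePerm fun h => D.e_mem_iff u h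
  σ := Equiv.ofBijective (fun h => ⟨D.contractVertex u h.1, contractVertex_mem h1 h2 h.2⟩) (by
    have := D.finite
    refine Finite.injective_iff_bijective.1 ?_
    rintro ⟨x, hx⟩ ⟨y, hy⟩ hxy
    have hxy := congrArg Subtype.val hxy
    refine Subtype.ext ?_
    change x = y
    simp only [contractVertex] at hxy
    split_ifs at hxy with h3 h4 h4
    · exact D.σ.injective (D.e.injective (D.σ.injective hxy))
    · have h5 := D.σ.injective hxy
      rcases h3 with h3 | h3 <;> rw [h3] at h5
      · exact (hy.2 h5.symm).elim
      · exact (hy.1 (h5.symm.trans (D.e_e u))).elim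
    · have h5 := D.σ.injective hxy
      rcases h4 with h3 | h3 <;> rw [h3] at h5
      · exact (hx.2 h5).elim
      · exact (hx.1 (h5.trans (D.e_e u))).elim
    · exact D.σ.injective hxy)
  label h := D.label h.1
  e_e h := Subtype.ext (D.e_e h.1)
  e_ne h hh := D.e_ne h.1 (congrArg Subtype.val hh)
  valence := by
    rintro ⟨h, hh⟩
    simp only [Equiv.ofBijective_apply, Subtype.mk.injEq]
    have hu : ∀ g, D.σ (D.σ g) ≠ g → ¬ (D.σ g = u ∨ D.σ g = D.e u) := by
      rintro g hg (h3 | h3)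
      · have h4 : g = D.σ u := D.σ.injective (h3.trans h1.2.symm)
        rw [h4, h1.2] at hg
        exact hg rfl
      · have h4 : g = D.σ (D.e u) := D.σ.injective (h3.trans h2.2.symm)
        rw [h4, h2.2] at hg
        exact hg rfl
    have hh' : ¬ (h = u ∨ h = D.e u) := by tauto
    by_cases h3 : D.σ h = u ∨ D.σ h = D.e u
    · right; left
      rw [contractVertex, contractVertex, if_pos h3]
      rcases h3 with h3 | h3
      · have h4 : h = D.σ u := D.σ.injective (h3.trans h1.2.symm)
        rw [h3, if_pos (by rw [h2.2]; exact .inr rfl), h2.2, D.e_e, h4]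
      · have h4 : h = D.σ (D.e u) := D.σ.injective (h3.trans h2.2.symm)
        rw [h3, D.e_e, if_pos (by rw [h1.2]; exact .inl rfl), h1.2, h4]
    · by_cases h4 : D.σ (D.σ h) = h
      · right; left
        rw [contractVertex, contractVertex, if_neg h3, h4, if_neg hh']
      · have h5 : D.σ (D.σ (D.σ h)) = h := by
          rcases D.valence h with h5 | h5 | h5
          · exact absurd (by rw [h5, h5]) h4
          · exact absurd h5 h4
          · exact h5
        right; right
        have e1 : D.contractVertex u h = D.σ h := if_neg h3
        have e2 : D.contractVertex u (D.σ h) = D.σ (D.σ h) :=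
          if_neg (hu _ (by rw [h5]; exact fun h6 => h4 (by rw [← h6, ← h6])))
        have e3 : D.contractVertex u (D.σ (D.σ h)) = h := by
          rw [contractVertex, if_neg (by rw [h5]; exact hh'), h5]
        rw [e1, e2, e3]

theorem contract_σ_of_eq {h : (D.contract u h1 h2).H} (h3 : D.σ h.1 = u) :
    ((D.contract u h1 h2).σ h).1 = D.σ (D.e u) := by
  have : D.contractVertex u h.1 = D.σ (D.e u) := by
    rw [contractVertex, if_pos (.inl h3), h3]
  exact this

theorem contract_σ_of_eq' {h : (D.contract u h1 h2).H} (h3 : D.σ h.1 = D.e u) :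
    ((D.contract u h1 h2).σ h).1 = D.σ u := by
  have : D.contractVertex u h.1 = D.σ u := by
    rw [contractVertex, if_pos (.inr h3), h3, D.e_e]
  exact this

theorem contract_σ_of_ne {h : (D.contract u h1 h2).H} (h3 : D.σ h.1 ≠ u) (h4 : D.σ h.1 ≠ D.e u) :
    ((D.contract u h1 h2).σ h).1 = D.σ h.1 :=
  if_neg (by tauto)

open Classical in
/-- The half-edges of `D`, after the reinsertion of the contracted edge `{u, e u}`. -/
noncomputable def reinsert (D : Diagram L) (u : D.H) : {h : D.H // h ≠ u ∧ h ≠ D.e u} ⊕ Bool → D.H :=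
  Sum.elim (fun h => if h.1 = D.σ u then D.e u else h.1) (fun b => if b then D.σ u else u)

theorem reinsert_inl_of_eq {h : {h : D.H // h ≠ u ∧ h ≠ D.e u}} (h3 : h.1 = D.σ u) :
    D.reinsert u (.inl h) = D.e u := if_pos h3

theorem reinsert_inl_of_ne {h : {h : D.H // h ≠ u ∧ h ≠ D.e u}} (h3 : h.1 ≠ D.σ u) :
    D.reinsert u (.inl h) = h.1 := if_neg h3

theorem reinsert_false : D.reinsert u (.inr false) = u := by simp [reinsert]

theorem reinsert_true : D.reinsert u (.inr true) = D.σ u := by simp [reinsert]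

include h1 in
theorem reinsert_bijective (h3 : D.σ u ≠ D.e u) : Function.Bijective (D.reinsert u) := by
  constructor
  · rintro (x | _ | _) (y | _ | _) hxy
    · by_cases hx : x.1 = D.σ u <;> by_cases hy : y.1 = D.σ u
      · exact congrArg _ (Subtype.ext (hx.trans hy.symm))
      · rw [reinsert_inl_of_eq hx, reinsert_inl_of_ne hy] at hxy
        exact (y.2.2 hxy.symm).elim
      · rw [reinsert_inl_of_ne hx, reinsert_inl_of_eq hy] at hxy
        exact (x.2.2 hxy).elim
      · rw [reinsert_inl_of_ne hx, reinsert_inl_of_ne hy] at hxy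
        exact congrArg _ (Subtype.ext hxy)
    · rw [reinsert_false] at hxy
      by_cases hx : x.1 = D.σ u
      · rw [reinsert_inl_of_eq hx] at hxy
        exact (D.e_ne _ hxy).elim
      · rw [reinsert_inl_of_ne hx] at hxy
        exact (x.2.1 hxy).elim
    · rw [reinsert_true] at hxy
      by_cases hx : x.1 = D.σ u
      · rw [reinsert_inl_of_eq hx] at hxy
        exact (h3 hxy.symm).elim
      · rw [reinsert_inl_of_ne hx] at hxy
        exact (hx hxy).elim
    · rw [reinsert_false] at hxy
      by_cases hx : y.1 = D.σ u
      · rw [reinsert_inl_of_eq hx] at hxy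
        exact (D.e_ne _ hxy.symm).elim
      · rw [reinsert_inl_of_ne hx] at hxy
        exact (y.2.1 hxy.symm).elim
    · rfl
    · rw [reinsert_false, reinsert_true] at hxy
      exact (h1.1 hxy.symm).elim
    · rw [reinsert_true] at hxy
      by_cases hx : y.1 = D.σ u
      · rw [reinsert_inl_of_eq hx] at hxy
        exact (h3 hxy).elim
      · rw [reinsert_inl_of_ne hx] at hxy
        exact (hx hxy.symm).elim
    · rw [reinsert_false, reinsert_true] at hxy
      exact (h1.1 hxy).elim
    · rfl
  · intro h
    by_cases h4 : h = u
    · exact ⟨.inr false, by rw [reinsert_false, h4]⟩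
    · by_cases h5 : h = D.e u
      · exact ⟨.inl ⟨D.σ u, h1.1, h3⟩, by rw [reinsert_inl_of_eq rfl, h5]⟩
      · by_cases h6 : h = D.σ u
        · exact ⟨.inr true, by rw [reinsert_true, h6]⟩
        · exact ⟨.inl ⟨h, h4, h5⟩, reinsert_inl_of_ne h6⟩

/-- The contracted edge can be reinserted by a subdivision, unless it formed a closed dashed
loop. -/
noncomputable def contractSubdiv (h3 : D.σ u ≠ D.e u) :
    Iso ((D.contract u h1 h2).subdiv ⟨D.σ u, h1.1, h3⟩) D where
  f := Equiv.ofBijective (D.reinsert u) (reinsert_bijective h1 h3)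
  map_e x := by
    change D.reinsert u (((D.contract u h1 h2).subdiv ⟨D.σ u, h1.1, h3⟩).e x) =
      D.e (D.reinsert u x)
    rcases x with h | _ | _
    · by_cases h6 : h = ⟨D.σ u, h1.1, h3⟩
      · rw [h6, subdiv_e_inl_self, reinsert_false, reinsert_inl_of_eq rfl, D.e_e]
      · have h6' : h.1 ≠ D.σ u := fun h => h6 (Subtype.ext h)
        by_cases h7 : h = (D.contract u h1 h2).e ⟨D.σ u, h1.1, h3⟩
        · have h8 : h.1 = D.e (D.σ u) := congrArg Subtype.val h7
          rw [reinsert_inl_of_ne h6', h8, h7, subdiv_e_inl_e, reinsert_true, D.e_e]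
        · rw [subdiv_e_inl _ h6 h7, reinsert_inl_of_ne h6', reinsert_inl_of_ne]
          · rfl
          · intro h8
            have h9 : D.e h.1 = D.σ u := h8
            exact h7 (Subtype.ext (by change h.1 = D.e (D.σ u); rw [← h9, D.e_e]))
    · rw [subdiv_e_false, reinsert_false, reinsert_inl_of_eq rfl]
    · rw [subdiv_e_true, reinsert_true, reinsert_inl_of_ne]
      · rfl
      · exact D.e_ne _
  map_σ x := by
    change D.reinsert u (((D.contract u h1 h2).subdiv ⟨D.σ u, h1.1, h3⟩).σ x) =
      D.σ (D.reinsert u x)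
    have h0 : D.σ (D.e u) ≠ D.σ u := fun h => D.e_ne u (D.σ.injective h)
    rcases x with h | _ | _
    · rw [subdiv_σ_inl]
      by_cases h6 : h.1 = D.σ u
      · have := contract_σ_of_eq h1 h2 (h := h) (by rw [h6, h1.2])
        rw [reinsert_inl_of_ne (by rwa [this]), this, reinsert_inl_of_eq h6]
      · rw [reinsert_inl_of_ne h6]
        by_cases h7 : D.σ h.1 = D.e u
        · have := contract_σ_of_eq' h1 h2 (h := h) h7
          rw [reinsert_inl_of_eq this, h7]
        · have h8 : D.σ h.1 ≠ u := fun h8 => h6 (D.σ.injective (h8.trans h1.2.symm))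
          have := contract_σ_of_ne h1 h2 (h := h) h8 h7
          rw [reinsert_inl_of_ne, this]
          rw [this]
          exact fun h9 => h.2.1 (D.σ.injective h9)
    · rw [subdiv_σ_inr, reinsert_false, Bool.not_false, reinsert_true]
    · rw [subdiv_σ_inr, reinsert_true, Bool.not_true, reinsert_false, h1.2]
  map_label x hh := by
    change D.label (D.reinsert u x) = _
    rcases x with h | b
    · rw [reinsert_inl_of_ne]
      · rfl
      · intro h6
        have h7 : (D.contract u h1 h2).σ h = h := Sum.inl_injective hh
        have h8 := congrArg Subtype.val h7
        rw [contract_σ_of_eq h1 h2 (by rw [h6, h1.2]), h6] at h8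
        exact D.e_ne u (D.σ.injective h8)
    · exact (hh.not_isBiv (isBiv_subdiv_inr _ b)).elim

variable {A S : Set L} {n : ℕ} {t : ℚ}

/-- The contraction only removes one of two subdivision points on an edge or loop, and subdivision
does not change the value. -/
theorem eval_contract (h3 : D.σ u ≠ D.e u) :
    eval A S n t D = eval A S n t (D.contract u h1 h2) := by
  rw [← (contractSubdiv h1 h2 h3).eval_eq, eval_subdiv]

section LoopCase

variable (h3 : D.σ u = D.e u)

include h1 h3 in
theorem σ_ne_of_loop {h : D.H} (hh : h ≠ u ∧ h ≠ D.e u) : D.σ h ≠ u ∧ D.σ h ≠ D.e u := by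
  refine ⟨fun h4 => hh.2 (D.σ.injective ?_), fun h4 => hh.1 (D.σ.injective ?_)⟩
  · rw [h4, ← h3, h1.2]
  · rw [h4, h3]

include h3 in
theorem contract_σ_of_loop (h : (D.contract u h1 h2).H) :
    ((D.contract u h1 h2).σ h).1 = D.σ h.1 :=
  contract_σ_of_ne h1 h2 (σ_ne_of_loop h1 h3 h.2).1 (σ_ne_of_loop h1 h3 h.2).2

include h3 in
theorem isBiv_contract_of_loop (h : (D.contract u h1 h2).H) :
    (D.contract u h1 h2).IsBiv h ↔ D.IsBiv h.1 := by
  unfold IsBiv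
  rw [Ne, Subtype.ext_iff, Subtype.ext_iff, contract_σ_of_loop h1 h2 h3,
    contract_σ_of_loop h1 h2 h3, contract_σ_of_loop h1 h2 h3]

include h1 h2 h3 in
theorem onLoop_of_loop : D.OnLoop u := by
  refine onLoop_of_closed {h | h = u ∨ h = D.e u} ?_ ?_ ?_ (.inl rfl)
  · rintro _ (rfl | rfl)
    · exact .inr rfl
    · exact .inl (D.e_e u)
  · rintro _ (rfl | rfl)
    · exact .inr h3
    · rw [← h3, h1.2]
      exact .inl rfl
  · rintro _ (rfl | rfl)
    · exact h1
    · exact h2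

include h3 in
theorem onLoop_contract (h : (D.contract u h1 h2).H) :
    (D.contract u h1 h2).OnLoop h ↔ D.OnLoop h.1 := by
  constructor
  · intro hh
    refine onLoop_of_closed (Subtype.val '' {h | (D.contract u h1 h2).OnLoop h}) ?_ ?_ ?_
      ⟨h, hh, rfl⟩
    · rintro _ ⟨g, hg, rfl⟩
      exact ⟨_, onLoop_e.2 hg, rfl⟩
    · rintro _ ⟨g, hg, rfl⟩
      exact ⟨_, onLoop_σ.2 hg, contract_σ_of_loop h1 h2 h3 g⟩
    · rintro _ ⟨g, hg, rfl⟩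
      exact (isBiv_contract_of_loop h1 h2 h3 g).1 (OnLoop.isBiv hg)
  · intro hh
    refine onLoop_of_closed (D := D.contract u h1 h2) {h | D.OnLoop h.1} ?_ ?_ ?_ hh
    · exact fun g hg => onLoop_e (D := D).2 hg
    · intro g hg
      rw [Set.mem_ofPred_eq, contract_σ_of_loop h1 h2 h3]
      exact onLoop_σ.2 hg
    · exact fun g hg => (isBiv_contract_of_loop h1 h2 h3 g).2 (OnLoop.isBiv hg)

-- If `σ u = e u`, then `{u, e u}` is an entire connected component.
include h1 h3 in
theorem conn_of_loop {a b : D.H} (hab : D.conn a b) :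
    (a ≠ u ∧ a ≠ D.e u) ↔ (b ≠ u ∧ b ≠ D.e u) := by
  induction hab with
  | rel x y hxy =>
    rcases hxy with rfl | rfl
    · exact (D.e_mem_iff u x).symm
    · refine ⟨σ_ne_of_loop h1 h3, fun h => ⟨?_, ?_⟩⟩
      · rintro rfl
        exact h.2 h3
      · rintro rfl
        rw [← h3, h1.2] at h
        exact h.1 rfl
  | refl => rfl
  | symm _ _ _ ih => exact ih.symm
  | trans _ _ _ _ _ ih1 ih2 => exact ih1.trans ih2

include h3 in
theorem conn_contract (a b : (D.contract u h1 h2).H) :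
    (D.contract u h1 h2).conn a b ↔ D.conn a.1 b.1 := by
  constructor
  · intro hab
    induction hab with
    | rel x y hxy =>
      rcases hxy with rfl | rfl
      · exact conn_e x.1
      · rw [contract_σ_of_loop h1 h2 h3]
        exact conn_σ x.1
    | refl => exact .refl _
    | symm _ _ _ ih => exact .symm _ _ ih
    | trans _ _ _ _ _ ih1 ih2 => exact .trans _ _ _ ih1 ih2
  · have key : ∀ a b : D.H, D.conn a b → ∀ ha hb,
        (D.contract u h1 h2).conn ⟨a, ha⟩ ⟨b, hb⟩ := by
      intro a b hab
      induction hab with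
      | rel x y hxy =>
        intro hx hy
        rcases hxy with rfl | rfl
        · exact conn_e (D := D.contract u h1 h2) ⟨x, hx⟩
        · refine .rel _ _ (.inr (Subtype.ext (contract_σ_of_loop h1 h2 h3 ⟨x, hx⟩).symm))
      | refl => exact fun _ _ => .refl _
      | symm _ _ _ ih => exact fun ha hb => .symm _ _ (ih hb ha)
      | trans x y z hxy _ ih1 ih2 =>
        exact fun ha hb => .trans _ _ _ (ih1 ha ((conn_of_loop h1 h3 hxy).1 ha)) (ih2 _ hb)
    exact fun hab => key a.1 b.1 hab a.2 b.2

-- The contracted component is one loop with a single subdivision point; it corresponds to `none`,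
-- and all other loops stay as they are.
include h3 in
theorem loops_contract : D.loops = (D.contract u h1 h2).loops + 1 := by
  have := D.finite
  have hf : Finite (Quotient (D.contract u h1 h2).loopSetoid) := Quotient.finite _
  rw [loops_eq_card, loops_eq_card, ← Finite.card_option]
  let φ : Option (Quotient (D.contract u h1 h2).loopSetoid) → Quotient D.loopSetoid
    | none => Quotient.mk _ ⟨u, onLoop_of_loop h1 h2 h3⟩
    | some q => Quotient.map' (s₁ := (D.contract u h1 h2).loopSetoid) (s₂ := D.loopSetoid)
        (fun h => ⟨h.1.1, (onLoop_contract h1 h2 h3 h.1).1 h.2⟩)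
        (fun a b hab => (conn_contract h1 h2 h3 a.1 b.1).1 hab) q
  refine (Nat.card_congr (Equiv.ofBijective φ ⟨?_, ?_⟩)).symm
  · rintro (_ | a) (_ | b) hab
    · rfl
    · induction b using Quotient.inductionOn with
      | h b =>
        have h4 : D.loopSetoid _ _ := Quotient.exact hab
        exact (((conn_of_loop h1 h3 (a := u) (b := b.1.1) h4).2 b.1.2).1 rfl).elim
    · induction a using Quotient.inductionOn with
      | h a =>
        have h4 : D.loopSetoid _ _ := Quotient.exact hab
        exact (((conn_of_loop h1 h3 (a := a.1.1) (b := u) h4).1 a.1.2).1 rfl).elim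
    · induction a using Quotient.inductionOn with
      | h a =>
        induction b using Quotient.inductionOn with
        | h b =>
          have h4 : D.loopSetoid _ _ := Quotient.exact hab
          have h5 : (D.contract u h1 h2).loopSetoid a b := (conn_contract h1 h2 h3 a.1 b.1).2 h4
          exact congrArg some (Quotient.sound h5)
  · intro q
    induction q using Quotient.inductionOn with
    | h a =>
      by_cases ha : a.1 ≠ u ∧ a.1 ≠ D.e u
      · exact ⟨some (Quotient.mk _ ⟨⟨a.1, ha⟩, (onLoop_contract h1 h2 h3 _).2 a.2⟩), rfl⟩
      · refine ⟨none, Quotient.sound ?_⟩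
        change D.conn u a.1
        rw [not_and_or, not_ne_iff, not_ne_iff] at ha
        rcases ha with ha | ha
        · rw [ha]
        · rw [ha]
          exact conn_e u

-- Here contraction deletes a whole loop, which is what the factor `t` accounts for.
include h3 in
theorem eval_contract_of_loop :
    eval A S n t D = t • eval A S n t (D.contract u h1 h2) := by
  have f : Iso D.withoutLoops (D.contract u h1 h2).withoutLoops :=
    { f :=
        { toFun := fun h => ⟨⟨h.1, fun h4 => h.2 (h4 ▸ onLoop_of_loop h1 h2 h3), fun h4 => h.2
            (h4 ▸ onLoop_e.2 (onLoop_of_loop h1 h2 h3))⟩,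
              fun h4 => h.2 ((onLoop_contract h1 h2 h3 _).1 h4)⟩
          invFun := fun h => ⟨h.1.1, fun h4 => h.2 ((onLoop_contract h1 h2 h3 _).2 h4)⟩
          left_inv := fun _ => rfl
          right_inv := fun _ => rfl }
      map_e := fun _ => rfl
      map_σ := fun h => Subtype.ext (Subtype.ext (contract_σ_of_loop h1 h2 h3 ⟨h.1, _⟩).symm)
      map_label := fun _ _ => rfl }
  unfold eval
  rw [f.cls_eq, loops_contract h1 h2 h3, pow_succ', mul_smul]

end LoopCase

end Contract

/-! ### Erasing a subdivision point -/

section Smooth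

variable {L : Type} {D : Diagram L} {p : D.H}

open Classical in
/-- The edges of `D` when the subdivision point `{p, σ p}` is erased. -/
noncomputable def smoothEdge (D : Diagram L) (p h : D.H) : D.H :=
  if D.e h = p then D.e (D.σ p) else if D.e h = D.σ p then D.e p else D.e h

theorem smoothEdge_mem (h2 : D.e p ≠ D.σ p) (h : D.H) :
    D.smoothEdge p h ≠ p ∧ D.smoothEdge p h ≠ D.σ p := by
  have h3 : D.e (D.σ p) ≠ p := fun h3 => h2 (by rw [← D.e_e (D.σ p), h3])
  unfold smoothEdge
  split_ifs with h4 h5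
  · exact ⟨h3, D.e_ne _⟩
  · exact ⟨D.e_ne _, h2⟩
  · exact ⟨h4, h5⟩

theorem smoothEdge_invol (h1 : D.IsBiv p) {h : D.H} (hh : h ≠ p ∧ h ≠ D.σ p) :
    D.smoothEdge p (D.smoothEdge p h) = h := by
  by_cases h4 : D.e h = p
  · have e1 : D.smoothEdge p h = D.e (D.σ p) := if_pos h4
    rw [e1, smoothEdge, D.e_e, if_neg h1.1, if_pos rfl, ← h4, D.e_e]
  · by_cases h5 : D.e h = D.σ p
    · have e1 : D.smoothEdge p h = D.e p := by rw [smoothEdge, if_neg h4, if_pos h5]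
      rw [e1, smoothEdge, D.e_e, if_pos rfl, ← h5, D.e_e]
    · have e1 : D.smoothEdge p h = D.e h := by rw [smoothEdge, if_neg h4, if_neg h5]
      rw [e1, smoothEdge, D.e_e, if_neg hh.1, if_neg hh.2]

theorem smoothEdge_ne (h1 : D.IsBiv p) {h : D.H} : D.smoothEdge p h ≠ h := by
  unfold smoothEdge
  split_ifs with h4 h5
  · rintro rfl
    rw [D.e_e] at h4
    exact h1.1 h4
  · rintro rfl
    rw [D.e_e] at h5
    exact h1.1 h5.symm
  · exact D.e_ne h

theorem σ_mem_iff (h1 : D.IsBiv p) (h : D.H) :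
    (D.σ h ≠ p ∧ D.σ h ≠ D.σ p) ↔ (h ≠ p ∧ h ≠ D.σ p) := by
  have h2 : D.σ h = p ↔ h = D.σ p :=
    ⟨fun h2 => D.σ.injective (h2.trans h1.2.symm), fun h2 => by rw [h2, h1.2]⟩
  have h3 := D.σ.injective.eq_iff (a := h) (b := p)
  tauto

/-- The subdivision point `{p, σ p}` is erased. -/
noncomputable abbrev smooth (D : Diagram L) (p : D.H) (h1 : D.IsBiv p) (h2 : D.e p ≠ D.σ p) :
    Diagram L where
  H := {h : D.H // h ≠ p ∧ h ≠ D.σ p}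
  finite := by have := D.finite; infer_instance
  e :=
    { toFun := fun h => ⟨D.smoothEdge p h.1, smoothEdge_mem h2 h.1⟩
      invFun := fun h => ⟨D.smoothEdge p h.1, smoothEdge_mem h2 h.1⟩
      left_inv := fun h => Subtype.ext (smoothEdge_invol h1 h.2)
      right_inv := fun h => Subtype.ext (smoothEdge_invol h1 h.2) }
  σ := D.σ.subtypePerm fun h => σ_mem_iff h1 h
  label h := D.label h.1
  e_e h := Subtype.ext (smoothEdge_invol h1 h.2)
  e_ne h hh := smoothEdge_ne h1 (congrArg Subtype.val hh)
  valence h := by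
    rcases D.valence h.1 with h3 | h3 | h3
    · exact .inl (Subtype.ext h3)
    · exact .inr (.inl (Subtype.ext h3))
    · exact .inr (.inr (Subtype.ext h3))

/-- The half-edges of `D`, after the reinsertion of the subdivision point `{p, σ p}`. -/
def unsmooth (D : Diagram L) (p : D.H) : {h : D.H // h ≠ p ∧ h ≠ D.σ p} ⊕ Bool → D.H :=
  Sum.elim Subtype.val (fun b => if b then D.σ p else p)

theorem unsmooth_bijective (h1 : D.IsBiv p) : Function.Bijective (D.unsmooth p) := by
  constructor
  · rintro (x | _ | _) (y | _ | _) hxy <;> simp only [unsmooth, Sum.elim_inl, Sum.elim_inr,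
      Bool.false_eq_true, if_true, if_false] at hxy
    · exact congrArg _ (Subtype.ext hxy)
    · exact (x.2.1 hxy).elim
    · exact (x.2.2 hxy).elim
    · exact (y.2.1 hxy.symm).elim
    · rfl
    · exact (h1.1 hxy.symm).elim
    · exact (y.2.2 hxy.symm).elim
    · exact (h1.1 hxy).elim
    · rfl
  · intro h
    by_cases h3 : h = p
    · exact ⟨.inr false, by simp [unsmooth, h3]⟩
    · by_cases h4 : h = D.σ p
      · exact ⟨.inr true, by simp [unsmooth, h4]⟩
      · exact ⟨.inl ⟨h, h3, h4⟩, rfl⟩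

/-- The erased subdivision point can be reinserted. -/
noncomputable def smoothSubdiv (h1 : D.IsBiv p) (h2 : D.e p ≠ D.σ p) :
    Iso ((D.smooth p h1 h2).subdiv ⟨D.e p, D.e_ne p, h2⟩) D where
  f := Equiv.ofBijective (D.unsmooth p) (unsmooth_bijective h1)
  map_e x := by
    change D.unsmooth p (((D.smooth p h1 h2).subdiv ⟨D.e p, D.e_ne p, h2⟩).e x) =
      D.e (D.unsmooth p x)
    have h3 : D.smoothEdge p (D.e p) = D.e (D.σ p) := if_pos (D.e_e p)
    rcases x with h | _ | _
    · by_cases h6 : h = ⟨D.e p, D.e_ne p, h2⟩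
      · rw [h6, subdiv_e_inl_self]
        exact (D.e_e p).symm
      · by_cases h7 : h = (D.smooth p h1 h2).e ⟨D.e p, D.e_ne p, h2⟩
        · have h8 : h.1 = D.e (D.σ p) := (congrArg Subtype.val h7).trans h3
          rw [h7, subdiv_e_inl_e, ← h7]
          change D.σ p = D.e h.1
          rw [h8, D.e_e]
        · rw [subdiv_e_inl _ h6 h7]
          change D.smoothEdge p h.1 = D.e h.1
          have h8 : D.e h.1 ≠ p := fun h8 => h6 (Subtype.ext (by
            exact (D.e_e h.1).symm.trans (congrArg D.e h8)))
          have h9 : D.e h.1 ≠ D.σ p := fun h9 => h7 (Subtype.ext (by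
            change h.1 = D.smoothEdge p (D.e p)
            exact ((D.e_e h.1).symm.trans (congrArg D.e h9)).trans h3.symm))
          rw [smoothEdge, if_neg h8, if_neg h9]
    · rfl
    · exact h3
  map_σ x := by
    rcases x with h | _ | _
    · rfl
    · rfl
    · exact h1.2.symm
  map_label x hh := by
    rcases x with h | b
    · rfl
    · exact (hh.not_isBiv (isBiv_subdiv_inr _ b)).elim

theorem eval_smooth {A S : Set L} {n : ℕ} {t : ℚ} (h1 : D.IsBiv p) (h2 : D.e p ≠ D.σ p) :
    eval A S n t D = eval A S n t (D.smooth p h1 h2) := by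
  rw [← (smoothSubdiv h1 h2).eval_eq, eval_subdiv]

end Smooth

/-! ### From gluing with chords to joining legs -/

section Contraction

variable {L : Type} {A S : Set L} {n : ℕ} {t : ℚ}

/-- Several edges that join subdivision points can be contracted at the same time, if no two of
them are adjacent. -/
theorem eval_eq_of_contraction (N : ℕ) : ∀ {U V : Diagram L} (ι : V.H → U.H),
    Function.Injective ι → (∀ v, ι (V.e v) = U.e (ι v)) →
    (∀ y ∉ Set.range ι, U.IsBiv y ∧ U.σ y ∈ Set.range ι) →
    (∀ v, U.σ (ι v) ∈ Set.range ι → ι (V.σ v) = U.σ (ι v)) →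
    (∀ v, U.σ (ι v) ∉ Set.range ι → ι (V.σ v) = U.σ (U.e (U.σ (ι v)))) →
    (∀ v, V.IsLeg v → U.label (ι v) = V.label v) → Nat.card U.H = N →
    eval A S n t U = eval A S n t V := by
  induction N using Nat.strong_induction_on with
  | h N IH =>
    intro U V ι hι he hb hσ hσ' hl hN
    have := U.finite
    by_cases hsurj : Function.Surjective ι
    · exact (Iso.eval_eq ⟨Equiv.ofBijective ι ⟨hι, hsurj⟩, he, fun v => hσ v (hsurj _), hl⟩).symm
    · rw [Function.Surjective, not_forall] at hsurj
      obtain ⟨y, hy⟩ := hsurj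
      have hee : ∀ z, U.e z ∈ Set.range ι → z ∈ Set.range ι := by
        rintro z ⟨v, hv⟩
        exact ⟨V.e v, by rw [he, hv, U.e_e]⟩
      have hy' : U.e y ∉ Set.range ι := fun h => hy (hee _ h)
      have h1 := (hb y hy).1
      have h2 := (hb _ hy').1
      -- `σ y` lies in the image of `ι` and `e y` does not. So the edge `{y, e y}` is not a loop by
      -- itself, and contracting it costs no factor.
      have h3 : U.σ y ≠ U.e y := fun h3 => hy' (h3 ▸ (hb y hy).2)
      rw [eval_contract h1 h2 h3]
      have hne : ∀ x ∈ Set.range ι, x ≠ y ∧ x ≠ U.e y := fun x hx =>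
        ⟨by rintro rfl; exact hy hx, by rintro rfl; exact hy' hx⟩
      have hmem : ∀ v, ι v ≠ y ∧ ι v ≠ U.e y := fun v => hne _ ⟨v, rfl⟩
      let ι' : V.H → (U.contract y h1 h2).H := fun v => ⟨ι v, hmem v⟩
      have hr : ∀ x : (U.contract y h1 h2).H, x ∈ Set.range ι' ↔ x.1 ∈ Set.range ι := fun x =>
        ⟨fun ⟨v, hv⟩ => ⟨v, congrArg Subtype.val hv⟩, fun ⟨v, hv⟩ => ⟨v, Subtype.ext hv⟩⟩
      refine IH (Nat.card (U.contract y h1 h2).H) ?_ ι' ?_ ?_ ?_ ?_ ?_ ?_ rfl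
      · rw [← hN]
        exact Finite.card_subtype_lt (x := y) (by simp)
      · exact fun v w h => hι (congrArg Subtype.val h)
      · exact fun v => Subtype.ext (he v)
      · intro z hz
        rw [hr] at hz
        obtain ⟨h4, h5⟩ := hb _ hz
        have h6 := hne _ h5
        have h7 : ((U.contract y h1 h2).σ z).1 = U.σ z.1 := contract_σ_of_ne h1 h2 h6.1 h6.2
        have h8 : ((U.contract y h1 h2).σ ((U.contract y h1 h2).σ z)).1 = z.1 := by
          rw [contract_σ_of_ne h1 h2, h7, h4.2]
          · rw [h7, h4.2]; exact z.2.1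
          · rw [h7, h4.2]; exact z.2.2
        refine ⟨⟨fun h => h4.1 ?_, Subtype.ext h8⟩, ?_⟩
        · rw [← h7, h]
        · rw [hr, h7]
          exact h5
      · intro v hv
        rw [hr] at hv
        refine Subtype.ext ?_
        change ι (V.σ v) = _
        by_cases h4 : U.σ (ι v) = y
        · rw [contract_σ_of_eq h1 h2 (h := ι' v) h4, hσ' v (by rwa [h4]), h4]
        · by_cases h5 : U.σ (ι v) = U.e y
          · rw [contract_σ_of_eq' h1 h2 (h := ι' v) h5, hσ' v (by rwa [h5]), h5, U.e_e]
          · rw [contract_σ_of_ne h1 h2 (h := ι' v) h4 h5] at hv ⊢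
            exact hσ v hv
      · intro v hv
        rw [hr] at hv
        refine Subtype.ext ?_
        change ι (V.σ v) = _
        by_cases h4 : U.σ (ι v) = y
        · rw [contract_σ_of_eq h1 h2 (h := ι' v) h4] at hv
          exact (hv (hb _ hy').2).elim
        · by_cases h5 : U.σ (ι v) = U.e y
          · rw [contract_σ_of_eq' h1 h2 (h := ι' v) h5] at hv
            exact (hv (hb _ hy).2).elim
          · have h6 := contract_σ_of_ne h1 h2 (h := ι' v) h4 h5
            rw [h6] at hv
            have h7 : ((U.contract y h1 h2).e ((U.contract y h1 h2).σ (ι' v))).1 =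
                U.e (U.σ (ι v)) := congrArg U.e h6
            have h8 : U.e (U.σ (ι v)) ∉ Set.range ι := fun h => hv (hee _ h)
            have h9 := hne _ (hb _ h8).2
            rw [contract_σ_of_ne h1 h2 (by rw [h7]; exact h9.1) (by rw [h7]; exact h9.2), h7]
            exact hσ' v hv
      · exact hl

/-- The positions of the legs of `D` that are glued to the legs of `C`. -/
def Gluing.toEmbedding {X : Set L} {C D : Diagram L} (g : Gluing X C D)
    (hC : ∀ c, C.IsLeg c ∧ C.label c ∈ X) : C.H ↪ D.H where
  toFun c := (g.1 ⟨c, hC c⟩).1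
  inj' _ _ h := congrArg Subtype.val (g.1.injective (Subtype.ext h))

theorem isMatching_viaEmbedding {J : Type} {D : Diagram L} (τ : Equiv.Perm J)
    (hτ : ∀ j, τ (τ j) = j) (ℓ : J ↪ D.H) (hℓ : ∀ j, D.IsLeg (ℓ j)) :
    D.IsMatching (τ.viaEmbedding ℓ) := by
  constructor
  · intro h
    by_cases hh : h ∈ Set.range ℓ
    · obtain ⟨j, rfl⟩ := hh
      rw [Equiv.Perm.viaEmbedding_apply, Equiv.Perm.viaEmbedding_apply, hτ]
    · rw [Equiv.Perm.viaEmbedding_apply_of_notMem _ _ _ hh,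
        Equiv.Perm.viaEmbedding_apply_of_notMem _ _ _ hh]
  · intro h hh
    by_cases h1 : h ∈ Set.range ℓ
    · obtain ⟨j, rfl⟩ := h1
      exact hℓ j
    · exact (hh (Equiv.Perm.viaEmbedding_apply_of_notMem _ _ _ h1)).elim

theorem Gluing.isLeg {X : Set L} {C D : Diagram L} (g : Gluing X C D)
    (hC : ∀ c, C.IsLeg c ∧ C.label c ∈ X) (c : C.H) : D.IsLeg (g.toEmbedding hC c) :=
  (g.1 ⟨c, hC c⟩).2.1

/-- Gluing with chords amounts to joining legs in pairs. -/
theorem eval_glue {X : Set L} {C D : Diagram L} (g : Gluing X C D)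
    (hC : ∀ c, C.IsLeg c ∧ C.label c ∈ X) :
    eval A S n t (glue g) = eval A S n t (D.join (C.e.viaEmbedding (g.toEmbedding hC))
      (isMatching_viaEmbedding _ C.e_e _ (g.isLeg hC))) := by
  have hσc : ∀ c, (glue g).σ (.inl c) = .inr (g.toEmbedding hC c) := by
    intro c
    change Sum.map C.σ D.σ (glueLegs g (.inl c)) = _
    simp only [glueLegs, dif_pos (hC c), Sum.map_inr]
    exact congrArg Sum.inr (g.isLeg hC c)
  have hσd : ∀ c, (glue g).σ (.inr (g.toEmbedding hC c)) = .inl c := by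
    intro c
    have h1 : D.IsLeg (g.toEmbedding hC c) ∧ D.label (g.toEmbedding hC c) ∈ X :=
      (g.1 ⟨c, hC c⟩).2
    have h2 : g.1.symm ⟨g.toEmbedding hC c, h1⟩ = ⟨c, hC c⟩ := g.1.symm_apply_apply _
    change Sum.map C.σ D.σ (glueLegs g (.inr _)) = _
    simp only [glueLegs, dif_pos h1, Sum.map_inl, h2]
    exact congrArg Sum.inl (hC c).1
  have hσn : ∀ d, d ∉ Set.range (g.toEmbedding hC) → (glue g).σ (.inr d) = .inr (D.σ d) := by
    intro d hd
    have h1 : ¬ (D.IsLeg d ∧ D.label d ∈ X) := fun h1 => hd ⟨(g.1.symm ⟨d, h1⟩).1, by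
      exact congrArg Subtype.val (g.1.apply_symm_apply ⟨d, h1⟩)⟩
    change Sum.map C.σ D.σ (glueLegs g (.inr d)) = _
    simp only [glueLegs, dif_neg h1, Sum.map_inr]
  -- Each chord becomes an edge between two subdivision points whose other halves are in `D`.
  -- Contracting all the chords leaves the legs of `D` joined directly, along `C.e`.
  refine eval_eq_of_contraction (Nat.card (glue g).H) (U := glue g) (V := D.join _ _) Sum.inr
    Sum.inr_injective (fun _ => rfl) ?_ ?_ ?_ (fun _ _ => rfl) rfl
  · rintro (c | d) hy
    · unfold IsBiv
      rw [hσc, hσd]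
      exact ⟨⟨Sum.inr_ne_inl, rfl⟩, ⟨_, rfl⟩⟩
    · exact (hy ⟨d, rfl⟩).elim
  · intro d hd
    by_cases h1 : d ∈ Set.range (g.toEmbedding hC)
    · obtain ⟨c, rfl⟩ := h1
      rw [hσd] at hd
      obtain ⟨d, hd⟩ := hd
      exact (Sum.inr_ne_inl hd).elim
    · rw [hσn d h1, Equiv.Perm.mul_apply, Equiv.Perm.viaEmbedding_apply_of_notMem _ _ _ h1]
  · intro d hd
    by_cases h1 : d ∈ Set.range (g.toEmbedding hC)
    · obtain ⟨c, rfl⟩ := h1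
      rw [hσd, Equiv.Perm.mul_apply, Equiv.Perm.viaEmbedding_apply]
      change _ = (glue g).σ (.inl (C.e c))
      rw [hσc]
      exact congrArg Sum.inr (g.isLeg hC _)
    · rw [hσn d h1] at hd
      exact (hd ⟨_, rfl⟩).elim

end Contraction

/-! ### Pairings of a family of legs: loops, struts and antisymmetry -/

section Pairing

variable {L : Type} {A S : Set L} {n : ℕ} {t : ℚ} {J : Type}

/-- The legs `ℓ j` are joined in pairs according to the involution `τ`. -/
noncomputable abbrev pairUp (E : Diagram L) (ℓ : J ↪ E.H) (hℓ : ∀ j, E.IsLeg (ℓ j))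
    (τ : Equiv.Perm J) (hτ : ∀ j, τ (τ j) = j) : Diagram L :=
  E.join (τ.viaEmbedding ℓ) (isMatching_viaEmbedding τ hτ ℓ hℓ)

variable {E : Diagram L} {ℓ : J ↪ E.H} (hℓ : ∀ j, E.IsLeg (ℓ j)) {τ : Equiv.Perm J}
  (hτ : ∀ j, τ (τ j) = j)

theorem pairUp_σ (j : J) : (pairUp E ℓ hℓ τ hτ).σ (ℓ j) = ℓ (τ j) := by
  rw [Equiv.Perm.mul_apply, Equiv.Perm.viaEmbedding_apply]
  exact hℓ _

theorem pairUp_σ_of_notMem {h : E.H} (hh : h ∉ Set.range ℓ) :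
    (pairUp E ℓ hℓ τ hτ).σ h = E.σ h := by
  rw [Equiv.Perm.mul_apply, Equiv.Perm.viaEmbedding_apply_of_notMem _ _ _ hh]

theorem pairUp_σ_congr {τ' : Equiv.Perm J} (hτ' : ∀ j, τ' (τ' j) = j) {h : E.H}
    (hh : ∀ j, h = ℓ j → τ j = τ' j) :
    (pairUp E ℓ hℓ τ hτ).σ h = (pairUp E ℓ hℓ τ' hτ').σ h := by
  by_cases h1 : h ∈ Set.range ℓ
  · obtain ⟨j, rfl⟩ := h1
    rw [pairUp_σ, pairUp_σ, hh j rfl]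
  · rw [pairUp_σ_of_notMem _ _ h1, pairUp_σ_of_notMem _ _ h1]

theorem eval_pairUp_congr {τ' : Equiv.Perm J} (hτ' : ∀ j, τ' (τ' j) = j) (h : τ = τ') :
    eval A S n t (pairUp E ℓ hℓ τ hτ) = eval A S n t (pairUp E ℓ hℓ τ' hτ') := by
  subst h
  rfl

theorem isBiv_pairUp {j : J} (hj : τ j ≠ j) : (pairUp E ℓ hℓ τ hτ).IsBiv (ℓ j) :=
  isBiv_join_of_ne _ (by rwa [Equiv.Perm.viaEmbedding_apply, ℓ.injective.ne_iff])

theorem isBiv_pairUp_of_notMem {h : E.H} (hh : h ∉ Set.range ℓ) :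
    (pairUp E ℓ hℓ τ hτ).IsBiv h ↔ E.IsBiv h :=
  isBiv_join_of_eq _ (Equiv.Perm.viaEmbedding_apply_of_notMem _ _ _ hh)

theorem isTri_pairUp (h : E.H) : (pairUp E ℓ hℓ τ hτ).IsTri h ↔ E.IsTri h := isTri_join _ h

theorem isLeg_pairUp (hne : ∀ j, τ j ≠ j) (h : E.H) :
    (pairUp E ℓ hℓ τ hτ).IsLeg h ↔ E.IsLeg h ∧ h ∉ Set.range ℓ := by
  rw [isLeg_join]
  refine and_congr_right fun _ => ⟨?_, Equiv.Perm.viaEmbedding_apply_of_notMem _ _ _⟩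
  rintro h1 ⟨j, rfl⟩
  rw [Equiv.Perm.viaEmbedding_apply, ℓ.injective.eq_iff] at h1
  exact hne j h1

theorem viaEmbedding_subtype {H : Type} {P : H → Prop} (τ : Equiv.Perm J) (ℓ : J ↪ H)
    (ℓ' : J ↪ {h // P h}) (h1 : ∀ j, (ℓ' j).1 = ℓ j) (h : {h // P h}) :
    (τ.viaEmbedding ℓ' h).1 = τ.viaEmbedding ℓ h.1 := by
  by_cases hh : h ∈ Set.range ℓ'
  · obtain ⟨j, rfl⟩ := hh
    rw [Equiv.Perm.viaEmbedding_apply, h1, h1, Equiv.Perm.viaEmbedding_apply]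
  · rw [Equiv.Perm.viaEmbedding_apply_of_notMem _ _ _ hh,
      Equiv.Perm.viaEmbedding_apply_of_notMem]
    rintro ⟨j, hj⟩
    exact hh ⟨j, Subtype.ext ((h1 j).trans hj)⟩

/-- Loops that are already present can be split off before joining legs. -/
theorem eval_pairUp_contract {p : E.H} (h1 : E.IsBiv p) (h2 : E.IsBiv (E.e p))
    (h3 : E.σ p = E.e p) (ℓ' : J ↪ (E.contract p h1 h2).H) (hl : ∀ j, (ℓ' j).1 = ℓ j)
    (hℓ' : ∀ j, (E.contract p h1 h2).IsLeg (ℓ' j)) :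
    eval A S n t (pairUp E ℓ hℓ τ hτ) =
      t • eval A S n t (pairUp (E.contract p h1 h2) ℓ' hℓ' τ hτ) := by
  have hp : p ∉ Set.range ℓ := by
    rintro ⟨j, rfl⟩
    exact (hℓ j).not_isBiv h1
  have hp' : E.e p ∉ Set.range ℓ := by
    rintro ⟨j, hj⟩
    exact (hℓ j).not_isBiv (hj ▸ h2)
  have h1' : (pairUp E ℓ hℓ τ hτ).IsBiv p := (isBiv_pairUp_of_notMem hℓ hτ hp).2 h1
  have h2' : (pairUp E ℓ hℓ τ hτ).IsBiv ((pairUp E ℓ hℓ τ hτ).e p) :=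
    (isBiv_pairUp_of_notMem hℓ hτ hp').2 h2
  have h3' : (pairUp E ℓ hℓ τ hτ).σ p = (pairUp E ℓ hℓ τ hτ).e p := by
    rw [pairUp_σ_of_notMem _ _ hp, h3]
  rw [eval_contract_of_loop h1' h2' h3']
  refine congrArg _ (Iso.eval_eq ⟨Equiv.refl _, fun _ => rfl, fun h => Subtype.ext ?_,
    fun _ _ => rfl⟩)
  change (((pairUp E ℓ hℓ τ hτ).contract p h1' h2').σ h).1 = _
  rw [contract_σ_of_loop h1' h2' h3']
  change _ = ((E.contract p h1 h2).σ (τ.viaEmbedding ℓ' h)).1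
  rw [contract_σ_of_loop h1 h2 h3, viaEmbedding_subtype τ ℓ ℓ' hl]
  rfl

/-- Subdivision points that are already present can be erased before joining legs. -/
theorem eval_pairUp_smooth {p : E.H} (h1 : E.IsBiv p) (h2 : E.e p ≠ E.σ p)
    (ℓ' : J ↪ (E.smooth p h1 h2).H) (hl : ∀ j, (ℓ' j).1 = ℓ j)
    (hℓ' : ∀ j, (E.smooth p h1 h2).IsLeg (ℓ' j)) :
    eval A S n t (pairUp E ℓ hℓ τ hτ) =
      eval A S n t (pairUp (E.smooth p h1 h2) ℓ' hℓ' τ hτ) := by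
  have hp : p ∉ Set.range ℓ := by
    rintro ⟨j, rfl⟩
    exact (hℓ j).not_isBiv h1
  have h1' : (pairUp E ℓ hℓ τ hτ).IsBiv p := (isBiv_pairUp_of_notMem hℓ hτ hp).2 h1
  have h0 : (pairUp E ℓ hℓ τ hτ).σ p = E.σ p := pairUp_σ_of_notMem _ _ hp
  have h2' : (pairUp E ℓ hℓ τ hτ).e p ≠ (pairUp E ℓ hℓ τ hτ).σ p := by
    rw [h0]
    exact h2
  rw [eval_smooth h1' h2']
  refine Iso.eval_eq ⟨Equiv.subtypeEquivRight fun h => by rw [h0], fun h => Subtype.ext ?_,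
    fun h => Subtype.ext ?_, fun _ _ => rfl⟩
  · have key : ∀ x : E.H, (pairUp E ℓ hℓ τ hτ).smoothEdge p x = E.smoothEdge p x := by
      intro x
      unfold smoothEdge
      rw [h0]
    exact key h.1
  · change E.σ (τ.viaEmbedding ℓ h.1) = E.σ (τ.viaEmbedding ℓ' _).1
    rw [viaEmbedding_subtype τ ℓ ℓ' hl]
    rfl

variable [DecidableEq J]

theorem swap_conj_involutive {τ : Equiv.Perm J} (hτ : ∀ j, τ (τ j) = j) (a b : J) :
    ∀ j, (Equiv.swap a b * τ * Equiv.swap a b) ((Equiv.swap a b * τ * Equiv.swap a b) j) = j := by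
  intro j
  simp [hτ]

/-- Joining the two ends of a strut to other legs amounts to joining those legs. -/
theorem eval_pairUp_strut {a b a' : J} (hab : E.e (ℓ a) = ℓ b) (ha : τ a = b) (hne : ∀ j, τ j ≠ j)
    (ha' : a' ≠ a) :
    eval A S n t (pairUp E ℓ hℓ (Equiv.swap b a' * τ * Equiv.swap b a')
      (swap_conj_involutive hτ b a')) = (if a' = b then t else 1) •
    eval A S n t ((pairUp E ℓ hℓ τ hτ).contract (ℓ a) (isBiv_pairUp hℓ hτ (hne a)) (by
      rw [show (pairUp E ℓ hℓ τ hτ).e (ℓ a) = ℓ b from hab]; exact isBiv_pairUp hℓ hτ (hne b))) := by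
  have h1 := isBiv_pairUp hℓ hτ (hne a)
  have h2 : (pairUp E ℓ hℓ τ hτ).IsBiv ((pairUp E ℓ hℓ τ hτ).e (ℓ a)) := by
    rw [show (pairUp E ℓ hℓ τ hτ).e (ℓ a) = ℓ b from hab]; exact isBiv_pairUp hℓ hτ (hne b)
  have h3 : (pairUp E ℓ hℓ τ hτ).σ (ℓ a) = (pairUp E ℓ hℓ τ hτ).e (ℓ a) := by
    rw [pairUp_σ, ha]; exact hab.symm
  have hb : τ b = a := by rw [← ha, hτ]
  have hba : b ≠ a := fun h => hne a (ha.trans h)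
  split_ifs with hb'
  -- The swap is trivial, and the strut closes up to a loop.
  · subst hb'
    rw [← eval_contract_of_loop h1 h2 h3]
    exact eval_pairUp_congr hℓ _ hτ (Equiv.ext fun j => by simp)
  · set τ' := Equiv.swap b a' * τ * Equiv.swap b a' with hτ'
    have hτ'' : ∀ j, τ' (τ' j) = j := swap_conj_involutive hτ b a'
    -- The new pairing joins the strut's ends `a`, `b` to `a'` and `c`. Contracting the strut
    -- therefore joins `a'` to `c`, as `τ` does, and no loop is lost.
    set c := τ a' with hc
    have hca' : c ≠ a' := hne a'
    have hcb : c ≠ b := fun h => ha' (by rw [← hτ a', ← hc, h, hb])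
    have hcc : τ c = a' := hτ a'
    have t1 : τ' a = a' := by
      simp [hτ', Equiv.swap_apply_of_ne_of_ne hba.symm ha'.symm, ha]
    have t2 : τ' b = c := by
      simp [hτ', ← hc, Equiv.swap_apply_of_ne_of_ne hcb hca']
    have t1' : τ' a' = a := by rw [← t1, hτ'']
    have t2' : τ' c = b := by rw [← t2, hτ'']
    have i1 : (pairUp E ℓ hℓ τ' hτ'').IsBiv (ℓ a) := isBiv_pairUp hℓ hτ'' (by rwa [t1])
    have i2 : (pairUp E ℓ hℓ τ' hτ'').IsBiv ((pairUp E ℓ hℓ τ' hτ'').e (ℓ a)) := by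
      rw [show (pairUp E ℓ hℓ τ' hτ'').e (ℓ a) = ℓ b from hab]
      exact isBiv_pairUp hℓ hτ'' (by rwa [t2])
    have i3 : (pairUp E ℓ hℓ τ' hτ'').σ (ℓ a) ≠ (pairUp E ℓ hℓ τ' hτ'').e (ℓ a) := by
      rw [pairUp_σ, t1, show (pairUp E ℓ hℓ τ' hτ'').e (ℓ a) = ℓ b from hab]
      exact ℓ.injective.ne hb'
    rw [one_smul, eval_contract i1 i2 i3]
    refine Iso.eval_eq ⟨Equiv.refl _, fun _ => rfl, fun h => Subtype.ext ?_, fun _ _ => rfl⟩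
    change (((pairUp E ℓ hℓ τ' hτ'').contract (ℓ a) i1 i2).σ h).1 =
      (((pairUp E ℓ hℓ τ hτ).contract (ℓ a) h1 h2).σ h).1
    rw [contract_σ_of_loop h1 h2 h3]
    by_cases e1 : h.1 = ℓ a'
    · rw [contract_σ_of_eq i1 i2 (by rw [e1, pairUp_σ, t1']), e1, pairUp_σ,
        show (pairUp E ℓ hℓ τ' hτ'').e (ℓ a) = ℓ b from hab, pairUp_σ, t2]
    · by_cases e2 : h.1 = ℓ c
      · rw [contract_σ_of_eq' i1 i2 (by rw [e2, pairUp_σ, t2']; exact hab.symm), e2, pairUp_σ,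
          pairUp_σ, t1, hcc]
      · have e3 : (pairUp E ℓ hℓ τ' hτ'').σ h.1 = (pairUp E ℓ hℓ τ hτ).σ h.1 := by
          refine pairUp_σ_congr hℓ hτ'' hτ ?_
          intro j hj
          have j1 : j ≠ b := by
            rintro rfl
            exact h.2.2 (hj.trans hab.symm)
          have j2 : j ≠ a' := by
            rintro rfl
            exact e1 hj
          have j3 : τ j ≠ b := by
            intro h4
            refine h.2.1 (hj.trans ?_)
            rw [← hτ j, h4, hb]
          have j4 : τ j ≠ a' := by
            intro h4
            refine e2 (hj.trans ?_)
            rw [← hτ j, h4]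
          simp [hτ', Equiv.swap_apply_of_ne_of_ne j1 j2, Equiv.swap_apply_of_ne_of_ne j3 j4]
        have e4 := σ_ne_of_loop h1 h3 h.2
        rw [contract_σ_of_ne i1 i2 (by rw [e3]; exact e4.1) (by rw [e3]; exact e4.2), e3]

theorem viaEmbedding_swap_conj [DecidableEq E.H] (a b : J) :
    (Equiv.swap a b * τ * Equiv.swap a b).viaEmbedding ℓ =
      Equiv.swap (ℓ a) (ℓ b) * τ.viaEmbedding ℓ * Equiv.swap (ℓ a) (ℓ b) := by
  have h1 : ∀ j, Equiv.swap (ℓ a) (ℓ b) (ℓ j) = ℓ (Equiv.swap a b j) := fun j =>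
    (ℓ.injective.swap_apply a b j)
  ext h
  by_cases hh : h ∈ Set.range ℓ
  · obtain ⟨j, rfl⟩ := hh
    simp [Equiv.Perm.viaEmbedding_apply, h1]
  · have h2 : Equiv.swap (ℓ a) (ℓ b) h = h := Equiv.swap_apply_of_ne_of_ne
      (by rintro rfl; exact hh ⟨_, rfl⟩) (by rintro rfl; exact hh ⟨_, rfl⟩)
    simp [Equiv.Perm.viaEmbedding_apply_of_notMem _ _ _ hh, h2]

/-- Exchanging two legs that are adjacent to the same trivalent vertex changes the sign. -/
theorem eval_pairUp_antisymm {a b : J} (hne : ∀ j, τ j ≠ j) (ha : E.IsTri (E.e (ℓ a)))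
    (hab : E.e (ℓ b) = E.σ (E.e (ℓ a))) :
    eval A S n t (pairUp E ℓ hℓ τ hτ) +
      eval A S n t (pairUp E ℓ hℓ (Equiv.swap a b * τ * Equiv.swap a b)
        (swap_conj_involutive hτ a b)) = 0 := by
  classical
  set D := pairUp E ℓ hℓ τ hτ with hD
  set u := ℓ a
  set w := ℓ b
  have hu : E.IsLeg u := hℓ a
  have hw : E.IsLeg w := hℓ b
  have hb : E.IsTri (E.e w) := by rwa [hab, isTri_σ_iff]
  have htri : ∀ h, E.IsTri h → h ∉ Set.range ℓ := by
    rintro _ h1 ⟨j, rfl⟩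
    exact (hℓ j).not_isTri h1
  have s1 : ∀ h, E.IsTri h → D.σ h = E.σ h := fun h hh => pairUp_σ_of_notMem _ _ (htri h hh)
  set h0 := E.σ (E.e w) with hh0
  have t0 : E.IsTri h0 := by rwa [hh0, isTri_σ_iff]
  have e1 : D.σ h0 = E.e u := by
    rw [s1 _ t0, hh0, hab]
    exact ha.σ_σ_σ
  have e2 : D.σ (E.e u) = E.e w := by rw [s1 _ ha, hab]
  have key := eval_antisymm (A := A) (S := S) (n := n) (t := t) (D := D) h0
    ((isTri_pairUp hℓ hτ h0).2 t0)
  rw [e1, e2] at key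
  refine Eq.trans (congrArg _ (Iso.eval_eq ?_).symm) key
  let s : Equiv.Perm E.H := Equiv.swap (E.e u) (E.e w)
  let T : Equiv.Perm E.H := Equiv.swap u w
  have n1 : E.e u ≠ u := E.e_ne u
  have n2 : E.e u ≠ w := fun h => hw.not_isTri (h ▸ ha)
  have n3 : E.e w ≠ u := fun h => hu.not_isTri (h ▸ hb)
  have n4 : E.e w ≠ w := E.e_ne w
  have hs : ∀ x, s (s x) = x := fun x => Equiv.swap_apply_self _ _ x
  have hT : ∀ x, T (T x) = x := fun x => Equiv.swap_apply_self _ _ x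
  have hes : ∀ x, E.e (s x) = T (E.e x) := by
    intro x
    have := (E.e.injective.swap_apply (E.e u) (E.e w) x)
    rw [E.e_e, E.e_e] at this
    exact this.symm
  have heT : ∀ x, E.e (T x) = s (E.e x) := fun x => (E.e.injective.swap_apply u w x).symm
  have hcomm : ∀ x, T (s x) = s (T x) := by
    intro x
    have h5 : Equiv.Perm.Disjoint T s := by
      intro y
      by_cases h6 : y = u
      · right; rw [h6]; exact Equiv.swap_apply_of_ne_of_ne n1.symm n3.symm
      · by_cases h7 : y = w
        · right; rw [h7]; exact Equiv.swap_apply_of_ne_of_ne n2.symm n4.symm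
        · left; exact Equiv.swap_apply_of_ne_of_ne h6 h7
    exact Equiv.congr_fun h5.commute x
  have hσT : ∀ x, E.σ (T x) = T (E.σ x) := by
    intro x
    have := (E.σ.injective.swap_apply u w x)
    rw [show E.σ u = u from hu, show E.σ w = w from hw] at this
    exact this.symm
  -- The isomorphism exchanges the two entire edges `{u, e u}` and `{w, e w}`. At the trivalent
  -- vertex it undoes the reversal of the cyclic order, and at the other ends it exchanges the two
  -- legs.
  refine ⟨T * s, ?_, ?_, ?_⟩
  · intro x
    change T (s (E.e x)) = E.e (T (s x))
    rw [heT, hes, hcomm]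
  · intro x
    change T (s (s (D.σ (s⁻¹ x)))) = E.σ ((Equiv.swap a b * τ * Equiv.swap a b).viaEmbedding ℓ
      (T (s x)))
    rw [hs, viaEmbedding_swap_conj]
    change _ = E.σ (T (τ.viaEmbedding ℓ (T (T (s x)))))
    rw [hT, hσT]
    rfl
  · intro x hx
    have hx' : D.IsLeg x := by
      refine (isLeg_conjugate (D := D) (fun g hg => ?_) x).1 hx
      rw [isTri_pairUp hℓ hτ] at hg
      exact Equiv.swap_apply_of_ne_of_ne (by rintro rfl; exact hg ha) (by rintro rfl; exact hg hb)
    obtain ⟨h5, h6⟩ := (isLeg_pairUp hℓ hτ hne x).1 hx'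
    have h7 : s x = x := Equiv.swap_apply_of_ne_of_ne
      (by rintro rfl; exact h5.not_isTri ha) (by rintro rfl; exact h5.not_isTri hb)
    have h8 : T x = x := Equiv.swap_apply_of_ne_of_ne
      (by rintro rfl; exact h6 ⟨_, rfl⟩) (by rintro rfl; exact h6 ⟨_, rfl⟩)
    change E.label (T (s x)) = _
    rw [h7, h8]

end Pairing

/-! ### Vanishing of the sum over all pairings of 2n + 2 legs -/

section PairingSum

variable {L : Type} {A S : Set L} {n : ℕ} {J : Type}

theorem conj_involutive {τ : Equiv.Perm J} (hτ : ∀ j, τ (τ j) = j) (π : Equiv.Perm J) :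
    ∀ j, (π * τ * π⁻¹) ((π * τ * π⁻¹) j) = j := by
  intro j
  simp [hτ]

theorem conj_ne {τ : Equiv.Perm J} (hτ : ∀ j, τ j ≠ j) (π : Equiv.Perm J) :
    ∀ j, (π * τ * π⁻¹) j ≠ j := by
  intro j h
  refine hτ (π⁻¹ j) ?_
  have h1 := congrArg (π⁻¹ : Equiv.Perm J) h
  simpa using h1

/-- The joined legs become subdivision points, so the degree does not depend on the pairing. -/
theorem degree_pairUp {E : Diagram L} {ℓ : J ↪ E.H} (hℓ : ∀ j, E.IsLeg (ℓ j))
    {τ : Equiv.Perm J} (hτ : ∀ j, τ (τ j) = j) (hne : ∀ j, τ j ≠ j) :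
    (pairUp E ℓ hℓ τ hτ).degree =
      (Nat.card {h : E.H // E.IsLeg h ∧ h ∉ Set.range ℓ} + Nat.card {h : E.H // E.IsTri h} / 3) / 2 := by
  unfold degree
  rw [Nat.card_congr (Equiv.subtypeEquivRight (isLeg_pairUp hℓ hτ hne)),
    Nat.card_congr (Equiv.subtypeEquivRight (isTri_pairUp hℓ hτ))]

/-- If more legs are attached than there are vertices to attach them to, then two of them are
attached to the same trivalent vertex. -/
theorem exists_adjacent {E : Diagram L} {ℓ : J ↪ E.H} [Finite J] (hbiv : ∀ h, ¬ E.IsBiv h)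
    (hℓ : ∀ j, E.e (ℓ j) ∉ Set.range ℓ)
    (hJ : Nat.card {h : E.H // E.IsLeg h ∧ h ∉ Set.range ℓ} + Nat.card {h : E.H // E.IsTri h} / 3 <
      Nat.card J) :
    ∃ a b, E.IsTri (E.e (ℓ a)) ∧ E.e (ℓ b) = E.σ (E.e (ℓ a)) ∧ a ≠ b := by
  classical
  by_contra hcon
  push Not at hcon
  have := E.finite
  have h1 : Nat.card {j : J // E.IsLeg (E.e (ℓ j))} ≤
      Nat.card {h : E.H // E.IsLeg h ∧ h ∉ Set.range ℓ} :=
    Nat.card_le_card_of_injective (fun j => ⟨E.e (ℓ j.1), j.2, hℓ _⟩) (fun a b hab =>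
      Subtype.ext (ℓ.injective (E.e.injective (congrArg Subtype.val hab))))
  -- If no two of the legs share a trivalent vertex, each leg hanging on one accounts for three
  -- half-edges of its own. Counting them, together with the legs that hang on free legs,
  -- contradicts the bound on `Nat.card J`.
  have hinj : ∀ a b, E.IsTri (E.e (ℓ a)) → E.IsTri (E.e (ℓ b)) →
      E.e (ℓ b) = E.σ (E.e (ℓ a)) → False := by
    intro a b ha hb hab
    have := hcon a b ha hab
    subst this
    exact ha.1 hab.symm
  have hinj' : ∀ a b, E.IsTri (E.e (ℓ a)) → E.IsTri (E.e (ℓ b)) →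
      E.e (ℓ b) = E.σ (E.σ (E.e (ℓ a))) → False := by
    intro a b ha hb hab
    exact hinj b a hb ha (by rw [hab, ha.σ_σ_σ])
  have h2 : Nat.card ({j : J // E.IsTri (E.e (ℓ j))} × Fin 3) ≤
      Nat.card {h : E.H // E.IsTri h} := by
    let φ : {j : J // E.IsTri (E.e (ℓ j))} × Fin 3 → {h : E.H // E.IsTri h} := fun x =>
      match x with
      | (j, 0) => ⟨E.e (ℓ j.1), j.2⟩
      | (j, 1) => ⟨E.σ (E.e (ℓ j.1)), by rw [isTri_σ_iff]; exact j.2⟩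
      | (j, 2) => ⟨E.σ (E.σ (E.e (ℓ j.1))), by rw [isTri_σ_iff, isTri_σ_iff]; exact j.2⟩
    refine Nat.card_le_card_of_injective φ ?_
    have inj0 : ∀ a b : {j : J // E.IsTri (E.e (ℓ j))}, E.e (ℓ a.1) = E.e (ℓ b.1) → a = b :=
      fun a b h => Subtype.ext (ℓ.injective (E.e.injective h))
    rintro ⟨a, i⟩ ⟨b, j⟩ hab
    have hab := congrArg Subtype.val hab
    fin_cases i <;> fin_cases j
    · exact Prod.ext (inj0 a b hab) rfl
    · exact (hinj b a b.2 a.2 hab).elim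
    · exact (hinj' b a b.2 a.2 hab).elim
    · exact (hinj a b a.2 b.2 hab.symm).elim
    · exact Prod.ext (inj0 a b (E.σ.injective hab)) rfl
    · exact (hinj b a b.2 a.2 (E.σ.injective hab)).elim
    · exact (hinj' a b a.2 b.2 hab.symm).elim
    · exact (hinj a b a.2 b.2 (E.σ.injective hab).symm).elim
    · exact Prod.ext (inj0 a b (E.σ.injective (E.σ.injective hab))) rfl
  have h3 : Nat.card J = Nat.card {j : J // E.IsLeg (E.e (ℓ j))} +
      Nat.card {j : J // E.IsTri (E.e (ℓ j))} := by
    rw [← Nat.card_sum]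
    have e1 : ∀ j, E.IsTri (E.e (ℓ j)) ↔ ¬ E.IsLeg (E.e (ℓ j)) := fun j => by
      have h4 := E.isLeg_or_isBiv_or_isTri (E.e (ℓ j))
      have h5 := hbiv (E.e (ℓ j))
      exact ⟨fun h6 h7 => h7.not_isTri h6, by tauto⟩
    rw [Nat.card_congr (Equiv.sumCongr (Equiv.refl _) (Equiv.subtypeEquivRight e1))]
    exact (Nat.card_congr (Equiv.sumCompl _)).symm
  rw [Nat.card_prod, Nat.card_eq_fintype_card (α := Fin 3), Fintype.card_fin] at h2
  omega

variable [Fintype J] [DecidableEq J]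

/-- The sum of all ways of joining `2n + 2` given legs in pairs vanishes in `B_{≤ n}`. -/
theorem sum_pairUp_eq_zero (hJ : Fintype.card J = 2 * n + 2) {τ : Equiv.Perm J}
    (hτ : ∀ j, τ (τ j) = j) (hne : ∀ j, τ j ≠ j) (N : ℕ) :
    ∀ (E : Diagram L) (ℓ : J ↪ E.H) (hℓ : ∀ j, E.IsLeg (ℓ j)), Nat.card E.H = N →
      ∑ π : Equiv.Perm J,
        eval A S n (-2 * n) (pairUp E ℓ hℓ (π * τ * π⁻¹) (conj_involutive hτ π)) = 0 := by
  induction N using Nat.strong_induction_on with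
  | h N IH =>
    intro E ℓ hℓ hN
    have hfin := E.finite
    -- Subdivision points present from the start are removed by induction on the number of
    -- half-edges: a loop with one point splits off as a factor common to all pairings, and any
    -- other point is erased.
    by_cases hbiv : ∃ p, E.IsBiv p
    · obtain ⟨p, hp⟩ := hbiv
      have hpl : ∀ j, ℓ j ≠ p := by
        rintro j rfl
        exact (hℓ j).not_isBiv hp
      have hpl' : ∀ j, ℓ j ≠ E.σ p := by
        intro j hj
        exact (hℓ j).not_isBiv (by rw [hj, isBiv_σ_iff]; exact hp)
      by_cases h2 : E.e p = E.σ p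
      · have hp' : E.IsBiv (E.e p) := by rw [h2, isBiv_σ_iff]; exact hp
        let ℓ' : J ↪ (E.contract p hp hp').H :=
          ⟨fun j => ⟨ℓ j, hpl j, by rw [h2]; exact hpl' j⟩,
            fun a b h => ℓ.injective (congrArg Subtype.val h)⟩
        have hℓ' : ∀ j, (E.contract p hp hp').IsLeg (ℓ' j) := fun j =>
          Subtype.ext ((contract_σ_of_loop hp hp' h2.symm (ℓ' j)).trans (hℓ j))
        have := IH _ (by rw [← hN]; exact Finite.card_subtype_lt (x := p) (by simp)) _ ℓ' hℓ' rfl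
        simp_rw [eval_pairUp_contract hℓ (conj_involutive hτ _) hp hp' h2.symm ℓ' (fun _ => rfl) hℓ']
        rw [← Finset.smul_sum, this, smul_zero]
      · let ℓ' : J ↪ (E.smooth p hp h2).H :=
          ⟨fun j => ⟨ℓ j, hpl j, hpl' j⟩, fun a b h => ℓ.injective (congrArg Subtype.val h)⟩
        have hℓ' : ∀ j, (E.smooth p hp h2).IsLeg (ℓ' j) := fun j => Subtype.ext (hℓ j)
        have := IH _ (by rw [← hN]; exact Finite.card_subtype_lt (x := p) (by simp)) _ ℓ' hℓ' rfl
        simp_rw [eval_pairUp_smooth hℓ (conj_involutive hτ _) hp h2 ℓ' (fun _ => rfl) hℓ']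
        exact this
    push Not at hbiv
    by_cases hstrut : ∃ a b, E.e (ℓ a) = ℓ b
    · obtain ⟨a, b, hab⟩ := hstrut
      have hba : b ≠ a := by
        rintro rfl
        exact E.e_ne _ hab
      set F : Equiv.Perm J → BLe A S n := fun π =>
        eval A S n (-2 * n) (pairUp E ℓ hℓ (π * τ * π⁻¹) (conj_involutive hτ π)) with hF
      have hFs : ∀ π a', F (Equiv.swap b a' * π) = eval A S n (-2 * n)
          (pairUp E ℓ hℓ (Equiv.swap b a' * (π * τ * π⁻¹) * Equiv.swap b a')
            (swap_conj_involutive (conj_involutive hτ π) b a')) := by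
        intro π a'
        refine eval_pairUp_congr hℓ _ _ ?_
        rw [mul_inv_rev, Equiv.swap_inv]
        simp only [mul_assoc]
      -- The terms are sorted by the partner `a'` of the strut end `a`. Multiplication by `swap b
      -- a'` compares the partner `a'` with the partner `b`, for which the strut becomes a loop.
      have h1 : ∑ π, F π = ∑ a' : J, ∑ π with (π * τ * π⁻¹) a = a', F π :=
        (Finset.sum_fiberwise _ _ _).symm
      have h2 : ∀ a' ∈ (Finset.univ : Finset J).erase a,
          ∑ π with (π * τ * π⁻¹) a = a', F π =
            ∑ π with (π * τ * π⁻¹) a = b, F (Equiv.swap b a' * π) := by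
        intro a' ha'
        have ha' := Finset.ne_of_mem_erase ha'
        have hs : Equiv.swap b a' a = a := Equiv.swap_apply_of_ne_of_ne hba.symm ha'.symm
        have key : ∀ π : Equiv.Perm J, (Equiv.swap b a' * π * τ * (Equiv.swap b a' * π)⁻¹) a =
            Equiv.swap b a' ((π * τ * π⁻¹) a) := by
          intro π
          rw [mul_inv_rev, Equiv.swap_inv]
          simp only [Equiv.Perm.mul_apply, hs]
        refine Finset.sum_nbij' (fun π => Equiv.swap b a' * π) (fun π => Equiv.swap b a' * π)
          ?_ ?_ ?_ ?_ ?_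
        · intro π hπ
          rw [Finset.mem_filter] at hπ ⊢
          rw [key, hπ.2, Equiv.swap_apply_right]
          exact ⟨Finset.mem_univ _, rfl⟩
        · intro π hπ
          rw [Finset.mem_filter] at hπ ⊢
          rw [key, hπ.2, Equiv.swap_apply_left]
          exact ⟨Finset.mem_univ _, rfl⟩
        · intro π _
          rw [← mul_assoc, Equiv.swap_mul_self, one_mul]
        · intro π _
          rw [← mul_assoc, Equiv.swap_mul_self, one_mul]
        · intro π _
          rw [← mul_assoc, Equiv.swap_mul_self, one_mul]
      have h3 : ∑ π with (π * τ * π⁻¹) a = a, F π = 0 := by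
        rw [Finset.filter_false_of_mem (fun π _ => conj_ne hne π a), Finset.sum_empty]
      change ∑ π, F π = 0
      rw [h1, ← Finset.add_sum_erase _ _ (Finset.mem_univ a), h3, zero_add, Finset.sum_congr rfl h2,
        Finset.sum_comm]
      refine Finset.sum_eq_zero fun π hπ => ?_
      rw [Finset.mem_filter] at hπ
      -- `G` is the diagram with the strut removed; it does not depend on `a'`.
      obtain ⟨G, hG⟩ : ∃ G, ∀ a' ∈ (Finset.univ : Finset J).erase a,
          F (Equiv.swap b a' * π) = (if a' = b then (-2 * n : ℚ) else 1) • G :=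
        ⟨_, fun a' ha' => (hFs π a').trans (eval_pairUp_strut hℓ (conj_involutive hτ π) hab hπ.2
          (conj_ne hne π) (Finset.ne_of_mem_erase ha'))⟩
      rw [Finset.sum_congr rfl hG, ← Finset.sum_smul]
      -- Besides `a` and `b` there are `2n` partners, each with factor 1; this is the reason for the
      -- value `-2n` of a loop.
      have h4 : ∑ a' ∈ (Finset.univ : Finset J).erase a, (if a' = b then (-2 * n : ℚ) else 1) = 0 := by
        rw [← Finset.add_sum_erase _ _ (Finset.mem_erase.2 ⟨hba, Finset.mem_univ b⟩), if_pos rfl,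
          Finset.sum_congr rfl (fun a' ha' => if_neg (Finset.ne_of_mem_erase ha')),
          Finset.sum_const, Finset.card_erase_of_mem (Finset.mem_erase.2 ⟨hba, Finset.mem_univ b⟩),
          Finset.card_erase_of_mem (Finset.mem_univ a), Finset.card_univ, hJ]
        simp
      rw [h4, zero_smul]
    · push Not at hstrut
      -- This is the degree of every joined diagram. If it is at most `n`, then there are at most
      -- `2n + 1` remaining vertices even after rounding, fewer than the `2n + 2` legs.
      by_cases hdeg : (Nat.card {h : E.H // E.IsLeg h ∧ h ∉ Set.range ℓ} +
          Nat.card {h : E.H // E.IsTri h} / 3) / 2 ≤ n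
      · obtain ⟨a, b, ha, hab, hne'⟩ := exists_adjacent (ℓ := ℓ) hbiv
          (fun j ⟨i, hi⟩ => hstrut j i hi.symm)
          (by rw [Nat.card_eq_fintype_card (α := J), hJ]; omega)
        set F : Equiv.Perm J → BLe A S n := fun π =>
          eval A S n (-2 * n) (pairUp E ℓ hℓ (π * τ * π⁻¹) (conj_involutive hτ π)) with hF
        have h1 : ∑ π, F π = ∑ π, F (Equiv.swap a b * π) :=
          (Equiv.sum_comp (Equiv.mulLeft (Equiv.swap a b)) F).symm
        -- Exchanging `a` and `b` is a bijection of the index set by `h1` and a change of sign by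
        -- AS, so the sum equals its negative.
        have h2 : ∑ π, F π + ∑ π, F (Equiv.swap a b * π) = 0 := by
          rw [← Finset.sum_add_distrib]
          refine Finset.sum_eq_zero fun π _ => ?_
          rw [← eval_pairUp_antisymm (A := A) (S := S) (n := n) (t := -2 * n) hℓ
            (conj_involutive hτ π) (conj_ne hne π) ha hab]
          refine congrArg _ (eval_pairUp_congr hℓ _ _ ?_)
          rw [mul_inv_rev, Equiv.swap_inv]
          simp only [mul_assoc]
        rw [← h1, ← two_smul ℚ] at h2
        exact (smul_eq_zero.1 h2).resolve_left two_ne_zero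
      · refine Finset.sum_eq_zero fun π _ => ?_
        unfold eval
        rw [cls_of_notMem, smul_zero]
        intro h
        refine hdeg ?_
        rw [← degree_pairUp hℓ (conj_involutive hτ π) (conj_ne hne π), ← degree_withoutLoops]
        exact h.2

/-- The sum over all ways of joining `2n + 2` given legs in pairs, with one fixed leg. -/
theorem sum_pairUp_stabilizer_eq_zero (hJ : Fintype.card J = 2 * n + 2) {τ : Equiv.Perm J}
    (hτ : ∀ j, τ (τ j) = j) (hne : ∀ j, τ j ≠ j) (q : J)
    (E : Diagram L) (ℓ : J ↪ E.H) (hℓ : ∀ j, E.IsLeg (ℓ j)) :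
      ∑ π : Equiv.Perm J with π q = q,
        eval A S n (-2 * n) (pairUp E ℓ hℓ (π * τ * π⁻¹) (conj_involutive hτ π)) = 0 := by
  have h0 := sum_pairUp_eq_zero (A := A) (S := S) hJ hτ hne _ E ℓ hℓ rfl
  set F : Equiv.Perm J → BLe A S n := fun π =>
    eval A S n (-2 * n) (pairUp E ℓ hℓ (π * τ * π⁻¹) (conj_involutive hτ π)) with hF
  -- The centralizer of a fixed-point-free involution is transitive: exchange `q` with `r` and,
  -- unless they are partners, also the partner of `q` with the partner of `r`.
  have hcent : ∀ r : J, ∃ ζ : Equiv.Perm J, ζ * τ = τ * ζ ∧ ζ r = q := by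
    intro r
    have hsw : ∀ x y : J, Equiv.swap (τ x) (τ y) * τ = τ * Equiv.swap x y := by
      intro x y
      ext j
      exact τ.injective.swap_apply x y j
    by_cases h1 : r = τ q
    · refine ⟨Equiv.swap q r, ?_, Equiv.swap_apply_right _ _⟩
      have := hsw q r
      rwa [h1, hτ, Equiv.swap_comm, ← h1] at this
    · by_cases h2 : r = q
      · exact ⟨1, by simp, by simp [h2]⟩
      · refine ⟨Equiv.swap q r * Equiv.swap (τ q) (τ r), ?_, ?_⟩
        · have e1 := hsw q r
          have e2 := hsw (τ q) (τ r)
          rw [hτ, hτ] at e2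
          rw [mul_assoc, e1, ← mul_assoc, e2, mul_assoc]
          congr 1
          refine Equiv.Perm.Disjoint.commute ?_
          intro y
          have d1 : q ≠ τ q := (hne q).symm
          have d2 : q ≠ τ r := fun h => h1 (by rw [h, hτ])
          have d3 : r ≠ τ r := (hne r).symm
          by_cases y1 : y = q
          · left; rw [y1]; exact Equiv.swap_apply_of_ne_of_ne d1 d2
          · by_cases y2 : y = r
            · left; rw [y2]; exact Equiv.swap_apply_of_ne_of_ne h1 d3
            · right; exact Equiv.swap_apply_of_ne_of_ne y1 y2
        · rw [Equiv.Perm.mul_apply, Equiv.swap_apply_of_ne_of_ne h1 (hne r).symm,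
            Equiv.swap_apply_right]
  -- `F π` depends only on the pairing, which does not change when `π` is multiplied on the right by
  -- an element of the centralizer. So the full sum is `2n + 2` times the sum over the stabilizer.
  have h1 : ∀ r : J, ∑ π : Equiv.Perm J with π r = q, F π = ∑ π with π q = q, F π := by
    intro r
    obtain ⟨ζ, h2, h3⟩ := hcent r
    have hζ : ζ⁻¹ q = r := by rw [Equiv.Perm.inv_eq_iff_eq, h3]
    refine Finset.sum_nbij' (fun π => π * ζ⁻¹) (fun π => π * ζ) ?_ ?_ ?_ ?_ ?_
    · intro π hπ
      rw [Finset.mem_filter] at hπ ⊢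
      exact ⟨Finset.mem_univ _, by rw [Equiv.Perm.mul_apply, hζ, hπ.2]⟩
    · intro π hπ
      rw [Finset.mem_filter] at hπ ⊢
      exact ⟨Finset.mem_univ _, by rw [Equiv.Perm.mul_apply, h3, hπ.2]⟩
    · intro π _
      simp
    · intro π _
      simp
    · intro π _
      refine eval_pairUp_congr hℓ _ _ ?_
      rw [mul_inv_rev, inv_inv]
      have h4 : ζ⁻¹ * τ * ζ = τ := by rw [mul_assoc, ← h2, inv_mul_cancel_left]
      calc π * τ * π⁻¹ = π * (ζ⁻¹ * τ * ζ) * π⁻¹ := by rw [h4]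
        _ = _ := by simp only [mul_assoc]
  have h2 : ∑ π, F π = ∑ r : J, ∑ π : Equiv.Perm J with π⁻¹ q = r, F π :=
    (Finset.sum_fiberwise _ _ _).symm
  have h3 : ∀ r : J, ∑ π : Equiv.Perm J with π⁻¹ q = r, F π = ∑ π with π q = q, F π := by
    intro r
    rw [← h1 r]
    refine Finset.sum_congr (Finset.filter_congr fun π _ => ?_) fun _ _ => rfl
    rw [Equiv.Perm.inv_eq_iff_eq]
    exact eq_comm
  rw [Finset.sum_congr rfl (fun r _ => h3 r), Finset.sum_const, Finset.card_univ, hJ] at h2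
  rw [h2, ← Nat.cast_smul_eq_nsmul ℚ] at h0
  exact (smul_eq_zero.1 h0).resolve_left (by positivity)

end PairingSum

/-! ### Formal integration as a sum over placements of chords -/

section Chording

variable {μ : ℕ}

/-- The ends of `n` chords for every `i`. -/
abbrev ChordEnd (μ n : ℕ) : Type := (Fin μ × Fin n) × Bool

/-- The other end of a chord. -/
def flip (μ n : ℕ) : Equiv.Perm (ChordEnd μ n) := (chords μ n).e

theorem flip_flip {μ n : ℕ} (c : ChordEnd μ n) : flip μ n (flip μ n c) = c := (chords μ n).e_e c

theorem flip_ne {μ n : ℕ} (c : ChordEnd μ n) : flip μ n c ≠ c := (chords μ n).e_ne c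

/-- The ways of placing the ends of `n` chords for every `i` on the half-edges that are labelled
`x_i` according to `X`. -/
def Chording {μ : ℕ} (n : ℕ) {H : Type} (X : Fin μ → H → Prop) : Type :=
  {γ : ChordEnd μ n ↪ H // (∀ c, X c.1.1 (γ c)) ∧ ∀ i h, X i h → h ∈ Set.range γ}

/-- The leg `h` is labelled `x_i`. -/
def IsX (D : Diagram (Lab μ)) (i : Fin μ) (h : D.H) : Prop := D.IsLeg h ∧ D.label h = Lab.x i

/-- The coefficient in the definition of formal integration. -/
noncomputable def chordCoeff (μ n : ℕ) : ℚ :=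
  ∏ _i : Fin μ, (1 / (n.factorial : ℚ)) * (1 / 2 : ℚ) ^ n

/-- The value of a diagram in `B_{≤ n}(X')`, every closed dashed loop being replaced by `-2n`. -/
noncomputable abbrev evalInt (n : ℕ) (D : Diagram (Lab μ)) :
    BLe (Lab.X' μ ∪ Lab.K μ) (Lab.K μ) n :=
  eval (Lab.X' μ ∪ Lab.K μ) (Lab.K μ) n (-2 * n) D

theorem chords_mem (n : ℕ) (c : ChordEnd μ n) :
    (chords μ n).IsLeg c ∧ (chords μ n).label c ∈ Lab.X μ := ⟨rfl, ⟨_, rfl⟩⟩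

variable {n : ℕ} {H : Type} {X : Fin μ → H → Prop} {D : Diagram (Lab μ)} {ι : H ↪ D.H}

theorem Chording.isLeg (hX : ∀ i h, D.IsX i h ↔ ∃ g, ι g = h ∧ X i g) (γ : Chording n X)
    (c : ChordEnd μ n) : D.IsLeg (γ.1.trans ι c) :=
  ((hX c.1.1 _).2 ⟨γ.1 c, rfl, γ.2.1 c⟩).1

/-- The gluing determined by a placement of the ends of chords. -/
noncomputable def Chording.toGluing (hX : ∀ i h, D.IsX i h ↔ ∃ g, ι g = h ∧ X i g)
    (γ : Chording n X) : Gluing (Lab.X μ) (chords μ n) D := by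
  have h1 : ∀ c, D.IsX c.1.1 (ι (γ.1 c)) := fun c => (hX c.1.1 _).2 ⟨γ.1 c, rfl, γ.2.1 c⟩
  refine ⟨Equiv.ofBijective (fun c => ⟨ι (γ.1 c.1), (h1 c.1).1, ⟨c.1.1.1, (h1 c.1).2.symm⟩⟩)
    ⟨?_, ?_⟩, fun c => (h1 c.1).2⟩
  · intro a b hab
    exact Subtype.ext (γ.1.injective (ι.injective (congrArg Subtype.val hab)))
  · rintro ⟨d, hd, i, hi⟩
    obtain ⟨g, rfl, hg⟩ := (hX i d).1 ⟨hd, hi.symm⟩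
    obtain ⟨c, rfl⟩ := γ.2.2 i g hg
    exact ⟨⟨c, chords_mem n c⟩, rfl⟩

theorem Chording.toGluing_apply (hX : ∀ i h, D.IsX i h ↔ ∃ g, ι g = h ∧ X i g)
    (γ : Chording n X) (c : (chords μ n).LegIn (Lab.X μ)) :
    ((γ.toGluing hX).1 c).1 = ι (γ.1 c.1) := rfl

/-- In terms of placements, the index set of the integral depends only on the set of `X`-legs, given
through `ι`. Integrals of different diagrams with the same `X`-legs can then be compared term by
term. -/
theorem Chording.toGluing_bijective (hX : ∀ i h, D.IsX i h ↔ ∃ g, ι g = h ∧ X i g) :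
    Function.Bijective (Chording.toGluing (n := n) hX) := by
  constructor
  · intro γ γ' h
    refine Subtype.ext (DFunLike.ext _ _ fun c => ι.injective ?_)
    have h1 := toGluing_apply hX γ ⟨c, chords_mem n c⟩
    rw [h] at h1
    exact h1.symm
  · intro g
    have h1 : ∀ c : ChordEnd μ n, ∃ h : H, ι h = (g.1 ⟨c, chords_mem n c⟩).1 ∧ X c.1.1 h :=
      fun c => (hX _ _).1 ⟨(g.1 ⟨c, chords_mem n c⟩).2.1, g.2 _⟩
    choose φ hφ hφX using h1
    refine ⟨⟨⟨φ, fun a b hab => ?_⟩, hφX, ?_⟩, ?_⟩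
    · have h2 : g.1 ⟨a, chords_mem n a⟩ = g.1 ⟨b, chords_mem n b⟩ :=
        Subtype.ext (by rw [← hφ, ← hφ, hab])
      exact congrArg Subtype.val (g.1.injective h2)
    · intro i h hh
      have h2 := (hX i (ι h)).2 ⟨h, rfl, hh⟩
      obtain ⟨c, hc⟩ := g.1.surjective ⟨ι h, h2.1, ⟨i, h2.2.symm⟩⟩
      refine ⟨c.1, ι.injective ((hφ c.1).trans ?_)⟩
      exact congrArg Subtype.val hc
    · refine Subtype.ext (Equiv.ext fun c => Subtype.ext ?_)
      exact hφ c.1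

theorem eval_pairUp_congr_right {L J : Type} {A S : Set L} {t : ℚ} {E : Diagram L} {ℓ ℓ' : J ↪ E.H}
    (hℓ : ∀ j, E.IsLeg (ℓ j)) (hℓ' : ∀ j, E.IsLeg (ℓ' j)) (τ : Equiv.Perm J)
    (hτ : ∀ j, τ (τ j) = j) (h : ℓ = ℓ') :
    eval A S n t (pairUp E ℓ hℓ τ hτ) = eval A S n t (pairUp E ℓ' hℓ' τ hτ) := by
  subst h
  rfl

/-- Formal integration as a sum over placements of the ends of chords. -/
theorem intDiagram_eq (hX : ∀ i h, D.IsX i h ↔ ∃ g, ι g = h ∧ X i g) :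
    intDiagram n D = chordCoeff μ n • ∑ᶠ γ : Chording n X,
      evalInt n (pairUp D (γ.1.trans ι) (γ.isLeg hX) (flip μ n) flip_flip) := by
  unfold intDiagram chordCoeff
  rw [← finsum_comp_equiv (Equiv.ofBijective _ (Chording.toGluing_bijective (n := n) hX))]
  refine congrArg (chordCoeff μ n • ·) (finsum_congr fun γ => ?_)
  refine (congrArg _ (mk_eq_cls _ _ n _ _)).trans ?_
  refine (eval_glue (A := Lab.X' μ ∪ Lab.K μ) (S := Lab.K μ) (n := n) (t := -2 * n)
    (γ.toGluing hX) (chords_mem n)).trans ?_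
  exact eval_pairUp_congr_right (ℓ := (γ.toGluing hX).toEmbedding (chords_mem n))
    (fun c => (γ.toGluing hX).isLeg (chords_mem n) c) _ (flip μ n) flip_flip
    (DFunLike.ext _ _ fun c => rfl)

theorem intDiagram_eq_self : intDiagram n D = chordCoeff μ n • ∑ᶠ γ : Chording n D.IsX,
      evalInt n (pairUp D γ.1 (fun c => (γ.2.1 c).1) (flip μ n) flip_flip) :=
  intDiagram_eq (ι := Function.Embedding.refl _) fun i h => by simp

end Chording

/-! ### Formal integration respects the defining relations -/

section Relations

variable {μ n : ℕ} {D D' : Diagram (Lab μ)}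

theorem Iso.isX (f : Iso D D') (i : Fin μ) (h : D.H) : D'.IsX i (f.f h) ↔ D.IsX i h := by
  unfold IsX
  rw [f.isLeg]
  exact and_congr_right fun hh => by rw [f.map_label h hh]

/-- Joining legs commutes with isomorphisms. -/
def Iso.pairUp {L J : Type} {D D' : Diagram L} (f : Iso D D') (ℓ : J ↪ D.H) (ℓ' : J ↪ D'.H)
    (hℓ : ∀ j, D.IsLeg (ℓ j)) (hℓ' : ∀ j, D'.IsLeg (ℓ' j)) (τ : Equiv.Perm J)
    (hτ : ∀ j, τ (τ j) = j) (hne : ∀ j, τ j ≠ j) (hl : ∀ j, ℓ' j = f.f (ℓ j)) :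
    Iso (D.pairUp ℓ hℓ τ hτ) (D'.pairUp ℓ' hℓ' τ hτ) where
  f := f.f
  map_e := f.map_e
  map_σ h := by
    by_cases hh : h ∈ Set.range ℓ
    · obtain ⟨j, rfl⟩ := hh
      rw [pairUp_σ, ← hl, ← hl, pairUp_σ]
    · rw [pairUp_σ_of_notMem _ _ hh, pairUp_σ_of_notMem, f.map_σ]
      rintro ⟨j, hj⟩
      exact hh ⟨j, f.f.injective (by rw [← hl, hj])⟩
  map_label h hh := f.map_label h ((isLeg_pairUp hℓ hτ hne h).1 hh).1

theorem Iso.intDiagram_eq (f : Iso D D') : intDiagram n D = intDiagram n D' := by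
  refine intDiagram_eq_self.trans
    (Eq.trans ?_ (Diagram.intDiagram_eq (X := D.IsX) (ι := f.f.toEmbedding) ?_).symm)
  · refine congrArg (chordCoeff μ n • ·) (finsum_congr fun γ => ?_)
    exact (f.pairUp γ.1 (γ.1.trans f.f.toEmbedding) _ _ (flip μ n) flip_flip flip_ne
      (fun _ => rfl)).eval_eq
  · intro i h
    constructor
    · intro hh
      refine ⟨f.f.symm h, f.f.apply_symm_apply h, ?_⟩
      rwa [← f.isX, Equiv.apply_symm_apply]
    · rintro ⟨g, rfl, hg⟩
      exact (f.isX i g).2 hg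

/-- The new point contributes no legs, and joining legs commutes with subdividing an edge. -/
theorem intDiagram_subdiv (a : D.H) : intDiagram n (D.subdiv a) = intDiagram n D := by
  refine (intDiagram_eq (X := D.IsX) (ι := Function.Embedding.inl) ?_).trans
    (Eq.trans ?_ intDiagram_eq_self.symm)
  rotate_left
  · refine congrArg (chordCoeff μ n • ·) (finsum_congr fun γ => ?_)
    have hγ := fun c => (γ.2.1 c).1
    have hγ' : ∀ c, (D.subdiv a).IsLeg ((γ.1.trans Function.Embedding.inl) c) := fun c =>
      (isLeg_subdiv_inl a _).2 (hγ c)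
    refine Eq.trans (Iso.eval_eq ?_) (eval_subdiv (D := pairUp D γ.1 hγ _ flip_flip) a)
    refine ⟨Equiv.refl _, by rintro (h | _ | _) <;> rfl, ?_, fun _ _ => rfl⟩
    rintro (h | b)
    · by_cases hh : h ∈ Set.range γ.1
      · obtain ⟨c, rfl⟩ := hh
        change (pairUp (D.subdiv a) (γ.1.trans Function.Embedding.inl) hγ' _ flip_flip).σ
          ((γ.1.trans Function.Embedding.inl) c) = Sum.inl ((pairUp D γ.1 hγ _ flip_flip).σ _)
        rw [pairUp_σ, pairUp_σ]
        rfl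
      · change (pairUp (D.subdiv a) (γ.1.trans Function.Embedding.inl) hγ' _ flip_flip).σ
          (.inl h) = Sum.inl ((pairUp D γ.1 hγ _ flip_flip).σ _)
        rw [pairUp_σ_of_notMem _ _ hh, pairUp_σ_of_notMem]
        · rfl
        · rintro ⟨c, hc⟩
          exact hh ⟨c, Sum.inl_injective hc⟩
    · change (pairUp (D.subdiv a) (γ.1.trans Function.Embedding.inl) hγ' _ flip_flip).σ
          (.inr b) = _
      rw [pairUp_σ_of_notMem]
      · rfl
      · rintro ⟨c, hc⟩
        exact Sum.inl_ne_inr hc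
  · rintro i (h | b)
    · constructor
      · exact fun hh => ⟨h, rfl, (isLeg_subdiv_inl a h).1 hh.1, hh.2⟩
      · rintro ⟨g, hg, hh⟩
        obtain rfl := Sum.inl_injective hg
        exact ⟨(isLeg_subdiv_inl a g).2 hh.1, hh.2⟩
    · constructor
      · exact fun hh => (hh.1.not_isBiv (isBiv_subdiv_inr a b)).elim
      · rintro ⟨g, hg, hh⟩
        exact (Sum.inl_ne_inr hg).elim

/-- Joining moves legs only, `ρ` moves half-edges at trivalent vertices only; so the two operations
commute. -/
theorem intDiagram_conjugate {ρ : Equiv.Perm D.H} (hρ : ∀ h, ¬ D.IsTri h → ρ h = h) :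
    intDiagram n (D.conjugate ρ) = chordCoeff μ n • ∑ᶠ γ : Chording n D.IsX,
      evalInt n ((pairUp D γ.1 (fun c => (γ.2.1 c).1) (flip μ n) flip_flip).conjugate ρ) := by
  rw [intDiagram_eq (D := D.conjugate ρ) (X := D.IsX) (ι := Function.Embedding.refl _)]
  · refine congrArg (chordCoeff μ n • ·) (finsum_congr fun γ => ?_)
    have hγ := fun c => (γ.2.1 c).1
    refine Iso.eval_eq ⟨Equiv.refl _, fun _ => rfl, fun h => ?_, fun _ _ => rfl⟩
    have hcomm : ∀ h, (flip μ n).viaEmbedding γ.1 (ρ h) =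
        ρ ((flip μ n).viaEmbedding γ.1 h) := by
      intro h
      by_cases hh : h ∈ Set.range γ.1
      · obtain ⟨c, rfl⟩ := hh
        rw [hρ _ (hγ c).not_isTri, Equiv.Perm.viaEmbedding_apply, hρ _ (hγ _).not_isTri]
      · rw [Equiv.Perm.viaEmbedding_apply_of_notMem _ _ _ hh,
          Equiv.Perm.viaEmbedding_apply_of_notMem]
        rintro ⟨c, hc⟩
        refine hh ⟨c, ?_⟩
        rw [← hρ _ (hγ c).not_isTri] at hc
        exact ρ.injective hc
    change ρ (D.σ (ρ⁻¹ ((flip μ n).viaEmbedding γ.1 h))) =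
      ρ (D.σ ((flip μ n).viaEmbedding γ.1 (ρ⁻¹ h)))
    congr 2
    rw [Equiv.Perm.inv_eq_iff_eq, ← hcomm]
    congr 1
    exact (ρ.apply_symm_apply h).symm
  · intro i h
    have : (D.conjugate ρ).IsX i h ↔ D.IsX i h := and_congr_left fun _ => isLeg_conjugate hρ h
    rw [this]
    simp

theorem finsum_comm_of_finite {α β M : Type*} [AddCommMonoid M] [Finite α] [Finite β]
    (f : α → β → M) : ∑ᶠ a, ∑ᶠ b, f a b = ∑ᶠ b, ∑ᶠ a, f a b := by
  have := Fintype.ofFinite α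
  have := Fintype.ofFinite β
  simp_rw [finsum_eq_sum_of_fintype]
  exact Finset.sum_comm

instance {H : Type} [Finite H] (X : Fin μ → H → Prop) : Finite (Chording n X) :=
  Subtype.finite

theorem pairUp_σ_of_isTri {L J : Type} {E : Diagram L} {ℓ : J ↪ E.H} (hℓ : ∀ j, E.IsLeg (ℓ j))
    {τ : Equiv.Perm J} (hτ : ∀ j, τ (τ j) = j) {h : E.H} (hh : E.IsTri h) :
    (pairUp E ℓ hℓ τ hτ).σ h = E.σ h :=
  pairUp_σ_of_notMem hℓ hτ (by rintro ⟨j, rfl⟩; exact (hℓ j).not_isTri hh)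

/-- For every placement of the chords, the joined diagrams satisfy the same relation at the same
vertex. -/
theorem intDiagram_antisymm [DecidableEq D.H] (h : D.H) (hh : D.IsTri h) :
    intDiagram n D + intDiagram n (D.conjugate (Equiv.swap (D.σ h) (D.σ (D.σ h)))) = 0 := by
  have := D.finite
  have h1 : D.IsTri (D.σ h) := (D.isTri_σ_iff h).2 hh
  have h2 : D.IsTri (D.σ (D.σ h)) := (D.isTri_σ_iff _).2 h1
  rw [intDiagram_conjugate (fun g hg => Equiv.swap_apply_of_ne_of_ne (by rintro rfl; exact hg h1)
    (by rintro rfl; exact hg h2)), intDiagram_eq_self, ← smul_add,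
    ← finsum_add_distrib (Set.toFinite _) (Set.toFinite _)]
  rw [finsum_eq_zero_of_forall_eq_zero, smul_zero]
  intro γ
  have key := eval_antisymm (A := Lab.X' μ ∪ Lab.K μ) (S := Lab.K μ) (n := n) (t := -2 * n)
    (D := pairUp D γ.1 (fun c => (γ.2.1 c).1) (flip μ n) flip_flip) h
    ((isTri_pairUp _ _ h).2 hh)
  rwa [pairUp_σ_of_isTri _ _ hh, pairUp_σ_of_isTri _ _ h1] at key

theorem intDiagram_ihx [DecidableEq D.H] (a : D.H) (ha : D.IsTri a) (hd : D.IsTri (D.e a))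
    (h1 : D.e a ≠ D.σ a) (h2 : D.e a ≠ D.σ (D.σ a)) (ρ : Equiv.Perm D.H)
    (hρ : ρ = Equiv.swap (D.σ a) (D.σ (D.σ a)) * Equiv.swap (D.σ (D.σ a)) (D.σ (D.e a))) :
    intDiagram n D + intDiagram n (D.conjugate ρ) + intDiagram n (D.conjugate (ρ * ρ)) = 0 := by
  have := D.finite
  have i1 : D.IsTri (D.σ a) := (D.isTri_σ_iff a).2 ha
  have i2 : D.IsTri (D.σ (D.σ a)) := (D.isTri_σ_iff _).2 i1
  have i3 : D.IsTri (D.σ (D.e a)) := (D.isTri_σ_iff _).2 hd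
  have hρ' : ∀ g, ¬ D.IsTri g → ρ g = g := by
    intro g hg
    have n1 : g ≠ D.σ a := by rintro rfl; exact hg i1
    have n2 : g ≠ D.σ (D.σ a) := by rintro rfl; exact hg i2
    have n3 : g ≠ D.σ (D.e a) := by rintro rfl; exact hg i3
    rw [hρ, Equiv.Perm.mul_apply, Equiv.swap_apply_of_ne_of_ne n2 n3,
      Equiv.swap_apply_of_ne_of_ne n1 n2]
  have hρρ : ∀ g, ¬ D.IsTri g → (ρ * ρ) g = g := fun g hg => by
    rw [Equiv.Perm.mul_apply, hρ' g hg, hρ' g hg]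
  rw [intDiagram_conjugate hρ', intDiagram_conjugate hρρ, intDiagram_eq_self, ← smul_add,
    ← smul_add, ← finsum_add_distrib (Set.toFinite _) (Set.toFinite _),
    ← finsum_add_distrib (Set.toFinite _) (Set.toFinite _)]
  rw [finsum_eq_zero_of_forall_eq_zero, smul_zero]
  intro γ
  refine eval_ihx (D := pairUp D γ.1 (fun c => (γ.2.1 c).1) (flip μ n) flip_flip) a
    ((isTri_pairUp _ _ _).2 ha) ((isTri_pairUp _ _ _).2 hd) ?_ ?_ ρ ?_
  · rwa [pairUp_σ_of_isTri _ _ ha]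
  · rwa [pairUp_σ_of_isTri _ _ ha, pairUp_σ_of_isTri _ _ i1]
  · rw [pairUp_σ_of_isTri _ _ ha, pairUp_σ_of_isTri _ _ i1, pairUp_σ_of_isTri _ _ hd, hρ]

open Classical in
/-- The diagram `D` with a new label `l` at `s`. -/
noncomputable abbrev relabel {L : Type} (D : Diagram L) (s : D.H) (l : L) : Diagram L where
  H := D.H
  finite := D.finite
  e := D.e
  σ := D.σ
  label := Function.update D.label s l
  e_e := D.e_e
  e_ne := D.e_ne
  valence := D.valence

/-- Joining other legs commutes with attaching a leg. -/
noncomputable def isoPairUpAttachLeg {L J : Type} (D : Diagram L) {s u : D.H} (hs : D.IsLeg s)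
    (hu : D.IsLeg u) (hus : u ≠ s) (ℓ : J ↪ D.H) (hℓ : ∀ j, D.IsLeg (ℓ j)) (τ : Equiv.Perm J)
    (hτ : ∀ j, τ (τ j) = j) (hne : ∀ j, τ j ≠ j) (hsℓ : s ∉ Set.range ℓ) (huℓ : u ∉ Set.range ℓ)
    (l m : L) (ℓ' : J ↪ (D.attachLeg l s u hs hu hus).H) (hl : ∀ j, ℓ' j = Sum.inl (ℓ j))
    (hℓ' : ∀ j, (D.attachLeg l s u hs hu hus).IsLeg (ℓ' j))
    (hsP : (pairUp (D.relabel s m) ℓ hℓ τ hτ).IsLeg s)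
    (huP : (pairUp (D.relabel s m) ℓ hℓ τ hτ).IsLeg u) :
    Iso (pairUp (D.attachLeg l s u hs hu hus) ℓ' hℓ' τ hτ)
      ((pairUp (D.relabel s m) ℓ hℓ τ hτ).attachLeg l s u hsP huP hus) where
  f := Equiv.refl _
  map_e _ := rfl
  map_σ := by
    have hmem : ∀ h, h ∉ Set.range ℓ → (Sum.inl h : D.H ⊕ Bool) ∉ Set.range ℓ' := by
      rintro h hh ⟨c, hc⟩
      exact hh ⟨c, Sum.inl_injective ((hl c).symm.trans hc)⟩
    have hmem' : ∀ b, (Sum.inr b : D.H ⊕ Bool) ∉ Set.range ℓ' := by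
      rintro b ⟨c, hc⟩
      exact Sum.inl_ne_inr ((hl c).symm.trans hc)
    rintro (h | _ | _)
    · by_cases h1 : h = u
      · subst h1
        refine Eq.trans ?_ (attachLeg_σ_left (l := l) hsP huP hus).symm
        exact (pairUp_σ_of_notMem hℓ' hτ (hmem h huℓ)).trans (attachLeg_σ_left hs hu hus)
      · by_cases h2 : h = s
        · subst h2
          refine Eq.trans ?_ (attachLeg_σ_new (l := l) hsP huP hus).symm
          exact (pairUp_σ_of_notMem hℓ' hτ (hmem h hsℓ)).trans (attachLeg_σ_new hs hu hus)
        · refine Eq.trans ?_ (attachLeg_σ_inl (l := l) hsP huP hus h1 h2).symm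
          by_cases hh : h ∈ Set.range ℓ
          · obtain ⟨c, rfl⟩ := hh
            refine Eq.trans (congrArg (pairUp (D.attachLeg l s u hs hu hus) ℓ' hℓ' τ hτ).σ
              (hl c).symm) ((pairUp_σ hℓ' hτ c).trans ((hl _).trans ?_))
            exact congrArg Sum.inl (pairUp_σ (E := D.relabel s m) hℓ hτ c).symm
          · exact (pairUp_σ_of_notMem hℓ' hτ (hmem h hh)).trans
              ((attachLeg_σ_inl hs hu hus h1 h2).trans
              (congrArg Sum.inl (pairUp_σ_of_notMem (E := D.relabel s m) hℓ hτ hh).symm))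
    · refine Eq.trans ?_ (attachLeg_σ_false (l := l) hsP huP hus).symm
      exact (pairUp_σ_of_notMem hℓ' hτ (hmem' false)).trans (attachLeg_σ_false hs hu hus)
    · refine Eq.trans ?_ (attachLeg_σ_true (l := l) hsP huP hus).symm
      exact (pairUp_σ_of_notMem hℓ' hτ (hmem' true)).trans (attachLeg_σ_true hs hu hus)
  map_label := by
    classical
    intro x hx
    have hx' := ((isLeg_pairUp hℓ' hτ hne x).1 hx).1
    rcases (isLeg_attachLeg_iff hs hu hus x).1 hx' with rfl | ⟨h, rfl, h1, h2, h3⟩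
    · rfl
    · exact Function.update_of_ne (β := fun _ => L) h2 m D.label

/-- Chords end on `X`-legs and the attachment takes place at `k`-legs, so each placement of the
chords turns the link relation for `D` into one for the joined diagram. -/
theorem intDiagram_link {s : D.H} (hs : D.IsLeg s) :
    ∑ᶠ u : {u : D.H // D.IsLeg u ∧ D.label u = Lab.k ∧ u ≠ s},
      intDiagram n (D.attachLeg Lab.k s u.1 hs u.2.1 u.2.2.2) = 0 := by
  classical
  have := D.finite
  -- The label of `s` is arbitrary and disappears in the attachment. With `k` in its place, no chord
  -- ends at `s`, and the `X`-legs of `D₀` are those of all the attached diagrams.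
  set D₀ := D.relabel s Lab.k with hD₀
  have hlab : ∀ h, h ≠ s → D₀.label h = D.label h := fun h hh => Function.update_of_ne hh _ _
  have hlabs : D₀.label s = Lab.k := Function.update_self (β := fun _ => Lab μ) s Lab.k D.label
  have hX : ∀ u : {u : D.H // D.IsLeg u ∧ D.label u = Lab.k ∧ u ≠ s}, ∀ i h,
      (D.attachLeg Lab.k s u.1 hs u.2.1 u.2.2.2).IsX i h ↔
        ∃ g, (Function.Embedding.inl : D₀.H ↪ D.H ⊕ Bool) g = h ∧ D₀.IsX i g := by
    rintro ⟨u, hu, hul, hne⟩ i h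
    unfold IsX
    rw [isLeg_attachLeg_iff]
    constructor
    · rintro ⟨rfl | ⟨h, rfl, h1, h2, h3⟩, h4⟩
      · exact absurd h4 (by simp)
      · exact ⟨h, rfl, h3, by rw [hlab h h2]; exact h4⟩
    · rintro ⟨g, rfl, hg, hgl⟩
      have g1 : g ≠ s := by
        intro hgs
        rw [hgs, hlabs] at hgl
        exact absurd hgl (by simp)
      have g2 : g ≠ u := by
        intro hgu
        rw [hlab g g1, hgu, hul] at hgl
        exact absurd hgl (by simp)
      refine ⟨.inr ⟨g, rfl, g2, g1, hg⟩, ?_⟩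
      rw [hlab g g1] at hgl
      exact hgl
  simp_rw [fun u => intDiagram_eq (n := n) (hX u)]
  -- The placements do not depend on the leg `u`, so the sum over `u` can be carried out first.
  rw [← smul_finsum, finsum_comm_of_finite]
  rw [finsum_eq_zero_of_forall_eq_zero, smul_zero]
  intro γ
  have hγ := fun c => (γ.2.1 c).1
  have hsγ : s ∉ Set.range γ.1 := by
    rintro ⟨c, hcs⟩
    have hc := (γ.2.1 c).2
    rw [hcs, hlabs] at hc
    exact absurd hc (by simp)
  have hkγ : ∀ u, D₀.label u = Lab.k → u ∉ Set.range γ.1 := by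
    rintro u hu ⟨c, hcu⟩
    have hc := (γ.2.1 c).2
    rw [hcu, hu] at hc
    exact absurd hc (by simp)
  set P := pairUp D₀ γ.1 hγ (flip μ n) flip_flip with hP
  have hsP : P.IsLeg s := (isLeg_pairUp hγ _ flip_ne s).2 ⟨hs, hsγ⟩
  let φ : {u : P.H // P.IsLeg u ∧ P.label u = Lab.k ∧ u ≠ s} ≃
      {u : D.H // D.IsLeg u ∧ D.label u = Lab.k ∧ u ≠ s} :=
    Equiv.subtypeEquivRight fun u => by
      rw [isLeg_pairUp hγ _ flip_ne]
      constructor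
      · rintro ⟨h1, h2, h3⟩
        exact ⟨h1.1, by rw [← hlab u h3]; exact h2, h3⟩
      · rintro ⟨h1, h2, h3⟩
        rw [← hlab u h3] at h2
        exact ⟨⟨h1, hkγ u h2⟩, h2, h3⟩
  rw [← finsum_comp_equiv φ]
  refine Eq.trans (finsum_congr fun u => ?_) (eval_link (A := Lab.X' μ ∪ Lab.K μ) (S := Lab.K μ)
    (n := n) (t := -2 * n) (l := Lab.k) rfl hsP)
  obtain ⟨u, hu, hul, hne⟩ := u
  have hu' : D.IsLeg u := ((isLeg_pairUp hγ _ flip_ne u).1 hu).1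
  have huγ : u ∉ Set.range γ.1 := hkγ u hul
  exact (isoPairUpAttachLeg D hs hu' hne γ.1 hγ (flip μ n) flip_flip flip_ne hsγ huγ Lab.k Lab.k
    _ (fun _ => rfl) _ hsP hu).eval_eq

/-- Formal integration respects the relations. -/
theorem linearCombination_intDiagram_of_relator {r : Diagram (Lab μ) →₀ ℚ}
    (hr : Relator (Lab.K μ) r) : Finsupp.linearCombination ℚ (intDiagram n) r = 0 := by
  classical
  have hv : ∀ D : Diagram (Lab μ), Finsupp.linearCombination ℚ (intDiagram n) D.vec =
      intDiagram n D := fun D => by simp [vec, Finsupp.linearCombination_single]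
  cases hr with
  | iso f => rw [map_sub, hv, hv, f.intDiagram_eq, sub_self]
  | subdivide D a => rw [map_sub, hv, hv, subdivide_eq, intDiagram_subdiv, sub_self]
  | antisymm D h hh =>
    rw [map_add, hv, hv, conj_eq]
    convert intDiagram_antisymm (n := n) h hh
  | ihx D a ha hd h1 h2 ρ hρ =>
    rw [map_add, map_add, hv, hv, hv, conj_eq, conj_eq]
    exact intDiagram_ihx a ha hd h1 h2 ρ (by rw [hρ])
  | link D l hl s hs =>
    obtain rfl : l = Lab.k := hl
    have := D.finite
    rw [_root_.map_finsum _ (Set.toFinite _)]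
    simp_rw [hv, attach_eq]
    exact intDiagram_link hs

end Relations

/-! ### Insertion of k-legs along edges -/

section Comb

variable {L : Type}

/-- The half-edges of the diagram obtained by inserting `m h` trivalent vertices with new legs on
every edge `{h, e h}`, next to `h`. -/
abbrev CombHalf {H : Type} (m : H → ℕ) : Type :=
  (Σ h : H, Fin (m h + 1)) ⊕ ((Σ h : H, Fin (m h)) × Option Bool)

/-- The edges of the diagram with inserted legs. -/
def combEdge (D : Diagram L) (m : D.H → ℕ) : CombHalf m → CombHalf m
  | .inl ⟨h, i⟩ =>
    if hi : i.1 < m h then .inr (⟨h, ⟨i.1, hi⟩⟩, none) else .inl ⟨D.e h, Fin.last _⟩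
  | .inr (⟨h, j⟩, none) => .inl ⟨h, j.castSucc⟩
  | .inr (t, some b) => .inr (t, some (!b))

/-- The vertices of the diagram with inserted legs. -/
def combVertex (D : Diagram L) (m : D.H → ℕ) : CombHalf m → CombHalf m
  | .inl ⟨h, ⟨0, _⟩⟩ => .inl ⟨D.σ h, 0⟩
  | .inl ⟨h, ⟨j + 1, hj⟩⟩ => .inr (⟨h, ⟨j, Nat.lt_of_succ_lt_succ hj⟩⟩, some false)
  | .inr (t, some false) => .inr (t, none)
  | .inr (t, none) => .inl ⟨t.1, t.2.succ⟩
  | .inr (t, some true) => .inr (t, some true)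

theorem combEdge_involutive (D : Diagram L) (m : D.H → ℕ) :
    Function.Involutive (D.combEdge m) := by
  rintro (⟨h, i⟩ | ⟨⟨h, j⟩, _ | b⟩)
  · by_cases hi : i.1 < m h
    · simp [combEdge, hi]
    · have hi' : i = Fin.last _ := Fin.ext (by simp; omega)
      subst hi'
      simp only [combEdge, Fin.val_last, lt_irrefl, dite_false]
      rw [D.e_e]
  · simp [combEdge]
  · simp [combEdge]

theorem combEdge_ne (D : Diagram L) (m : D.H → ℕ) (y : CombHalf m) : D.combEdge m y ≠ y := by
  rcases y with ⟨h, i⟩ | ⟨⟨h, j⟩, _ | b⟩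
  · simp only [combEdge]
    split_ifs
    · simp
    · intro hh
      exact D.e_ne h (congrArg Sigma.fst (Sum.inl.inj hh))
  · simp [combEdge]
  · simp [combEdge]

theorem combHalf_ext {H : Type} {m : H → ℕ} {h h' : H} {i : Fin (m h + 1)} {i' : Fin (m h' + 1)}
    (hh : h = h') (hi : i.1 = i'.1) : (.inl ⟨h, i⟩ : CombHalf m) = .inl ⟨h', i'⟩ := by
  subst hh
  rw [Fin.ext hi]

theorem combHalf_ext' {H : Type} {m : H → ℕ} {h h' : H} {i : Fin (m h)} {i' : Fin (m h')}
    (hh : h = h') (hi : i.1 = i'.1) (b : Option Bool) :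
    (.inr (⟨h, i⟩, b) : CombHalf m) = .inr (⟨h', i'⟩, b) := by
  subst hh
  rw [Fin.ext hi]

/-- The inverse of `combVertex`. -/
def combVertexInv (D : Diagram L) (m : D.H → ℕ) : CombHalf m → CombHalf m
  | .inl ⟨h, ⟨0, _⟩⟩ => .inl ⟨D.σ.symm h, 0⟩
  | .inl ⟨h, ⟨j + 1, hj⟩⟩ => .inr (⟨h, ⟨j, Nat.lt_of_succ_lt_succ hj⟩⟩, none)
  | .inr (t, some false) => .inl ⟨t.1, t.2.succ⟩
  | .inr (t, none) => .inr (t, some false)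
  | .inr (t, some true) => .inr (t, some true)

/-- The diagram obtained from `D` by inserting `m h` trivalent vertices with legs labelled `κ` on
every edge `{h, e h}`, next to `h`, and replacing the labels by `lab`. -/
abbrev comb (D : Diagram L) (m : D.H → ℕ) (lab : D.H → L) (κ : L) : Diagram L where
  H := CombHalf m
  finite := by have := D.finite; infer_instance
  e := (D.combEdge_involutive m).toPerm
  σ :=
    { toFun := D.combVertex m
      invFun := D.combVertexInv m
      left_inv := by
        rintro (⟨h, ⟨_ | j, hj⟩⟩ | ⟨⟨h, j⟩, _ | _ | _⟩)
        · exact combHalf_ext (D.σ.symm_apply_apply h) rfl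
        all_goals rfl
      right_inv := by
        rintro (⟨h, ⟨_ | j, hj⟩⟩ | ⟨⟨h, j⟩, _ | _ | _⟩)
        · exact combHalf_ext (D.σ.apply_symm_apply h) rfl
        all_goals rfl }
  label := Sum.elim (fun y => lab y.1) (fun _ => κ)
  e_e := D.combEdge_involutive m
  e_ne := D.combEdge_ne m
  valence y := by
    change D.combVertex m y = y ∨ D.combVertex m (D.combVertex m y) = y ∨
      D.combVertex m (D.combVertex m (D.combVertex m y)) = y
    rcases y with ⟨h, ⟨_ | j, hj⟩⟩ | ⟨⟨h, j⟩, _ | _ | _⟩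
    · rcases D.valence h with h1 | h1 | h1
      · exact .inl (combHalf_ext h1 rfl)
      · exact .inr (.inl (combHalf_ext h1 rfl))
      · exact .inr (.inr (combHalf_ext h1 rfl))
    · exact .inr (.inr rfl)
    · exact .inr (.inr rfl)
    · exact .inr (.inr rfl)
    · exact .inl rfl

/-- `graft` is an instance of `comb`. -/
def isoGraft {μ : ℕ} (D : Diagram (Lab μ)) (c : D.Choice) :
    Iso (D.graft c) (D.comb c.teeth c.newLabel Lab.k) where
  f := Equiv.refl _
  map_e := by rintro (⟨h, i⟩ | ⟨t, _ | _⟩) <;> rfl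
  map_σ := by rintro (⟨h, ⟨_ | j, hj⟩⟩ | ⟨t, _ | _ | _⟩) <;> rfl
  map_label h _ := by rcases h with _ | _ <;> rfl

variable {D : Diagram L} {m : D.H → ℕ} {lab : D.H → L} {κ : L}

/-- The half-edge `h` as a half-edge of the diagram with inserted legs. -/
def combBase {H : Type} (m : H → ℕ) : H ↪ CombHalf m where
  toFun h := .inl ⟨h, 0⟩
  inj' _ _ hh := congrArg Sigma.fst (Sum.inl_injective hh)

theorem comb_σ_base (h : D.H) :
    (D.comb m lab κ).σ (combBase m h) = combBase m (D.σ h) := rfl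

theorem isLeg_comb_base (h : D.H) : (D.comb m lab κ).IsLeg (combBase m h) ↔ D.IsLeg h := by
  unfold IsLeg
  rw [comb_σ_base, (combBase m).injective.eq_iff]

theorem isTri_comb_base (h : D.H) : (D.comb m lab κ).IsTri (combBase m h) ↔ D.IsTri h := by
  unfold IsTri
  rw [comb_σ_base, comb_σ_base, (combBase m).injective.ne_iff, (combBase m).injective.ne_iff]

theorem isTri_comb_succ (h : D.H) (j : Fin (m h)) :
    (D.comb m lab κ).IsTri (.inl ⟨h, j.succ⟩) := ⟨Sum.inr_ne_inl, Sum.inr_ne_inl⟩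

theorem isLeg_comb_tip (t : Σ h : D.H, Fin (m h)) :
    (D.comb m lab κ).IsLeg (.inr (t, some true)) := rfl

theorem isTri_comb_inner (t : Σ h : D.H, Fin (m h)) (b : Option Bool) (hb : b ≠ some true) :
    (D.comb m lab κ).IsTri (.inr (t, b)) := by
  rcases b with _ | _ | _
  · exact ⟨Sum.inl_ne_inr, fun h => by simpa using (Sum.inr_injective h)⟩
  · exact ⟨fun h => by simpa using (Sum.inr_injective h), Sum.inl_ne_inr⟩
  · exact absurd rfl hb

theorem isLeg_comb_iff (y : CombHalf m) : (D.comb m lab κ).IsLeg y ↔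
    (∃ h, combBase m h = y ∧ D.IsLeg h) ∨ ∃ t, y = .inr (t, some true) := by
  constructor
  · intro hy
    rcases y with ⟨h, ⟨_ | j, hj⟩⟩ | ⟨t, b⟩
    · exact .inl ⟨h, rfl, (isLeg_comb_base h).1 hy⟩
    · exact (hy.not_isTri (isTri_comb_succ h ⟨j, Nat.lt_of_succ_lt_succ hj⟩)).elim
    · refine .inr ⟨t, ?_⟩
      by_contra hb
      exact hy.not_isTri (isTri_comb_inner t b fun h => hb (by rw [h]))
  · rintro (⟨h, rfl, hh⟩ | ⟨t, rfl⟩)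
    · exact (isLeg_comb_base h).2 hh
    · rfl

theorem card_isLeg_comb : Nat.card {y // (D.comb m lab κ).IsLeg y} =
    Nat.card {h // D.IsLeg h} + Nat.card (Σ h, Fin (m h)) := by
  have := D.finite
  rw [← Nat.card_sum]
  refine (Nat.card_congr (Equiv.ofBijective (Sum.elim (fun h => ⟨combBase m h.1,
    (isLeg_comb_base h.1).2 h.2⟩) (fun t => ⟨.inr (t, some true), rfl⟩)) ⟨?_, ?_⟩)).symm
  · rintro (a | a) (b | b) hab
    · exact congrArg Sum.inl (Subtype.ext ((combBase m).injective (congrArg Subtype.val hab)))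
    · exact (Sum.inl_ne_inr (congrArg Subtype.val hab)).elim
    · exact (Sum.inr_ne_inl (congrArg Subtype.val hab)).elim
    · exact congrArg Sum.inr (congrArg Prod.fst (Sum.inr_injective (congrArg Subtype.val hab)))
  · rintro ⟨y, hy⟩
    rcases (isLeg_comb_iff y).1 hy with ⟨h, rfl, hh⟩ | ⟨t, rfl⟩
    · exact ⟨.inl ⟨h, hh⟩, rfl⟩
    · exact ⟨.inr t, rfl⟩

theorem card_isTri_comb : Nat.card {y // (D.comb m lab κ).IsTri y} =
    Nat.card {h // D.IsTri h} + 3 * Nat.card (Σ h, Fin (m h)) := by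
  have := D.finite
  have h3 : 3 * Nat.card (Σ h, Fin (m h)) = Nat.card ((Σ h, Fin (m h)) × Option Bool) := by
    rw [Nat.card_prod, mul_comm]
    simp
  rw [h3, ← Nat.card_sum]
  refine Nat.card_congr ⟨?_, ?_, ?_, ?_⟩
  · rintro ⟨⟨h, ⟨_ | j, hj⟩⟩ | ⟨t, _ | _ | _⟩, hy⟩
    · exact .inl ⟨h, (isTri_comb_base h).1 hy⟩
    · exact .inr (⟨h, ⟨j, Nat.lt_of_succ_lt_succ hj⟩⟩, some true)
    · exact .inr (t, none)
    · exact .inr (t, some false)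
    · exact ((isLeg_comb_tip t).not_isTri hy).elim
  · rintro (h | ⟨t, _ | _ | _⟩)
    · exact ⟨combBase m h.1, (isTri_comb_base h.1).2 h.2⟩
    · exact ⟨.inr (t, none), isTri_comb_inner _ _ (by simp)⟩
    · exact ⟨.inr (t, some false), isTri_comb_inner _ _ (by simp)⟩
    · exact ⟨.inl ⟨t.1, t.2.succ⟩, isTri_comb_succ _ _⟩
  · rintro ⟨⟨h, ⟨_ | j, hj⟩⟩ | ⟨t, _ | _ | _⟩, hy⟩
    · rfl
    · rfl
    · rfl
    · rfl
    · exact ((isLeg_comb_tip t).not_isTri hy).elim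
  · rintro (h | ⟨t, _ | _ | _⟩) <;> rfl

/-- Each inserted leg brings one univalent and one trivalent vertex, hence adds one to the degree.
-/
theorem degree_comb : (D.comb m lab κ).degree = D.degree + Nat.card (Σ h, Fin (m h)) := by
  unfold degree
  rw [card_isLeg_comb, card_isTri_comb]
  omega

end Comb

/-! ### A translated leg as a strut joined to the original leg -/

section Strut

variable {L : Type}

/-- The disjoint union of `D` and a strut whose ends are labelled `l`. -/
abbrev withStrut (D : Diagram L) (l : L) : Diagram L where
  H := D.H ⊕ Bool
  finite := by have := D.finite; infer_instance
  e := Equiv.sumCongr D.e Equiv.boolNot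
  σ := Equiv.sumCongr D.σ (Equiv.refl Bool)
  label := Sum.elim D.label (fun _ => l)
  e_e x := by rcases x with h | b <;> simp [D.e_e]
  e_ne x := by rcases x with h | b <;> simp [D.e_ne]
  valence x := by
    rcases x with h | b
    · simpa using D.valence h
    · simp

theorem comb_e_last {D : Diagram L} {m : D.H → ℕ} {lab : D.H → L} {κ : L} {h : D.H}
    {i : Fin (m h + 1)} (hi : ¬ i.1 < m h) :
    (D.comb m lab κ).e (.inl ⟨h, i⟩) = .inl ⟨D.e h, Fin.last _⟩ := dif_neg hi

theorem comb_e_of_lt {D : Diagram L} {m : D.H → ℕ} {lab : D.H → L} {κ : L} {h : D.H}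
    {i : Fin (m h + 1)} (hi : i.1 < m h) :
    (D.comb m lab κ).e (.inl ⟨h, i⟩) = .inr (⟨h, ⟨i.1, hi⟩⟩, none) := dif_pos hi

/-- Functoriality of the half-edges of diagrams with inserted legs. -/
def combMap {H H' : Type} {m : H → ℕ} {m' : H' → ℕ} (θ : H → H') (hθ : ∀ h, m' (θ h) = m h) :
    CombHalf m → CombHalf m'
  | .inl ⟨h, i⟩ => .inl ⟨θ h, i.cast (by rw [hθ])⟩
  | .inr (⟨h, j⟩, b) => .inr (⟨θ h, j.cast (by rw [hθ])⟩, b)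

theorem combMap_injective {H H' : Type} {m : H → ℕ} {m' : H' → ℕ} {θ : H → H'}
    (hθ : ∀ h, m' (θ h) = m h) (hinj : Function.Injective θ) :
    Function.Injective (combMap θ hθ) := by
  rintro (⟨h, i⟩ | ⟨⟨h, i⟩, b⟩) (⟨h', i'⟩ | ⟨⟨h', i'⟩, b'⟩) H
  · have H1 := Sum.inl_injective H
    obtain rfl := hinj (congrArg Sigma.fst H1)
    have H2 := congrArg Fin.val (eq_of_heq (Sigma.mk.inj H1).2)
    exact combHalf_ext rfl H2
  · exact (Sum.inl_ne_inr H).elim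
  · exact (Sum.inr_ne_inl H).elim
  · have H1 := congrArg Prod.fst (Sum.inr_injective H)
    obtain rfl : b = b' := congrArg Prod.snd (Sum.inr_injective H)
    obtain rfl := hinj (congrArg Sigma.fst H1)
    have H2 := congrArg Fin.val (eq_of_heq (Sigma.mk.inj H1).2)
    exact combHalf_ext' (m := m) rfl H2 b

variable (D : Diagram L) (s : D.H)

open Classical in
/-- Half-edges of `D` as half-edges of `D` with a strut, the leg `s` being sent to the strut. -/
noncomputable def toStrut (h : D.H) : D.H ⊕ Bool := if h = s then .inr true else .inl h

theorem toStrut_self : D.toStrut s s = .inr true := if_pos rfl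

variable {s}

theorem toStrut_of_ne {h : D.H} (hh : h ≠ s) : D.toStrut s h = .inl h := if_neg hh

variable (s)

theorem toStrut_injective : Function.Injective (D.toStrut s) := by
  intro a b hab
  by_cases ha : a = s <;> by_cases hb : b = s
  · rw [ha, hb]
  · rw [ha, toStrut_self, toStrut_of_ne _ hb] at hab
    exact (Sum.inr_ne_inl hab).elim
  · rw [hb, toStrut_self, toStrut_of_ne _ ha] at hab
    exact (Sum.inl_ne_inr hab).elim
  · rw [toStrut_of_ne _ ha, toStrut_of_ne _ hb] at hab
    exact Sum.inl_injective hab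

/-- The numbers of inserted legs when the end `true` of the strut receives `a` of them. -/
abbrev strutTeeth {H : Type} (m₀ : H → ℕ) (a : ℕ) : H ⊕ Bool → ℕ :=
  Sum.elim m₀ fun b => bif b then a else 0

variable {D s} {m m₀ : D.H → ℕ} (hm : ∀ h, h ≠ s → m h = m₀ h) (hm₀ : m₀ s = 0)

theorem strutTeeth_toStrut (hm : ∀ h, h ≠ s → m h = m₀ h) (h : D.H) :
    strutTeeth m₀ (m s) (D.toStrut s h) = m h := by
  by_cases hh : h = s
  · rw [hh, toStrut_self]
    rfl
  · rw [toStrut_of_ne _ hh, hm h hh]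
    rfl

/-- The half-edges of a diagram with inserted legs and one more subdivision point as half-edges of a
diagram with inserted legs and a strut. -/
noncomputable def strutMap (hm : ∀ h, h ≠ s → m h = m₀ h) :
    CombHalf m ⊕ Bool → CombHalf (strutTeeth m₀ (m s)) :=
  -- The old end `s`, with its teeth, becomes the end `true` of the strut. The two halves of the new
  -- subdivision point become the bare leg `s` and the free end `false` of the strut.
  Sum.elim (combMap (D.toStrut s) (strutTeeth_toStrut hm)) fun b =>
    combBase _ (bif b then .inl s else .inr false)

theorem strutMap_bijective (hm₀ : m₀ s = 0) : Function.Bijective (strutMap hm) := by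
  have h0 : ∀ (y : CombHalf m) b, strutMap hm (.inl y) ≠ strutMap hm (.inr b) := by
    rintro (⟨h, i⟩ | ⟨⟨h, i⟩, b'⟩) b H
    · have H1 : D.toStrut s h = bif b then .inl s else .inr false :=
        congrArg Sigma.fst (Sum.inl_injective H)
      by_cases hh : h = s
      · rw [hh, toStrut_self] at H1
        cases b
        · exact absurd (Sum.inr_injective H1) (by simp)
        · exact Sum.inr_ne_inl H1
      · rw [toStrut_of_ne _ hh] at H1
        cases b
        · exact Sum.inl_ne_inr H1
        · exact hh (Sum.inl_injective H1)
    · exact Sum.inr_ne_inl H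
  constructor
  · rintro (y | b) (y' | b') H
    · exact congrArg Sum.inl (combMap_injective (strutTeeth_toStrut hm) (D.toStrut_injective s) H)
    · exact (h0 _ _ H).elim
    · exact (h0 _ _ H.symm).elim
    · have H1 := (combBase (strutTeeth m₀ (m s))).injective H
      cases b <;> cases b' <;> first | rfl | exact (Sum.inl_ne_inr H1).elim |
        exact (Sum.inr_ne_inl H1).elim
  · rintro (⟨h | _ | _, i⟩ | ⟨⟨h | _ | _, i⟩, b⟩)
    · by_cases hh : h = s
      · subst hh
        refine ⟨.inr true, combHalf_ext rfl ?_⟩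
        have := i.2
        change i.1 < m₀ h + 1 at this
        change 0 = i.1
        omega
      · exact ⟨.inl (.inl ⟨h, i.cast (by rw [hm h hh]; rfl)⟩),
          combHalf_ext (toStrut_of_ne _ hh) rfl⟩
    · refine ⟨.inr false, combHalf_ext rfl ?_⟩
      have := i.2
      change i.1 < 0 + 1 at this
      change 0 = i.1
      omega
    · exact ⟨.inl (.inl ⟨s, i⟩), combHalf_ext (toStrut_self _ _) rfl⟩
    · by_cases hh : h = s
      · subst hh
        have := i.2
        change i.1 < m₀ h at this
        omega
      · exact ⟨.inl (.inr (⟨h, i.cast (by rw [hm h hh]; rfl)⟩, b)),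
          combHalf_ext' (toStrut_of_ne _ hh) rfl b⟩
    · exact i.elim0
    · exact ⟨.inl (.inr (⟨s, i⟩, b)), combHalf_ext' (toStrut_self _ _) rfl b⟩

variable {lab lab₀ : D.H → L} (hlab : ∀ h, h ≠ s → lab h = lab₀ h) (κ : L)

/-- `D` with inserted legs and a strut, one of whose ends receives `a` inserted legs. -/
abbrev combStrut (D : Diagram L) (m₀ : D.H → ℕ) (a : ℕ) (lab₀ : D.H → L)
    (l κ : L) : Diagram L :=
  (D.withStrut l).comb (strutTeeth m₀ a) (Sum.elim lab₀ fun _ => l) κ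

-- The edge at `s` is cut beyond its outermost tooth, at `Fin.last`. By `hm₀` the bare leg `s` has
-- no teeth, so its half-edge in position 0 is also its last one, and the far edge is recovered.
include hm₀ in
theorem strutMap_e (x : CombHalf m ⊕ Bool) :
    strutMap hm (((D.comb m lab κ).subdiv (.inl ⟨s, Fin.last _⟩)).e x) =
      (D.combStrut m₀ (m s) lab₀ (lab s) κ).e (strutMap hm x) := by
  have hes : D.e s ≠ s := D.e_ne s
  set G := D.comb m lab κ with hG
  have hlast : G.e (.inl ⟨s, Fin.last _⟩) = .inl ⟨D.e s, Fin.last _⟩ := comb_e_last (by simp)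
  have htee : ∀ h, strutTeeth m₀ (m s) (D.toStrut s h) = m h := strutTeeth_toStrut hm
  rcases x with (⟨h, i⟩ | ⟨⟨h, i⟩, _ | b⟩) | _ | _
  · by_cases hi : i.1 < m h
    · have h1 : (.inl ⟨h, i⟩ : CombHalf m) ≠ .inl ⟨s, Fin.last _⟩ := by
        intro H
        obtain rfl : h = s := congrArg Sigma.fst (Sum.inl_injective H)
        have := congrArg Fin.val (eq_of_heq (Sigma.mk.inj (Sum.inl_injective H)).2)
        simp at this
        omega
      have h2 : (.inl ⟨h, i⟩ : CombHalf m) ≠ G.e (.inl ⟨s, Fin.last _⟩) := by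
        rw [hlast]
        intro H
        obtain rfl : h = D.e s := congrArg Sigma.fst (Sum.inl_injective H)
        have := congrArg Fin.val (eq_of_heq (Sigma.mk.inj (Sum.inl_injective H)).2)
        simp at this
        omega
      refine (congrArg (strutMap hm) ((subdiv_e_inl (D := G) _ h1 h2).trans
        (congrArg Sum.inl (comb_e_of_lt hi)))).trans (Eq.symm ?_)
      exact comb_e_of_lt (D := D.withStrut (lab s)) (h := D.toStrut s h)
        (i := i.cast (by rw [htee])) (lt_of_lt_of_eq hi (htee h).symm)
    · have hi' : i = Fin.last _ := Fin.ext (by simp; omega)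
      subst hi'
      have hR : (D.combStrut m₀ (m s) lab₀ (lab s) κ).e
          (strutMap hm (.inl (.inl ⟨h, Fin.last _⟩))) =
            .inl ⟨(D.withStrut (lab s)).e (D.toStrut s h), Fin.last _⟩ :=
        comb_e_last (D := D.withStrut (lab s)) (h := D.toStrut s h)
          (i := (Fin.last (m h)).cast (by rw [htee]))
          fun H => hi (lt_of_lt_of_eq H (htee h))
      refine Eq.trans ?_ hR.symm
      by_cases h1 : h = s
      · subst h1
        refine (congrArg (strutMap hm) (subdiv_e_inl_self (D := G) _)).trans ?_
        exact combHalf_ext (by rw [toStrut_self]; rfl) (by rw [toStrut_self]; rfl)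
      · by_cases h2 : h = D.e s
        · subst h2
          refine (congrArg (strutMap hm) ((congrArg _ (congrArg Sum.inl hlast.symm)).trans
            (subdiv_e_inl_e (D := G) _))).trans ?_
          have h3 : (D.withStrut (lab s)).e (D.toStrut s (D.e s)) = .inl s := by
            rw [toStrut_of_ne _ hes]
            exact congrArg Sum.inl (D.e_e s)
          exact combHalf_ext h3.symm (by rw [h3]; exact hm₀.symm)
        · have h1' : (.inl ⟨h, Fin.last _⟩ : CombHalf m) ≠ .inl ⟨s, Fin.last _⟩ :=
            fun H => h1 (congrArg Sigma.fst (Sum.inl_injective H))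
          have h2' : (.inl ⟨h, Fin.last _⟩ : CombHalf m) ≠ G.e (.inl ⟨s, Fin.last _⟩) := by
            rw [hlast]
            exact fun H => h2 (congrArg Sigma.fst (Sum.inl_injective H))
          have h3 : D.e h ≠ s := fun H => h2 (by rw [← H, D.e_e])
          refine (congrArg (strutMap hm) ((subdiv_e_inl (D := G) _ h1' h2').trans
            (congrArg Sum.inl (comb_e_last hi)))).trans ?_
          have h4 : D.toStrut s (D.e h) = (D.withStrut (lab s)).e (D.toStrut s h) := by
            rw [toStrut_of_ne _ h3, toStrut_of_ne _ h1]
            rfl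
          exact combHalf_ext h4 ((htee (D.e h)).symm.trans (congrArg _ h4))
  · exact congrArg (strutMap hm) (subdiv_e_inl (D := G) _ Sum.inr_ne_inl
      (by rw [hlast]; exact Sum.inr_ne_inl))
  · exact congrArg (strutMap hm) (subdiv_e_inl (D := G) _ Sum.inr_ne_inl
      (by rw [hlast]; exact Sum.inr_ne_inl))
  · refine Eq.trans ?_ (comb_e_last (D := D.withStrut (lab s)) (by simp)).symm
    exact combHalf_ext (toStrut_self _ _) (by rw [Fin.val_last]; rfl)
  · refine (congrArg (strutMap hm) (congrArg Sum.inl hlast)).trans (Eq.trans ?_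
      (comb_e_last (D := D.withStrut (lab s)) (by simp [hm₀])).symm)
    exact combHalf_ext (toStrut_of_ne _ hes) (by
      change m (D.e s) = m₀ (D.e s)
      exact hm _ hes)

/-- Attaching a diagram with inserted legs at the leg `s` amounts to joining `s` to a strut. -/
theorem strutMap_σ {J : Type} {ℓ : J ↪ D.H} (hℓ : ∀ j, (D.comb m lab κ).IsLeg
      ((ℓ.trans (combBase m)) j)) {τ : Equiv.Perm J}
    (hτ : ∀ j, τ (τ j) = j) (hs : D.IsLeg s) (hsℓ : s ∉ Set.range ℓ)
    {ℓ' : J ⊕ Bool ↪ D.H ⊕ Bool} (hl : ∀ j, ℓ' (.inl j) = .inl (ℓ j))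
    (ht : ℓ' (.inr true) = .inl s) (hf : ℓ' (.inr false) = .inr false)
    (hℓ' : ∀ j, (D.combStrut m₀ (m s) lab₀ (lab s) κ).IsLeg ((ℓ'.trans (combBase _)) j))
    (hτ' : ∀ j, (Equiv.sumCongr τ Equiv.boolNot) ((Equiv.sumCongr τ Equiv.boolNot) j) = j)
    (x : CombHalf m ⊕ Bool) :
    strutMap hm (((pairUp (D.comb m lab κ) (ℓ.trans (combBase m)) hℓ τ hτ).subdiv
        (.inl ⟨s, Fin.last _⟩)).σ x) =
      (pairUp (D.combStrut m₀ (m s) lab₀ (lab s) κ) (ℓ'.trans (combBase _)) hℓ'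
        (Equiv.sumCongr τ Equiv.boolNot) hτ').σ (strutMap hm x) := by
  set P := pairUp (D.comb m lab κ) (ℓ.trans (combBase m)) hℓ τ hτ with hP
  set Q := pairUp (D.combStrut m₀ (m s) lab₀ (lab s) κ) (ℓ'.trans (combBase _)) hℓ'
        (Equiv.sumCongr τ Equiv.boolNot) hτ' with hQ
  have hbase : ∀ h, h ≠ s → strutMap hm (.inl (combBase m h)) = combBase _ (.inl h) :=
    fun h hh => combHalf_ext (toStrut_of_ne _ hh) rfl
  have hr : ∀ y : CombHalf (strutTeeth m₀ (m s)),
      (∀ j, y ≠ combBase _ (ℓ' j)) → y ∉ Set.range (ℓ'.trans (combBase _)) := by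
    rintro y hy ⟨j, hj⟩
    exact hy j hj.symm
  have hrP : ∀ y : CombHalf m,
      (∀ j, y ≠ combBase _ (ℓ j)) → y ∉ Set.range (ℓ.trans (combBase m)) := by
    rintro y hy ⟨j, hj⟩
    exact hy j hj.symm
  rcases x with (⟨h, ⟨_ | i, hi⟩⟩ | ⟨t, _ | _ | _⟩) | _ | _
  · change strutMap hm (.inl (P.σ (combBase m h))) = Q.σ (strutMap hm (.inl (combBase m h)))
    by_cases hh : h = s
    · subst hh
      have h1 : P.σ (combBase m h) = combBase m h :=
        (pairUp_σ_of_notMem hℓ hτ (hrP _ fun j hj => hsℓ ⟨j, ((combBase m).injective hj).symm⟩)).trans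
          (congrArg (combBase m) hs)
      have h2 : strutMap hm (.inl (combBase m h)) = combBase _ (.inr true) :=
        combHalf_ext (toStrut_self _ _) rfl
      rw [h1, h2]
      refine (pairUp_σ_of_notMem hℓ' hτ' (hr (combBase _ (.inr true)) ?_)).symm
      intro j hj
      have h3 := (combBase (strutTeeth m₀ (m h))).injective hj
      rcases j with j | _ | _
      · rw [hl] at h3; exact Sum.inr_ne_inl h3
      · rw [hf] at h3; exact absurd (Sum.inr_injective h3) (by simp)
      · rw [ht] at h3; exact Sum.inr_ne_inl h3
    · by_cases h1 : h ∈ Set.range ℓ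
      · obtain ⟨j, rfl⟩ := h1
        have h2 : ℓ (τ j) ≠ s := fun H => hsℓ ⟨_, H⟩
        have h3 : P.σ (combBase m (ℓ j)) = combBase m (ℓ (τ j)) := pairUp_σ hℓ hτ j
        rw [h3, hbase _ hh, hbase _ h2, ← hl, ← hl]
        exact (pairUp_σ hℓ' hτ' (.inl j)).symm
      · have h2 : D.σ h ≠ s := fun H => hh (D.σ.injective (H.trans hs.symm))
        have h3 : P.σ (combBase m h) = combBase m (D.σ h) :=
          pairUp_σ_of_notMem hℓ hτ (hrP _ fun j hj => h1 ⟨j, ((combBase m).injective hj).symm⟩)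
        rw [h3, hbase _ hh, hbase _ h2]
        refine (pairUp_σ_of_notMem hℓ' hτ' (hr (combBase _ (.inl h)) ?_)).symm
        intro j hj
        have h4 := (combBase (strutTeeth m₀ (m s))).injective hj
        rcases j with j | _ | _
        · rw [hl] at h4; exact h1 ⟨j, (Sum.inl_injective h4).symm⟩
        · rw [hf] at h4; exact Sum.inl_ne_inr h4
        · rw [ht] at h4; exact hh (Sum.inl_injective h4)
  · have h1 : P.σ (.inl ⟨h, ⟨i + 1, hi⟩⟩) =
        .inr (⟨h, ⟨i, Nat.lt_of_succ_lt_succ hi⟩⟩, some false) := by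
      refine pairUp_σ_of_notMem hℓ hτ (hrP _ fun j hj => ?_)
      have h2 := Sum.inl_injective hj
      obtain rfl : h = ℓ j := congrArg Sigma.fst h2
      have := congrArg Fin.val (eq_of_heq (Sigma.mk.inj h2).2)
      simp at this
    refine (congrArg (fun y => strutMap hm (.inl y)) h1).trans (Eq.symm ?_)
    refine pairUp_σ_of_notMem hℓ' hτ' (hr _ fun j hj => ?_)
    have h2 := Sum.inl_injective hj
    have h3 : ∀ (k k' : D.H ⊕ Bool) (a : Fin (strutTeeth m₀ (m s) k + 1)) b,
      (⟨k, a⟩ : Σ k, Fin (strutTeeth m₀ (m s) k + 1)) = ⟨k', b⟩ → a.1 = b.1 := by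
      rintro k k' a b H
      obtain rfl : k = k' := congrArg Sigma.fst H
      rw [eq_of_heq (Sigma.mk.inj H).2]
    exact absurd (h3 _ _ _ _ h2) (by simp)
  · have h1 : P.σ (.inr (t, none)) = .inl ⟨t.1, t.2.succ⟩ :=
      pairUp_σ_of_notMem hℓ hτ (hrP _ fun j hj => Sum.inr_ne_inl hj)
    refine (congrArg (fun y => strutMap hm (.inl y)) h1).trans (Eq.symm ?_)
    exact pairUp_σ_of_notMem hℓ' hτ' (hr _ fun j hj => Sum.inr_ne_inl hj)
  · have h1 : P.σ (.inr (t, some false)) = .inr (t, none) :=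
      pairUp_σ_of_notMem hℓ hτ (hrP _ fun j hj => Sum.inr_ne_inl hj)
    refine (congrArg (fun y => strutMap hm (.inl y)) h1).trans (Eq.symm ?_)
    exact pairUp_σ_of_notMem hℓ' hτ' (hr _ fun j hj => Sum.inr_ne_inl hj)
  · have h1 : P.σ (.inr (t, some true)) = .inr (t, some true) :=
      pairUp_σ_of_notMem hℓ hτ (hrP _ fun j hj => Sum.inr_ne_inl hj)
    refine (congrArg (fun y => strutMap hm (.inl y)) h1).trans (Eq.symm ?_)
    exact pairUp_σ_of_notMem hℓ' hτ' (hr _ fun j hj => Sum.inr_ne_inl hj)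
  · change combBase _ (.inl s) = Q.σ (combBase _ (.inr false))
    rw [← hf, ← ht]
    exact (pairUp_σ hℓ' hτ' (.inr false)).symm
  · change combBase _ (.inr false) = Q.σ (combBase _ (.inl s))
    rw [← hf, ← ht]
    exact (pairUp_σ hℓ' hτ' (.inr true)).symm

include hlab in
theorem strutMap_label (y : CombHalf m) :
    (D.combStrut m₀ (m s) lab₀ (lab s) κ).label (strutMap hm (.inl y)) =
      (D.comb m lab κ).label y := by
  rcases y with ⟨h, i⟩ | ⟨⟨h, i⟩, b⟩
  · change (Sum.elim lab₀ fun _ => lab s) (D.toStrut s h) = lab h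
    by_cases hh : h = s
    · rw [hh, toStrut_self]; rfl
    · rw [toStrut_of_ne _ hh, hlab h hh]; rfl
  · rfl

-- After a subdivision, the edge carrying the teeth of `s` is the strut with those teeth, its free
-- end being joined to the bare leg `s`. Thus a translated leg counts as one more chord, and the
-- diagram on the right no longer depends on `s` except through the position of that chord.
include hm hlab in
theorem eval_pairUp_comb {A S : Set L} {n : ℕ} {t : ℚ} (hm₀ : m₀ s = 0) {a : ℕ}
    (ha : m s = a) {l : L}
    (hls : lab s = l) {J : Type} {ℓ : J ↪ D.H}
    (hℓ : ∀ j, (D.comb m lab κ).IsLeg ((ℓ.trans (combBase m)) j)) {τ : Equiv.Perm J}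
    (hτ : ∀ j, τ (τ j) = j) (hs : D.IsLeg s) (hsℓ : s ∉ Set.range ℓ)
    {ℓ' : J ⊕ Bool ↪ D.H ⊕ Bool} (hl : ∀ j, ℓ' (.inl j) = .inl (ℓ j))
    (ht : ℓ' (.inr true) = .inl s) (hf : ℓ' (.inr false) = .inr false)
    (hℓ' : ∀ j, (D.combStrut m₀ a lab₀ l κ).IsLeg ((ℓ'.trans (combBase _)) j))
    (hτ' : ∀ j, (Equiv.sumCongr τ Equiv.boolNot) ((Equiv.sumCongr τ Equiv.boolNot) j) = j) :
    eval A S n t (pairUp (D.comb m lab κ) (ℓ.trans (combBase m)) hℓ τ hτ) =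
      eval A S n t (pairUp (D.combStrut m₀ a lab₀ l κ) (ℓ'.trans (combBase _)) hℓ'
        (Equiv.sumCongr τ Equiv.boolNot) hτ') := by
  subst ha hls
  refine (eval_subdiv (D := pairUp (D.comb m lab κ) (ℓ.trans (combBase m)) hℓ τ hτ)
    (.inl ⟨s, Fin.last _⟩)).symm.trans (Iso.eval_eq ⟨Equiv.ofBijective _
      (strutMap_bijective hm hm₀), ?_,
      strutMap_σ hm κ hℓ hτ hs hsℓ hl ht hf hℓ' hτ', ?_⟩)
  · rintro (y | _ | _)
    · exact strutMap_e (lab := lab) (lab₀ := lab₀) hm hm₀ κ (.inl y)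
    · exact strutMap_e (lab := lab) (lab₀ := lab₀) hm hm₀ κ (.inr false)
    · exact strutMap_e (lab := lab) (lab₀ := lab₀) hm hm₀ κ (.inr true)
  rintro (y | b) hy
  · exact strutMap_label hm hlab κ y
  · exact (hy.not_isBiv (isBiv_subdiv_inr _ b)).elim

end Strut

/-! ### Joining the legs of one colour -/

section Averaging

variable {L : Type} {A S : Set L} {n : ℕ} {t : ℚ} {J : Type} {E : Diagram L} {ℓ : J ↪ E.H}
  (hℓ : ∀ j, E.IsLeg (ℓ j)) {τ : Equiv.Perm J} (hτ : ∀ j, τ (τ j) = j) (hne : ∀ j, τ j ≠ j)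
  {p : J → Prop} [DecidablePred p] (hp : ∀ j, p (τ j) ↔ p j)

/-- Legs can be joined in two steps. -/
theorem eval_pairUp_split (π : Equiv.Perm {j // p j})
    (h1 : ∀ j, E.IsLeg (((Function.Embedding.subtype fun j => ¬ p j).trans ℓ) j))
    (h2 : ∀ j, τ.subtypePerm (fun j => not_congr (hp j)) (τ.subtypePerm
      (fun j => not_congr (hp j)) j) = j)
    (h3 : ∀ j, (pairUp E ((Function.Embedding.subtype fun j => ¬ p j).trans ℓ) h1
        (τ.subtypePerm fun j => not_congr (hp j)) h2).IsLeg
      (((Function.Embedding.subtype p).trans ℓ) j))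
    (h4 : ∀ j, (π * τ.subtypePerm hp * π⁻¹) ((π * τ.subtypePerm hp * π⁻¹) j) = j)
    (h5 : ∀ j, E.IsLeg (((Equiv.Perm.ofSubtype π).toEmbedding.trans ℓ) j)) :
    eval A S n t (pairUp E ((Equiv.Perm.ofSubtype π).toEmbedding.trans ℓ) h5 τ hτ) =
      eval A S n t (pairUp (pairUp E ((Function.Embedding.subtype fun j => ¬ p j).trans ℓ) h1
        (τ.subtypePerm fun j => not_congr (hp j)) h2) ((Function.Embedding.subtype p).trans ℓ) h3
        (π * τ.subtypePerm hp * π⁻¹) h4) := by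
  refine Iso.eval_eq ⟨Equiv.refl _, fun _ => rfl, fun h => ?_, fun _ _ => rfl⟩
  set Q := pairUp E ((Function.Embedding.subtype fun j => ¬ p j).trans ℓ) h1
        (τ.subtypePerm fun j => not_congr (hp j)) h2 with hQ
  set ℓπ := (Equiv.Perm.ofSubtype π).toEmbedding.trans ℓ with hℓπ
  change (pairUp E ℓπ h5 τ hτ).σ h = (pairUp Q ((Function.Embedding.subtype p).trans ℓ) h3
        (π * τ.subtypePerm hp * π⁻¹) h4).σ h
  have hrange : ∀ j, ℓ j = ℓπ ((Equiv.Perm.ofSubtype π).symm j) := fun j =>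
    congrArg ℓ ((Equiv.Perm.ofSubtype π).apply_symm_apply j).symm
  by_cases hh : h ∈ Set.range ℓ
  · obtain ⟨j, rfl⟩ := hh
    by_cases hj : p j
    · have e1 : (Equiv.Perm.ofSubtype π).symm j = (π⁻¹ ⟨j, hj⟩).1 := by
        rw [Equiv.symm_apply_eq, Equiv.Perm.ofSubtype_apply_coe]
        exact congrArg Subtype.val (π.apply_symm_apply ⟨j, hj⟩).symm
      have e2 : τ (π⁻¹ ⟨j, hj⟩).1 = (τ.subtypePerm hp (π⁻¹ ⟨j, hj⟩)).1 := rfl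
      refine ((congrArg _ (hrange j)).trans ((pairUp_σ h5 hτ _).trans ?_)).trans
        (pairUp_σ h3 h4 ⟨j, hj⟩).symm
      change ℓ (Equiv.Perm.ofSubtype π (τ _)) = ℓ _
      rw [e1, e2, Equiv.Perm.ofSubtype_apply_coe]
      rfl
    · have hfix : ∀ j, ¬ p j → Equiv.Perm.ofSubtype π j = j := fun j hj =>
        Equiv.Perm.ofSubtype_apply_of_not_mem π hj
      have e1 : (Equiv.Perm.ofSubtype π).symm j = j := by
        rw [Equiv.symm_apply_eq, hfix j hj]
      refine ((congrArg _ (hrange j)).trans ((pairUp_σ h5 hτ _).trans ?_)).trans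
        ((pairUp_σ_of_notMem h3 h4 ?_).trans (pairUp_σ h1 h2 ⟨j, hj⟩)).symm
      · change ℓ (Equiv.Perm.ofSubtype π (τ _)) = ℓ (τ j)
        rw [e1, hfix _ (mt (hp j).1 hj)]
      · rintro ⟨j', hj'⟩
        have h6 : j'.1 = j := ℓ.injective hj'
        exact hj (h6 ▸ j'.2)
  · have n1 : ∀ {K : Type} (f : K ↪ J), h ∉ Set.range (f.trans ℓ) := by
      rintro K f ⟨j, hj⟩
      exact hh ⟨_, hj⟩
    exact (pairUp_σ_of_notMem h5 hτ (n1 _)).trans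
      ((pairUp_σ_of_notMem h3 h4 (n1 _)).trans (pairUp_σ_of_notMem h1 h2 (n1 _))).symm

include hne in
/-- The sum over all ways of permuting the legs of one kind, one of them being fixed. -/
theorem sum_pairUp_ofSubtype_eq_zero [Fintype {j // p j}] [DecidableEq {j // p j}]
    (hcard : Fintype.card {j // p j} = 2 * n + 2) (hp : ∀ j, p (τ j) ↔ p j) (o : {j // p j}) :
    ∑ π : Equiv.Perm {j // p j} with π o = o, eval A S n (-2 * n)
      (pairUp E ((Equiv.Perm.ofSubtype π).toEmbedding.trans ℓ) (fun _ => hℓ _) τ hτ) = 0 := by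
  have h1 : ∀ j, E.IsLeg (((Function.Embedding.subtype fun j => ¬ p j).trans ℓ) j) :=
    fun j => hℓ _
  have h2 : ∀ j : {j // ¬ p j}, τ.subtypePerm (fun j => not_congr (hp j)) (τ.subtypePerm
      (fun j => not_congr (hp j)) j) = j := by
    intro j
    apply Subtype.ext
    exact hτ j.1
  have h2' : ∀ j : {j // p j}, τ.subtypePerm hp (τ.subtypePerm hp j) = j := by
    intro j
    apply Subtype.ext
    exact hτ j.1
  have h3 : ∀ j, (pairUp E ((Function.Embedding.subtype fun j => ¬ p j).trans ℓ) h1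
        (τ.subtypePerm fun j => not_congr (hp j)) h2).IsLeg
      (((Function.Embedding.subtype p).trans ℓ) j) := by
    intro j
    rw [isLeg_pairUp h1 h2 fun j hj => hne j (congrArg Subtype.val hj)]
    refine ⟨hℓ _, ?_⟩
    rintro ⟨j', hj'⟩
    have h6 : j'.1 = j.1 := ℓ.injective hj'
    exact j'.2 (h6 ▸ j.2)
  -- The legs outside `p` are joined once and for all. Permuting the positions of the others by `π`
  -- amounts to conjugating their pairing by `π`, so the stabilizer sum applies to the partly joined
  -- diagram.
  refine Eq.trans (Finset.sum_congr rfl fun π _ => eval_pairUp_split hτ hp π h1 h2 h3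
    (conj_involutive h2' π) _) ?_
  exact sum_pairUp_stabilizer_eq_zero hcard h2' (fun j hj => hne j (congrArg Subtype.val hj)) o _ _ h3

end Averaging

/-! ### Averaging over placements with one fixed position -/

section Placement

variable {I J H : Type}

/-- The label-preserving placements of `J` on the elements of `H`, with `o` being placed on `q`. -/
def Placement (lab : J → I) (X : I → H → Prop) (o : J) (q : H) : Type :=
  {ℓ : J ↪ H // (∀ c, X (lab c) (ℓ c)) ∧ (∀ i h, X i h → h ∈ Set.range ℓ) ∧ ℓ o = q}

variable {lab : J → I} {X : I → H → Prop} {o : J} {q : H}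

/-- Permutations of the elements of `J` with the label of `o`, fixing `o`, act on placements. -/
def Placement.permute [DecidablePred fun c => lab c = lab o] (π : Equiv.Perm {c // lab c = lab o})
    (hπ : π ⟨o, rfl⟩ = ⟨o, rfl⟩) (ℓ : Placement lab X o q) : Placement lab X o q := by
  have hlab : ∀ c, lab (Equiv.Perm.ofSubtype π c) = lab c := by
    intro c
    by_cases hc : lab c = lab o
    · exact ((Equiv.Perm.ofSubtype_apply_of_mem π hc).symm ▸ (π ⟨c, hc⟩).2).trans hc.symm
    · rw [Equiv.Perm.ofSubtype_apply_of_not_mem π hc]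
  refine ⟨(Equiv.Perm.ofSubtype π).toEmbedding.trans ℓ.1, fun c => ?_, fun i h hh => ?_, ?_⟩
  · rw [← hlab c]
    exact ℓ.2.1 _
  · obtain ⟨c, rfl⟩ := ℓ.2.2.1 i h hh
    exact ⟨(Equiv.Perm.ofSubtype π).symm c,
      congrArg ℓ.1 ((Equiv.Perm.ofSubtype π).apply_symm_apply c)⟩
  · refine (congrArg ℓ.1 ?_).trans ℓ.2.2.2
    refine (Equiv.Perm.ofSubtype_apply_of_mem π (rfl : lab o = lab o)).trans ?_
    rw [hπ]

theorem Placement.permute_bijective [DecidablePred fun c => lab c = lab o] [Finite J] [Finite H]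
    (π : Equiv.Perm {c // lab c = lab o}) (hπ : π ⟨o, rfl⟩ = ⟨o, rfl⟩) :
    Function.Bijective (Placement.permute (X := X) (q := q) π hπ) := by
  have : Finite (Placement lab X o q) := Subtype.finite
  refine Finite.injective_iff_bijective.1 fun ℓ ℓ' h => Subtype.ext (DFunLike.ext _ _ fun c => ?_)
  have h1 := DFunLike.congr_fun (congrArg Subtype.val h) ((Equiv.Perm.ofSubtype π).symm c)
  change ℓ.1 (Equiv.Perm.ofSubtype π _) = ℓ'.1 (Equiv.Perm.ofSubtype π _) at h1
  rwa [Equiv.apply_symm_apply] at h1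

/-- Permutations of the colour of `o` that fix `o` act on the placements by bijections, so the sum
equals its average over them. After exchanging the summations, the inner sum over permutations
vanishes for each placement. -/
theorem finsum_placement_eq_zero {L : Type} {A S : Set L} {n : ℕ} {E : Diagram L} [Finite J]
    [Finite H] (β : H ↪ E.H) (hβ : ∀ (ℓ : Placement lab X o q) j, E.IsLeg (ℓ.1.trans β j))
    {τ : Equiv.Perm J}
    (hτ : ∀ j, τ (τ j) = j) (hne : ∀ j, τ j ≠ j) (hlab : ∀ j, lab (τ j) = lab j)
    (hcard : Nat.card {c // lab c = lab o} = 2 * n + 2) :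
    ∑ᶠ ℓ : Placement lab X o q, eval A S n (-2 * n) (pairUp E (ℓ.1.trans β) (hβ ℓ) τ hτ) = 0 := by
  classical
  have := Fintype.ofFinite {c // lab c = lab o}
  have : Finite (Placement lab X o q) := Subtype.finite
  have := Fintype.ofFinite (Placement lab X o q)
  rw [Nat.card_eq_fintype_card] at hcard
  set f : Placement lab X o q → BLe A S n := fun ℓ =>
    eval A S n (-2 * n) (pairUp E (ℓ.1.trans β) (hβ ℓ) τ hτ) with hf
  set T : Finset (Equiv.Perm {c // lab c = lab o}) := {π | π ⟨o, rfl⟩ = ⟨o, rfl⟩} with hT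
  have h1 : ∀ π ∈ T, ∀ hπ : π ⟨o, rfl⟩ = ⟨o, rfl⟩, ∑ ℓ, f (Placement.permute π hπ ℓ) = ∑ ℓ, f ℓ :=
    fun π _ hπ => Fintype.sum_bijective _ (Placement.permute_bijective π hπ) _ _ fun _ => rfl
  have h2 : ∑ π ∈ T.attach, ∑ ℓ, f (Placement.permute π.1 (Finset.mem_filter.1 π.2).2 ℓ) = 0 := by
    rw [Finset.sum_comm]
    refine Finset.sum_eq_zero fun ℓ _ => ?_
    have key := sum_pairUp_ofSubtype_eq_zero (A := A) (S := S) (n := n) (hβ ℓ) hτ hne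
      (p := fun c => lab c = lab o) hcard (fun j => by rw [hlab]) ⟨o, rfl⟩
    rw [← Finset.sum_attach] at key
    exact key
  rw [finsum_eq_sum_of_fintype]
  have h3 : ∑ π ∈ T.attach, ∑ ℓ, f (Placement.permute π.1 (Finset.mem_filter.1 π.2).2 ℓ) =
      (T.card : ℚ) • ∑ ℓ, f ℓ := by
    rw [Finset.sum_congr rfl fun π _ => h1 π.1 π.2 _, Finset.sum_const, Finset.card_attach,
      Nat.cast_smul_eq_nsmul]
  rw [h3, smul_eq_zero] at h2
  refine h2.resolve_left ?_
  have : (1 : Equiv.Perm {c // lab c = lab o}) ∈ T := by simp [hT]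
  exact_mod_cast (Finset.card_pos.2 ⟨_, this⟩).ne'

end Placement

/-! ### Translating one more leg -/

section GraftIntegral

variable {μ n : ℕ} {D : Diagram (Lab μ)}

/-- Replaced legs are labelled by `X'` and inserted legs by `k`, so only the kept legs can receive
chords. -/
theorem isX_comb (c : D.Choice) (i : Fin μ) (y : CombHalf c.teeth) :
    (D.comb c.teeth c.newLabel Lab.k).IsX i y ↔
      ∃ h, combBase _ h = y ∧ D.IsX i h ∧ c.1 h = none := by
  have hlab : ∀ h, c.newLabel h = Lab.x i ↔ D.label h = Lab.x i ∧ c.1 h = none := by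
    intro h
    unfold Choice.newLabel
    rcases hc : c.1 h with _ | ⟨j, m⟩ <;> simp
  unfold IsX
  rw [isLeg_comb_iff]
  constructor
  · rintro ⟨⟨h, rfl, hh⟩ | ⟨t, rfl⟩, hl⟩
    · obtain ⟨h1, h2⟩ := (hlab h).1 hl
      exact ⟨h, rfl, ⟨hh, h1⟩, h2⟩
    · exact absurd hl (by simp)
  · rintro ⟨h, rfl, ⟨hh, h1⟩, h2⟩
    exact ⟨.inl ⟨h, rfl, hh⟩, (hlab h).2 ⟨h1, h2⟩⟩

/-- The half-edge `h` is a leg labelled `x_i` that is kept. -/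
def Choice.Kept (c : D.Choice) (i : Fin μ) (h : D.H) : Prop := D.IsX i h ∧ c.1 h = none

theorem intDiagram_graft (c : D.Choice) :
    intDiagram n (D.graft c) = chordCoeff μ n • ∑ᶠ γ : Chording n c.Kept,
      evalInt n (pairUp (D.comb c.teeth c.newLabel Lab.k) (γ.1.trans (combBase _))
        (γ.isLeg (isX_comb c)) (flip μ n) flip_flip) :=
  (isoGraft D c).intDiagram_eq.trans (intDiagram_eq (isX_comb c))

open Classical in
/-- A choice is changed at one leg. -/
noncomputable def Choice.set (c : D.Choice) (s : D.H) (hs : D.IsLeg s ∧ D.label s ∈ Lab.X μ)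
    (v : Option (Fin μ × ℕ)) : D.Choice :=
  ⟨Function.update c.1 s v, fun h hh => by
    by_cases h1 : h = s
    · rwa [h1]
    · rw [Function.update_of_ne h1] at hh
      exact c.2 h hh⟩

theorem Choice.set_self (c : D.Choice) (s : D.H) (hs : D.IsLeg s ∧ D.label s ∈ Lab.X μ)
    (v : Option (Fin μ × ℕ)) : (c.set s hs v).1 s = v := by
  classical exact Function.update_self (β := fun _ => Option (Fin μ × ℕ)) s v c.1

theorem Choice.set_of_ne (c : D.Choice) {s h : D.H} (hs : D.IsLeg s ∧ D.label s ∈ Lab.X μ)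
    (v : Option (Fin μ × ℕ)) (hh : h ≠ s) : (c.set s hs v).1 h = c.1 h := by
  classical exact Function.update_of_ne (β := fun _ => Option (Fin μ × ℕ)) hh v c.1

theorem IsX.mem {i : Fin μ} {h : D.H} (hh : D.IsX i h) : D.IsLeg h ∧ D.label h ∈ Lab.X μ :=
  ⟨hh.1, ⟨i, hh.2.symm⟩⟩

theorem Choice.kept_set_some (c : D.Choice) {s : D.H} (hs : D.IsLeg s ∧ D.label s ∈ Lab.X μ)
    (v : Fin μ × ℕ) (i : Fin μ) (h : D.H) :
    (c.set s hs (some v)).Kept i h ↔ c.Kept i h ∧ h ≠ s := by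
  unfold Choice.Kept
  by_cases hh : h = s
  · subst hh
    rw [c.set_self]
    simp
  · rw [c.set_of_ne _ _ hh]
    simp [hh]

theorem Choice.teeth_congr {c c' : D.Choice} {h h' : D.H} (hc : c.1 h = c'.1 h') :
    c.teeth h = c'.teeth h' := by
  unfold Choice.teeth
  rw [hc]

theorem Choice.newLabel_congr {c c' : D.Choice} {h : D.H} (hc : c.1 h = c'.1 h) :
    c.newLabel h = c'.newLabel h := by
  unfold Choice.newLabel
  rw [hc]

theorem Choice.teeth_of_none {c : D.Choice} {h : D.H} (hc : c.1 h = none) : c.teeth h = 0 := by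
  unfold Choice.teeth
  rw [hc]

theorem Choice.teeth_of_some {c : D.Choice} {h : D.H} {v : Fin μ × ℕ} (hc : c.1 h = some v) :
    c.teeth h = v.2 := by
  unfold Choice.teeth
  rw [hc]

theorem Choice.newLabel_of_some {c : D.Choice} {h : D.H} {v : Fin μ × ℕ} (hc : c.1 h = some v) :
    c.newLabel h = Lab.x' v.1 := by
  unfold Choice.newLabel
  rw [hc]

/-- The kept legs labelled by `i'`, together with the end of a strut if `i' = i`. -/
def Choice.KeptStrut (c : D.Choice) (i i' : Fin μ) : D.H ⊕ Bool → Prop :=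
  Sum.elim (c.Kept i') fun b => b = false ∧ i' = i

/-- The indices of the ends of chords and of one more chord indexed by `i`. -/
def chordLab {μ : ℕ} (n : ℕ) (i : Fin μ) : ChordEnd μ n ⊕ Bool → Fin μ :=
  Sum.elim (fun c => c.1.1) fun _ => i

/-- The `n` chords of colour `i` and the additional chord together have `2n + 2` ends. -/
theorem card_chordLab (i : Fin μ) :
    Nat.card {c // chordLab n i c = chordLab n i (.inr false)} = 2 * n + 2 := by
  have e : {c // chordLab n i c = chordLab n i (.inr false)} ≃ (Fin n × Bool) ⊕ Bool := by
    refine ⟨?_, ?_, ?_, ?_⟩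
    · rintro ⟨⟨⟨j, a⟩, b⟩ | b, _⟩
      · exact .inl (a, b)
      · exact .inr b
    · rintro (⟨a, b⟩ | b)
      · exact ⟨.inl ((i, a), b), rfl⟩
      · exact ⟨.inr b, rfl⟩
    · rintro ⟨⟨⟨j, a⟩, b⟩ | b, h⟩
      · obtain rfl : j = i := h
        rfl
      · rfl
    · rintro (⟨a, b⟩ | b) <;> rfl
  rw [Nat.card_congr e]
  simp
  ring

section

variable (c : D.Choice) (i : Fin μ) (v : Fin μ × ℕ)

/-- A placement of chords that avoids the leg `s`, as a placement of one more chord. -/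
def toPlacement (x : Σ s : {s // c.Kept i s}, Chording n (c.set s.1 s.2.1.mem (some v)).Kept) :
    Placement (chordLab n i) (c.KeptStrut i) (.inr false) (.inr false : D.H ⊕ Bool) := by
  obtain ⟨⟨s, hs⟩, γ⟩ := x
  have hγ : ∀ a, γ.1 a ≠ s := fun a => ((c.kept_set_some _ _ _ _).1 (γ.2.1 a)).2
  -- The additional chord runs from the free end of the strut to the leg `s`.
  refine ⟨⟨Sum.elim (fun a => .inl (γ.1 a)) fun b => bif b then .inl s else .inr false, ?_⟩,
    ?_, ?_, rfl⟩
  · rintro (a | _ | _) (b | _ | _) hab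
    · exact congrArg Sum.inl (γ.1.injective (Sum.inl_injective hab))
    · exact (Sum.inl_ne_inr hab).elim
    · exact (hγ a (Sum.inl_injective hab)).elim
    · exact (Sum.inr_ne_inl hab).elim
    · rfl
    · exact (Sum.inr_ne_inl hab).elim
    · exact (hγ b (Sum.inl_injective hab).symm).elim
    · exact (Sum.inl_ne_inr hab).elim
    · rfl
  · rintro (a | _ | _)
    · exact ((c.kept_set_some _ _ _ _).1 (γ.2.1 a)).1
    · exact ⟨rfl, rfl⟩
    · exact hs
  · rintro i' (h | b) hh
    · by_cases h1 : h = s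
      · exact ⟨.inr true, congrArg Sum.inl h1.symm⟩
      · obtain ⟨a, rfl⟩ := γ.2.2 i' h ((c.kept_set_some _ _ _ _).2 ⟨hh, h1⟩)
        exact ⟨.inl a, rfl⟩
    · obtain ⟨rfl, _⟩ := hh
      exact ⟨.inr false, rfl⟩

/-- The leg `s` is recovered as the position of the other end of the additional chord. Hence the
choice of `s` and the placement of the `n` chords per colour merge into one placement. -/
theorem toPlacement_bijective : Function.Bijective (toPlacement (n := n) c i v) := by
  constructor
  · rintro ⟨⟨s, hs⟩, γ⟩ ⟨⟨s', hs'⟩, γ'⟩ h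
    have h1 := fun a => DFunLike.congr_fun (congrArg Subtype.val h) a
    obtain rfl : s = s' := Sum.inl_injective (h1 (.inr true))
    obtain rfl : γ = γ' :=
      Subtype.ext (DFunLike.ext _ _ fun a => Sum.inl_injective (h1 (.inl a)))
    rfl
  · intro ℓ
    have h1 : ∀ a, a ≠ .inr false → ∃ h : D.H, ℓ.1 a = .inl h ∧ c.Kept (chordLab n i a) h := by
      intro a ha
      have h2 := ℓ.2.1 a
      rcases h3 : ℓ.1 a with h | b
      · rw [h3] at h2
        exact ⟨h, rfl, h2⟩
      · rw [h3] at h2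
        obtain ⟨rfl, _⟩ := h2
        exact (ha (ℓ.1.injective (h3.trans ℓ.2.2.2.symm))).elim
    obtain ⟨s, hs, hsK⟩ := h1 (.inr true) (by simp)
    choose φ hφ hφK using fun a : ChordEnd μ n => h1 (.inl a) (by simp)
    have hne : ∀ a, φ a ≠ s := by
      intro a ha
      have h2 := (hφ a).trans ((congrArg Sum.inl ha).trans hs.symm)
      exact Sum.inl_ne_inr (ℓ.1.injective h2)
    refine ⟨⟨⟨s, hsK⟩, ⟨⟨φ, fun a b hab => ?_⟩, fun a => ?_, ?_⟩⟩, ?_⟩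
    · exact Sum.inl_injective (ℓ.1.injective ((hφ a).trans ((congrArg Sum.inl hab).trans
        (hφ b).symm)))
    · exact (c.kept_set_some _ _ _ _).2 ⟨hφK a, hne a⟩
    · intro i' h hh
      obtain ⟨hK, hs'⟩ := (c.kept_set_some _ _ _ _).1 hh
      obtain ⟨a, ha⟩ := ℓ.2.2.1 i' (.inl h) hK
      rcases a with a | _ | _
      · exact ⟨a, Sum.inl_injective ((hφ a).symm.trans ha)⟩
      · exact (Sum.inr_ne_inl (ℓ.2.2.2.symm.trans ha)).elim
      · exact (hs' (Sum.inl_injective (ha.symm.trans hs))).elim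
    · refine Subtype.ext (DFunLike.ext _ _ ?_)
      rintro (a | _ | _)
      · exact (hφ a).symm
      · exact ℓ.2.2.2.symm
      · exact hs.symm

/-- Replacing the kept legs labelled `x_i` one by one in the same way gives zero in total. -/
theorem finsum_intDiagram_graft_set :
    ∑ᶠ s : {s // c.Kept i s}, intDiagram n (D.graft (c.set s.1 s.2.1.mem (some v))) = 0 := by
  have := D.finite
  simp_rw [intDiagram_graft]
  rw [← smul_finsum]
  have : ∀ s : {s // c.Kept i s}, Finite (Chording n (c.set s.1 s.2.1.mem (some v)).Kept) :=
    fun s => inferInstance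
  have hβ : ∀ (ℓ : Placement (chordLab n i) (c.KeptStrut i) (.inr false)
      (.inr false : D.H ⊕ Bool)) j, (D.combStrut c.teeth v.2 c.newLabel (Lab.x' v.1) Lab.k).IsLeg
        (ℓ.1.trans (combBase _) j) := by
    intro ℓ j
    refine (isLeg_comb_base (D := D.withStrut (Lab.x' v.1)) _).2 ?_
    have h1 := ℓ.2.1 j
    rcases h2 : ℓ.1 j with h | b
    · rw [h2] at h1
      exact congrArg Sum.inl h1.1.1
    · rfl
  have hτ : ∀ j, (Equiv.sumCongr (flip μ n) Equiv.boolNot)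
      ((Equiv.sumCongr (flip μ n) Equiv.boolNot) j) = j := by
    rintro (a | b)
    · exact congrArg Sum.inl (flip_flip a)
    · simp
  have hne : ∀ j, (Equiv.sumCongr (flip μ n) Equiv.boolNot) j ≠ j := by
    rintro (a | b) h
    · exact flip_ne a (Sum.inl_injective h)
    · simp at h
  have hlab : ∀ j, chordLab n i ((Equiv.sumCongr (flip μ n) Equiv.boolNot) j) =
      chordLab n i j := by rintro (a | b) <;> rfl
  have key := finsum_placement_eq_zero (A := Lab.X' μ ∪ Lab.K μ) (S := Lab.K μ) (n := n)
    (X := c.KeptStrut i) (q := .inr false)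
    (E := D.combStrut c.teeth v.2 c.newLabel (Lab.x' v.1) Lab.k) (combBase _) hβ hτ hne hlab (card_chordLab i)
  -- The vanishing sum over placements is rewritten as a double sum over the translated leg `s` and
  -- the chordings of the remaining legs.
  rw [← finsum_comp_equiv (Equiv.ofBijective _ (toPlacement_bijective (n := n) c i v))] at key
  refine Eq.trans ?_ ((congrArg (chordCoeff μ n • ·) key).trans (smul_zero _))
  refine congrArg (chordCoeff μ n • ·) ?_
  have := Fintype.ofFinite {s // c.Kept i s}
  have := fun s : {s // c.Kept i s} =>
    Fintype.ofFinite (Chording n (c.set s.1 s.2.1.mem (some v)).Kept)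
  rw [finsum_eq_sum_of_fintype, finsum_eq_sum_of_fintype, Fintype.sum_sigma]
  refine Finset.sum_congr rfl fun s _ => ?_
  rw [finsum_eq_sum_of_fintype]
  refine Finset.sum_congr rfl fun γ _ => ?_
  have hs1 := c.set_self s.1 s.2.1.mem (some v)
  have hs2 := fun (h : D.H) (hh : h ≠ s.1) => c.set_of_ne s.2.1.mem (some v) hh
  -- Away from `s` the choice is `c`, which keeps `s`; at `s` the number of teeth and the label are
  -- those of the strut.
  exact eval_pairUp_comb (fun h hh => Choice.teeth_congr (hs2 h hh))
    (fun h hh => Choice.newLabel_congr (hs2 h hh)) Lab.k (Choice.teeth_of_none s.2.2)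
    (Choice.teeth_of_some hs1) (Choice.newLabel_of_some hs1) _ flip_flip s.2.1.1
    (fun ⟨a, ha⟩ => ((c.kept_set_some _ _ _ _).1 (γ.2.1 a)).2 ha) (fun _ => rfl) rfl rfl _ hτ

end

end GraftIntegral

/-! ### Translation invariance for a single diagram -/

section Choices

variable {μ n : ℕ} {D : Diagram (Lab μ)}

/-- The ends of the `n` chords of colour `i` exhaust the elements of that colour, so a placement
forces their number. -/
theorem Chording.card_eq {H : Type} {X : Fin μ → H → Prop} (hX : ∀ i i' h, X i h → X i' h → i = i')
    (γ : Chording n X) (i : Fin μ) : Nat.card {h // X i h} = 2 * n := by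
  let φ : Fin n × Bool → {h // X i h} := fun a => ⟨γ.1 ((i, a.1), a.2), γ.2.1 ((i, a.1), a.2)⟩
  have hφ : Function.Bijective φ := by
    constructor
    · intro a b hab
      have h1 := γ.1.injective (congrArg Subtype.val hab)
      exact Prod.ext (congrArg (fun c : ChordEnd μ n => c.1.2) h1) (congrArg (fun c : ChordEnd μ n => c.2) h1)
    · rintro ⟨h, hh⟩
      obtain ⟨⟨⟨j, a⟩, b⟩, rfl⟩ := γ.2.2 i h hh
      obtain rfl : j = i := hX _ _ _ (γ.2.1 ((j, a), b)) hh
      exact ⟨(a, b), rfl⟩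
  rw [← Nat.card_congr (Equiv.ofBijective φ hφ)]
  simp [mul_comm]

theorem IsX.unique {i i' : Fin μ} {h : D.H} (h1 : D.IsX i h) (h2 : D.IsX i' h) : i = i' :=
  Lab.x.inj (h1.2.symm.trans h2.2)

theorem intDiagram_eq_zero_of_card {i : Fin μ} (h : Nat.card {h // D.IsX i h} ≠ 2 * n) :
    intDiagram n D = 0 := by
  rw [intDiagram_eq_self, finsum_eq_zero_of_forall_eq_zero, smul_zero]
  exact fun γ => (h (γ.card_eq (X := D.IsX) (fun _ _ _ h1 h2 => IsX.unique h1 h2) i)).elim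

theorem intDiagram_graft_eq_zero_of_card {c : D.Choice} {i : Fin μ}
    (h : Nat.card {h // c.Kept i h} ≠ 2 * n) : intDiagram n (D.graft c) = 0 := by
  rw [intDiagram_graft, finsum_eq_zero_of_forall_eq_zero, smul_zero]
  exact fun γ => (h (γ.card_eq (X := c.Kept) (fun _ _ _ h1 h2 => IsX.unique h1.1 h2.1) i)).elim

/-- The total number of inserted legs. -/
noncomputable def Choice.weight (c : D.Choice) : ℕ := Nat.card (Σ h, Fin (c.teeth h))

theorem Choice.weight_eq_sum [Fintype D.H] (c : D.Choice) : c.weight = ∑ h, c.teeth h := by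
  unfold Choice.weight
  simp

theorem degree_graft (c : D.Choice) : (D.graft c).degree = D.degree + c.weight :=
  (isoGraft D c).degree_eq.trans degree_comb

theorem Choice.weight_set {c : D.Choice} {s : D.H} (hs : D.IsLeg s ∧ D.label s ∈ Lab.X μ)
    (hc : c.1 s = none) (v : Fin μ × ℕ) : (c.set s hs (some v)).weight = c.weight + v.2 := by
  classical
  have := D.finite
  have := Fintype.ofFinite D.H
  rw [Choice.weight_eq_sum, Choice.weight_eq_sum, ← Finset.add_sum_erase _ _ (Finset.mem_univ s),
    ← Finset.add_sum_erase _ c.teeth (Finset.mem_univ s), Choice.teeth_of_some (c.set_self _ _ _),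
    Choice.teeth_of_none hc, zero_add, add_comm]
  refine congrArg (· + _) (Finset.sum_congr rfl fun h hh => ?_)
  exact Choice.teeth_congr (c.set_of_ne _ _ (Finset.ne_of_mem_erase hh))

/-- The contribution of a leg labelled `l` to the coefficient of a choice. -/
noncomputable def legCoeff (M : Matrix (Fin μ) (Fin μ) (PowerSeries ℚ)) :
    Lab μ → Option (Fin μ × ℕ) → ℚ
  | Lab.x i, some (j, m) => PowerSeries.coeff m (M i j)
  | _, _ => 1

theorem Choice.coeff_eq_prod [Fintype D.H] (M : Matrix (Fin μ) (Fin μ) (PowerSeries ℚ))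
    (c : D.Choice) : c.coeff M = ∏ h, legCoeff M (D.label h) (c.1 h) :=
  finprod_eq_prod_of_fintype _

/-- The factor depends on `s` only through its colour `i`, so it is common to all terms when `s`
runs over the kept legs of one colour. -/
theorem Choice.coeff_set (M : Matrix (Fin μ) (Fin μ) (PowerSeries ℚ)) {c : D.Choice} {s : D.H}
    {i : Fin μ} (hs : D.IsX i s) (hc : c.1 s = none) (v : Fin μ × ℕ) :
    (c.set s hs.mem (some v)).coeff M = PowerSeries.coeff v.2 (M i v.1) * c.coeff M := by
  classical
  have := D.finite
  have := Fintype.ofFinite D.H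
  have h1 : ∀ h, legCoeff M (D.label h) ((c.set s hs.mem (some v)).1 h) =
      (if h = s then PowerSeries.coeff v.2 (M i v.1) else 1) * legCoeff M (D.label h) (c.1 h) := by
    intro h
    split_ifs with hh
    · rw [hh, c.set_self, hc, hs.2]
      exact (mul_one _).symm
    · rw [c.set_of_ne _ _ hh, one_mul]
  rw [Choice.coeff_eq_prod, Choice.coeff_eq_prod, Finset.prod_congr rfl fun h _ => h1 h,
    Finset.prod_mul_distrib, Finset.prod_ite_eq' , if_pos (Finset.mem_univ s)]

/-- Each leg receives at most `T` teeth, so nothing is lost by recording their number in `Fin (T +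
1)`. -/
theorem finite_choices (D : Diagram (Lab μ)) (T : ℕ) : {c : D.Choice | c.weight ≤ T}.Finite := by
  classical
  have := D.finite
  have := Fintype.ofFinite D.H
  let f : {c : D.Choice | c.weight ≤ T} → D.H → Option (Fin μ × Fin (T + 1)) := fun c h =>
    (c.1.1 h).map fun v => (v.1, Fin.ofNat (T + 1) v.2)
  have hf : Function.Injective f := by
    intro c c' hcc
    refine Subtype.ext (Subtype.ext (funext fun h => ?_))
    have h1 : ∀ c : {c : D.Choice | c.weight ≤ T}, c.1.teeth h < T + 1 := fun c => by
      have h2 := c.2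
      rw [Set.mem_ofPred_eq, Choice.weight_eq_sum] at h2
      exact Nat.lt_succ_of_le
        ((Finset.single_le_sum (fun _ _ => Nat.zero_le _) (Finset.mem_univ h)).trans h2)
    have h2 := congrFun hcc h
    simp only [f] at h2
    rcases h3 : c.1.1 h with _ | v <;> rcases h4 : c'.1.1 h with _ | v'
    · rfl
    · simp [h3, h4] at h2
    · simp [h3, h4] at h2
    · have h5 := h1 c
      have h6 := h1 c'
      rw [Choice.teeth_of_some h3] at h5
      rw [Choice.teeth_of_some h4] at h6
      simp only [h3, h4, Option.map_some, Option.some.injEq, Prod.mk.injEq] at h2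
      have h7 := congrArg Fin.val h2.2
      simp only [Fin.ofNat, Nat.mod_eq_of_lt h5, Nat.mod_eq_of_lt h6] at h7
      exact congrArg some (Prod.ext h2.1 h7)
  exact Finite.of_injective f hf

/-- The choices with at most `T` inserted legs. -/
noncomputable def choicesLe (D : Diagram (Lab μ)) (T : ℕ) : Finset D.Choice :=
  (finite_choices D T).toFinset

theorem mem_choicesLe {T : ℕ} {c : D.Choice} : c ∈ choicesLe D T ↔ c.weight ≤ T := by
  simp [choicesLe]

open Classical in
/-- A choice is changed so that the leg `s` is kept. -/
noncomputable def Choice.clear (c : D.Choice) (s : D.H) : D.Choice :=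
  ⟨Function.update c.1 s none, fun h hh => by
    by_cases h1 : h = s
    · rw [h1, Function.update_self] at hh
      exact absurd rfl hh
    · rw [Function.update_of_ne h1] at hh
      exact c.2 h hh⟩

theorem Choice.clear_self (c : D.Choice) (s : D.H) : (c.clear s).1 s = none := by
  classical exact Function.update_self (β := fun _ => Option (Fin μ × ℕ)) s none c.1

theorem Choice.clear_of_ne (c : D.Choice) {s h : D.H} (hh : h ≠ s) :
    (c.clear s).1 h = c.1 h := by
  classical exact Function.update_of_ne (β := fun _ => Option (Fin μ × ℕ)) hh none c.1

theorem Choice.clear_set (c : D.Choice) {s : D.H} (hs : D.IsLeg s ∧ D.label s ∈ Lab.X μ)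
    (hc : c.1 s = none) (v : Option (Fin μ × ℕ)) : (c.set s hs v).clear s = c := by
  refine Subtype.ext (funext fun h => ?_)
  by_cases hh : h = s
  · rw [hh, Choice.clear_self, hc]
  · rw [Choice.clear_of_ne _ hh, c.set_of_ne _ _ hh]

theorem Choice.set_clear (c : D.Choice) {s : D.H} (hs : D.IsLeg s ∧ D.label s ∈ Lab.X μ)
    {v : Option (Fin μ × ℕ)} (hc : c.1 s = v) : (c.clear s).set s hs v = c := by
  refine Subtype.ext (funext fun h => ?_)
  by_cases hh : h = s
  · rw [hh, Choice.set_self, hc]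
  · rw [Choice.set_of_ne _ _ _ hh, Choice.clear_of_ne _ hh]

/-- The choice that keeps all legs. -/
def Choice.keep (D : Diagram (Lab μ)) : D.Choice := ⟨fun _ => none, fun _ h => absurd rfl h⟩

theorem Choice.weight_keep : (Choice.keep D).weight = 0 := by
  have := D.finite
  have := Fintype.ofFinite D.H
  rw [Choice.weight_eq_sum]
  exact Finset.sum_eq_zero fun _ _ => rfl

theorem Choice.coeff_keep (M : Matrix (Fin μ) (Fin μ) (PowerSeries ℚ)) :
    (Choice.keep D).coeff M = 1 := by
  unfold Choice.coeff
  refine finprod_eq_one_of_forall_eq_one fun h => ?_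
  rcases D.label h <;> rfl

/-- Without teeth, the inclusion of the original half-edges is an isomorphism. -/
theorem intDiagram_graft_keep : intDiagram n (D.graft (Choice.keep D)) = intDiagram n D := by
  refine (isoGraft D _).intDiagram_eq.trans (Iso.intDiagram_eq (Iso.symm
    ⟨Equiv.ofBijective (combBase _) ⟨(combBase _).injective, ?_⟩, fun h => ?_, fun h => rfl,
      fun h _ => rfl⟩))
  · rintro (⟨h, i⟩ | ⟨⟨h, i⟩, b⟩)
    · refine ⟨h, combHalf_ext rfl ?_⟩
      have := i.2
      change i.1 < 0 + 1 at this
      change 0 = i.1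
      omega
    · exact i.elim0
  · exact (comb_e_last (D := D) (m := (Choice.keep D).teeth) (h := h) (i := 0)
      (Nat.lt_irrefl 0)).symm

-- Double counting of pairs formed by a choice and a translated `x_i`-leg. Undoing the translation
-- of that leg sorts the pairs into families in which one more leg is translated in a prescribed
-- way, and each family sums to zero.
open Classical in
theorem sum_choices_card_smul (M : Matrix (Fin μ) (Fin μ) (PowerSeries ℚ)) (T : ℕ) (i : Fin μ) :
    ∑ c ∈ choicesLe D T, (Nat.card {s // D.IsX i s ∧ c.1 s ≠ none} : ℚ) •
      c.coeff M • intDiagram n (D.graft c) = 0 := by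
  have := D.finite
  have := Fintype.ofFinite D.H
  let F : D.Choice → BLe (Lab.X' μ ∪ Lab.K μ) (Lab.K μ) n := fun c =>
    c.coeff M • intDiagram n (D.graft c)
  let W : Finset (D.Choice × D.H) :=
    (choicesLe D T ×ˢ Finset.univ).filter fun x => D.IsX i x.2 ∧ x.1.1 x.2 ≠ none
  have hW : ∀ x, x ∈ W ↔ x.1.weight ≤ T ∧ D.IsX i x.2 ∧ x.1.1 x.2 ≠ none := fun x => by
    simp [W, mem_choicesLe]
  have h1 : ∑ c ∈ choicesLe D T, (Nat.card {s // D.IsX i s ∧ c.1 s ≠ none} : ℚ) • F c =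
      ∑ x ∈ W, F x.1 := by
    rw [Finset.sum_filter, Finset.sum_product]
    refine Finset.sum_congr rfl fun c _ => ?_
    change _ = ∑ a : D.H, if D.IsX i a ∧ c.1 a ≠ none then F c else 0
    rw [← Finset.sum_filter, Finset.sum_const, Nat.card_eq_fintype_card, Fintype.card_subtype,
      Nat.cast_smul_eq_nsmul]
  refine h1.trans ?_
  let g : D.Choice × D.H → D.Choice × Option (Fin μ × ℕ) := fun x => (x.1.clear x.2, x.1.1 x.2)
  rw [← Finset.sum_fiberwise_of_maps_to (t := W.image g) fun x hx => Finset.mem_image_of_mem g hx]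
  refine Finset.sum_eq_zero fun y hy => ?_
  obtain ⟨⟨c', s'⟩, hx', rfl⟩ := Finset.mem_image.1 hy
  obtain ⟨hT, hs', hc'⟩ := (hW _).1 hx'
  obtain ⟨v, hv⟩ := Option.ne_none_iff_exists'.1 hc'
  change c'.1 s' = some v at hv
  set c₀ := c'.clear s' with hc₀
  -- The weight is the same throughout a family, so the truncation at `T` contains a family
  -- entirely.
  have hT' : c₀.weight + v.2 ≤ T := by
    rw [← Choice.weight_set hs'.mem (c'.clear_self s'), c'.set_clear hs'.mem hv]
    exact hT
  -- The fibre consists of all ways of translating one further leg `s` of colour `i`, kept by `c₀`,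
  -- by the same value `v`.
  have hfib : W.filter (fun x => g x = g (c', s')) = Finset.univ.image
      fun s : {s // c₀.Kept i s} => (c₀.set s.1 s.2.1.mem (some v), s.1) := by
    have hg : g (c', s') = (c₀, some v) := Prod.ext rfl hv
    ext ⟨c, s⟩
    simp only [Finset.mem_filter, hW, hg, Finset.mem_image, Finset.mem_univ, true_and]
    constructor
    · rintro ⟨⟨h2, h3, h4⟩, h5⟩
      have h6 : c.clear s = c₀ := congrArg Prod.fst h5
      have h7 : c.1 s = some v := congrArg Prod.snd h5
      refine ⟨⟨s, h3, by rw [← h6, c.clear_self]⟩, ?_⟩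
      refine Prod.ext ?_ rfl
      change c₀.set s h3.mem (some v) = c
      rw [← h6]
      exact c.set_clear h3.mem h7
    · rintro ⟨s₁, h2⟩
      obtain rfl : c₀.set s₁.1 s₁.2.1.mem (some v) = c := congrArg Prod.fst h2
      obtain rfl : s₁.1 = s := congrArg Prod.snd h2
      refine ⟨⟨?_, s₁.2.1, ?_⟩, Prod.ext ?_ ?_⟩
      · rw [Choice.weight_set _ s₁.2.2]
        exact hT'
      · rw [c₀.set_self]
        simp
      · exact c₀.clear_set s₁.2.1.mem s₁.2.2 (some v)
      · exact c₀.set_self s₁.1 s₁.2.1.mem (some v)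
  rw [hfib, Finset.sum_image fun a _ b _ hab => Subtype.ext (congrArg Prod.snd hab)]
  have key := finsum_intDiagram_graft_set (n := n) c₀ i v
  rw [finsum_eq_sum_of_fintype] at key
  refine Eq.trans ?_ ((congrArg ((PowerSeries.coeff v.2 (M i v.1) * c₀.coeff M) • ·) key).trans
    (smul_zero _))
  rw [Finset.smul_sum]
  refine Finset.sum_congr rfl fun s _ => ?_
  change (c₀.set s.1 s.2.1.mem (some v)).coeff M • _ = _
  rw [Choice.coeff_set M s.2.1 s.2.2]

/-- Formal integration of a single diagram is invariant under translation. -/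
theorem sum_choices (M : Matrix (Fin μ) (Fin μ) (PowerSeries ℚ)) (T : ℕ) :
    ∑ c ∈ choicesLe D T, c.coeff M • intDiagram n (D.graft c) = intDiagram n D := by
  classical
  have := D.finite
  have := Fintype.ofFinite D.H
  -- If no colour has more than `2n` legs, a choice that replaces some leg keeps fewer than `2n` of
  -- its colour, and its integral is zero.
  by_cases hcard : ∀ i, Nat.card {h // D.IsX i h} ≤ 2 * n
  · rw [Finset.sum_eq_single (Choice.keep D)]
    · rw [Choice.coeff_keep, one_smul, intDiagram_graft_keep]
    · intro c _ hc
      have h1 : ∃ h, c.1 h ≠ none := by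
        by_contra h2
        push Not at h2
        exact hc (Subtype.ext (funext h2))
      obtain ⟨h, hh⟩ := h1
      obtain ⟨hl, i, hi⟩ := c.2 h hh
      rw [intDiagram_graft_eq_zero_of_card (i := i), smul_zero]
      refine ne_of_lt (lt_of_lt_of_le ?_ (hcard i))
      rw [Nat.card_eq_fintype_card, Nat.card_eq_fintype_card]
      refine Fintype.card_lt_of_injective_of_notMem (fun x => ⟨x.1, x.2.1⟩)
        (fun a b hab => Subtype.ext (Subtype.mk.inj hab)) (b := ⟨h, hl, hi.symm⟩) ?_
      rintro ⟨x, hx⟩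
      have hx' : x.1 = h := Subtype.mk.inj hx
      exact hh (hx' ▸ x.2.2)
    · intro h
      exact (h (mem_choicesLe.2 (Choice.weight_keep.trans_le (Nat.zero_le _)))).elim
  · push Not at hcard
    obtain ⟨i, hi⟩ := hcard
    rw [intDiagram_eq_zero_of_card hi.ne']
    have h1 := sum_choices_card_smul (n := n) (D := D) M T i
    -- A nonzero integral requires exactly `2n` kept legs, so the number of replaced legs may be
    -- taken constant. The constant is positive in this case and can be cancelled.
    have h2 : ∀ c ∈ choicesLe D T, (Nat.card {s // D.IsX i s ∧ c.1 s ≠ none} : ℚ) •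
        c.coeff M • intDiagram n (D.graft c) =
        ((Nat.card {h // D.IsX i h} : ℚ) - 2 * n) • c.coeff M • intDiagram n (D.graft c) := by
      intro c _
      by_cases hk : Nat.card {h // c.Kept i h} = 2 * n
      · refine congrArg (· • _) ?_
        have h3 : Nat.card {h // D.IsX i h} =
            Nat.card {h // c.Kept i h} + Nat.card {s // D.IsX i s ∧ c.1 s ≠ none} := by
          simp only [Nat.card_eq_fintype_card, Fintype.card_subtype, Choice.Kept]
          rw [← Finset.card_filter_add_card_filter_not (s := Finset.univ.filter (D.IsX i))
            (fun h => c.1 h = none), Finset.filter_filter, Finset.filter_filter]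
        rw [h3, hk]
        push_cast
        ring
      · rw [intDiagram_graft_eq_zero_of_card hk, smul_zero, smul_zero, smul_zero]
    rw [Finset.sum_congr rfl h2, ← Finset.smul_sum, smul_eq_zero] at h1
    refine h1.resolve_left (sub_ne_zero.2 ?_)
    exact_mod_cast hi.ne'

end Choices

/-! ### Degree bounds and passage to series -/

section Series

variable {μ n : ℕ} {D : Diagram (Lab μ)}

/-- The chords absorb `2nμ` legs and thus lower the degree by `nμ`; what remains has degree greater
than `n`. -/
theorem intDiagram_eq_zero_of_degree (h : n + n * μ < D.degree) : intDiagram n D = 0 := by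
  have := D.finite
  rw [intDiagram_eq_self, finsum_eq_zero_of_forall_eq_zero, smul_zero]
  intro γ
  have hγ := fun c => (γ.2.1 c).1
  have h1 : Nat.card {h : D.H // D.IsLeg h} =
      Nat.card {h : D.H // D.IsLeg h ∧ h ∉ Set.range γ.1} + 2 * (n * μ) := by
    classical
    have h2 : Nat.card {h : D.H // D.IsLeg h ∧ h ∈ Set.range γ.1} = 2 * (n * μ) := by
      rw [← Nat.card_congr (Equiv.ofBijective (fun c : ChordEnd μ n =>
        (⟨γ.1 c, hγ c, c, rfl⟩ : {h : D.H // D.IsLeg h ∧ h ∈ Set.range γ.1}))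
        ⟨fun a b hab => γ.1.injective (congrArg Subtype.val hab), ?_⟩)]
      · simp
        ring
      · rintro ⟨_, _, c, rfl⟩
        exact ⟨c, rfl⟩
    have := Fintype.ofFinite D.H
    rw [← h2]
    simp only [Nat.card_eq_fintype_card, Fintype.card_subtype]
    rw [← Finset.card_filter_add_card_filter_not (s := Finset.univ.filter D.IsLeg)
      (fun h => h ∉ Set.range γ.1), Finset.filter_filter, Finset.filter_filter]
    simp only [not_not]
  refine (congrArg _ (cls_of_notMem _ _ _ ?_)).trans (smul_zero _)
  intro hmem
  have h3 := hmem.2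
  rw [degree_withoutLoops, degree_pairUp hγ flip_flip flip_ne] at h3
  unfold degree at h
  omega

/-- Formal integration of combinations of diagrams in degree `d`. -/
noncomputable def intGens (n : ℕ) (P : Set (Diagram (Lab μ))) :
    (P →₀ ℚ) →ₗ[ℚ] BLe (Lab.X' μ ∪ Lab.K μ) (Lab.K μ) n :=
  Finsupp.linearCombination ℚ fun D => intDiagram n D.1

theorem integral_eq_sum (F : SeriesO (Lab μ)) : integral n F =
    ∑ d ∈ Finset.range (n + n * μ + 1), intGens n {D | D.degree = d} (F d) := by
  refine finsum_eq_sum_of_support_subset _ fun d hd => ?_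
  rw [Finset.coe_range, Set.mem_Iio, Nat.lt_succ_iff]
  by_contra hlt
  refine hd (Finset.sum_eq_zero fun D _ => ?_)
  refine (congrArg _ (intDiagram_eq_zero_of_degree ?_)).trans (smul_zero _)
  rw [D.2]
  omega

theorem intGens_toO (F : Series (Lab.X μ ∪ Lab.K μ)) (d : ℕ) :
    intGens n {D | D.degree = d} (F.toO d) = intGens n (gensEq (Lab.X μ ∪ Lab.K μ) d) (F d) :=
  Finsupp.linearCombination_mapDomain ℚ _ _

/-- Integration kills all relators, hence their span. -/
theorem intGens_eq_of_mk_eq {P : Set (Diagram (Lab μ))} {a b : P →₀ ℚ}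
    (h : (Submodule.Quotient.mk a : Space P (Lab.K μ)) = Submodule.Quotient.mk b) :
    intGens n P a = intGens n P b := by
  rw [Submodule.Quotient.eq] at h
  rw [← sub_eq_zero, ← map_sub]
  have h1 : Submodule.span ℚ {r : P →₀ ℚ | Relator (Lab.K μ) (r.mapDomain Subtype.val)} ≤
      LinearMap.ker (intGens n P) := by
    rw [Submodule.span_le]
    intro r hr
    have h2 := linearCombination_intDiagram_of_relator (n := n) hr
    rw [Finsupp.linearCombination_mapDomain] at h2
    exact h2
  exact h1 h

theorem degree_le_degree_graft (c : D.Choice) : D.degree ≤ (D.graft c).degree :=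
  (Nat.le_add_right _ _).trans_eq (degree_graft c).symm

/-- The part of degree `d` of the integral of the translation of a single diagram. -/
noncomputable def translatePart (n : ℕ) (M : Matrix (Fin μ) (Fin μ) (PowerSeries ℚ))
    (D : Diagram (Lab μ)) (d : ℕ) : BLe (Lab.X' μ ∪ Lab.K μ) (Lab.K μ) n :=
  ∑ c ∈ choicesLe D (n + n * μ - D.degree) with (D.graft c).degree = d,
    c.coeff M • intDiagram n (D.graft c)

/-- A choice raises the degree by its weight. The truncation of the weight therefore puts every
resulting degree within the range, and sorting by degree recovers the full sum over choices. -/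
theorem sum_translatePart (M : Matrix (Fin μ) (Fin μ) (PowerSeries ℚ))
    (hD : D.degree ≤ n + n * μ) :
    ∑ d ∈ Finset.range (n + n * μ + 1), translatePart n M D d = intDiagram n D := by
  unfold translatePart
  rw [Finset.sum_fiberwise_of_maps_to, sum_choices]
  intro c hc
  rw [mem_choicesLe] at hc
  rw [Finset.mem_range, degree_graft]
  omega

theorem translatePart_eq_zero (M : Matrix (Fin μ) (Fin μ) (PowerSeries ℚ)) {d : ℕ}
    (hD : d < D.degree) : translatePart n M D d = 0 := by
  refine Finset.sum_eq_zero fun c hc => ?_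
  have h1 := (Finset.mem_filter.1 hc).2
  have h2 := degree_le_degree_graft c
  omega

theorem finsum_graft (M : Matrix (Fin μ) (Fin μ) (PowerSeries ℚ)) {d : ℕ} (hd : d ≤ n + n * μ)
    (q : ℚ) :
    intGens n {D | D.degree = d} (∑ᶠ c : {c : D.Choice // (D.graft c).degree = d},
      Finsupp.single ⟨D.graft c.1, c.2⟩ (q * c.1.coeff M)) = q • translatePart n M D d := by
  classical
  -- A prescribed degree `d` bounds the weight, so this sum over infinitely many possible choices is
  -- a finite one within the truncation.
  have hw : ∀ c : D.Choice, (D.graft c).degree = d →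
      c ∈ choicesLe D (n + n * μ - D.degree) := by
    intro c hc
    rw [mem_choicesLe]
    rw [degree_graft] at hc
    omega
  let e : {c : D.Choice // (D.graft c).degree = d} ≃
      {c // c ∈ (choicesLe D (n + n * μ - D.degree)).filter fun c => (D.graft c).degree = d} :=
    Equiv.subtypeEquivRight fun c => by
      rw [Finset.mem_filter]
      exact ⟨fun h => ⟨hw c h, h⟩, fun h => h.2⟩
  have : Finite {c : D.Choice // (D.graft c).degree = d} := Finite.of_equiv _ e.symm
  rw [_root_.map_finsum _ (Set.toFinite _)]
  have h1 : ∀ c : {c : D.Choice // (D.graft c).degree = d},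
      intGens n {D | D.degree = d} (Finsupp.single ⟨D.graft c.1, c.2⟩ (q * c.1.coeff M)) =
        q • c.1.coeff M • intDiagram n (D.graft c.1) := fun c => by
    rw [smul_smul]
    exact Finsupp.linearCombination_single ℚ _ _
  rw [finsum_congr h1, ← finsum_comp_equiv e.symm, finsum_eq_sum_of_fintype,
    ← Finset.smul_sum]
  exact congrArg _ (Finset.sum_coe_sort _ fun c => c.coeff M • intDiagram n (D.graft c))

theorem integral_translate (M : Matrix (Fin μ) (Fin μ) (PowerSeries ℚ))
    (F : Series (Lab.X μ ∪ Lab.K μ)) : integral n (F.translate M) = integral n F.toO := by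
  rw [integral_eq_sum, integral_eq_sum]
  have h1 : ∀ d ∈ Finset.range (n + n * μ + 1),
      intGens n {D | D.degree = d} (F.translate M d) =
        ∑ d' ∈ Finset.range (n + n * μ + 1),
          (F d').sum fun D q => q • translatePart n M D.1 d := by
    intro d hd
    rw [Finset.mem_range] at hd
    have h2 : Finset.range (d + 1) ⊆ Finset.range (n + n * μ + 1) :=
      Finset.range_subset_range.2 hd
    -- The range of `d'` is made independent of `d`, in order to exchange the two sums. The added
    -- terms vanish, since translation never lowers the degree.
    rw [← Finset.sum_subset h2]
    · unfold Series.translate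
      rw [map_sum]
      refine Finset.sum_congr rfl fun d' _ => ?_
      rw [map_finsuppSum]
      exact Finset.sum_congr rfl fun D _ => finsum_graft M (by omega) _
    · intro d' _ hd'
      refine Finset.sum_eq_zero fun D _ => ?_
      have h3 := D.2.2
      rw [Finset.mem_range] at hd'
      exact (congrArg _ (translatePart_eq_zero M (by omega))).trans (smul_zero _)
  rw [Finset.sum_congr rfl h1, Finset.sum_comm]
  refine Finset.sum_congr rfl fun d' hd' => ?_
  rw [intGens_toO]
  unfold Finsupp.sum
  rw [Finset.sum_comm]
  refine Finset.sum_congr rfl fun D _ => ?_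
  rw [← Finset.smul_sum]
  refine congrArg _ (sum_translatePart M ?_)
  rw [D.2.2]
  exact Nat.lt_succ_iff.1 (Finset.mem_range.1 hd')

theorem integral_toO_congr {F₁ F₂ : Series (Lab.X μ ∪ Lab.K μ)}
    (h : F₁.toB (Lab.K μ) = F₂.toB (Lab.K μ)) : integral n F₁.toO = integral n F₂.toO := by
  rw [integral_eq_sum, integral_eq_sum]
  refine Finset.sum_congr rfl fun d _ => ?_
  rw [intGens_toO, intGens_toO]
  exact intGens_eq_of_mk_eq (congrFun h d)

end Series

end Diagram

theorem mainTheorem4 (μ n : ℕ) (M : Matrix (Fin μ) (Fin μ) (PowerSeries ℚ))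
    (F : Diagram.B (Lab.X μ ∪ Lab.K μ) (Lab.K μ))
    (F₁ F₂ : Diagram.Series (Lab.X μ ∪ Lab.K μ))
    (h₁ : F₁.toB (Lab.K μ) = F) (h₂ : F₂.toB (Lab.K μ) = F) :
    Diagram.integral n F₁.toO = Diagram.integral n (F₂.translate M) :=
  (Diagram.integral_toO_congr (h₁.trans h₂.symm)).trans (Diagram.integral_translate M F₂).symm
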